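/- Let $\mathbf k$ be a field of characteristic zero and let $S$ be a finite group, also regarded as a constant affine group scheme over $\mathbf k$. A pro-algebraic group is an affine group scheme over $\mathbf k$, and it is $\mathbf k$-prounipotent if it is an inverse limit of unipotent algebraic groups over $\mathbf k$ (equivalently, if each of its nonzero linear representations has a nonzero fixed vector). (1) Every extension of pro-algebraic groups over $\mathbf k$ $$1\longrightarrow U\longrightarrow H\longrightarrow S\longrightarrow 1$$ with $U$ $\mathbf k$-prounipotent splits: there is a morphism $S\to H$ of group schemes over $\mathbf k$ which is a section of $H\to S$. (2) Let $G$ be a group and let $\varphi:G\to S$ be a surjective morphism with finitely generated kernel. The $\mathbf k$-prounipotent completion of $\operatorname{Ker}\varphi$ is the initial morphism $\iota:\operatorname{Ker}\varphi\to(\operatorname{Ker}\varphi)(\mathbf k)$ from $\operatorname{Ker}\varphi$ to (the $\mathbf k$-points of) a $\mathbf k$-prounipotent group. The relative completion $\varphi(\mathbf k):G(\varphi,\mathbf k)\to S$ is the initial object of the category whose objects consist of a pro-algebraic group $G'$, a surjective morphism $\varphi':G'\to S$ with $\mathbf k$-prounipotent kernel, and a group morphism $\psi':G\to G'(\mathbf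 k)$ with $\varphi'\circ\psi'=\varphi$. Both exist, and there are an action of $S$ on $(\operatorname{Ker}\varphi)(\mathbf k)$ by automorphisms of pro-algebraic groups and an isomorphism of pro-algebraic groups $$G(\varphi,\mathbf k)\;\simeq\;(\operatorname{Ker}\varphi)(\mathbf k)\rtimes S$$ which commutes with the projections to $S$ and, on $\operatorname{Ker}\varphi$, identifies the canonical morphism $G\to G(\varphi,\mathbf k)$ with $\iota$. -/

import Mathlib

open scoped TensorProduct

universe u

noncomputable section

/-! Affine group schemes (that is, pro-algebraic groups) over a field `k` are represented by their
coordinate rings, the commutative Hopf algebras over `k`. A morphism of group schemes `H ⟶ H'` is a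
bialgebra map `O(H') →ₐc[k] O(H)` in the opposite direction. The group `H(k)` of `k`-points is
`WithConv (O(H) →ₐ[k] k)` with the convolution product. -/

/-! ### Linear algebra of functions on a finite set -/

namespace FinFun

open TensorProduct

variable {k : Type*} [Field k] {S : Type*} [Fintype S] [DecidableEq S]
  {V : Type*} [AddCommGroup V] [Module k V] {M : Type*} [AddCommGroup M] [Module k M]

/-- Evaluation of a function at a point. -/
abbrev ev (k : Type*) [Field k] {S : Type*} (V : Type*) [AddCommGroup V] [Module k V] (s : S) :
    (S → V) →ₗ[k] V := LinearMap.proj s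

/-- The function supported at a point, with a given value there. -/
abbrev sg (k : Type*) [Field k] {S : Type*} [DecidableEq S] (V : Type*) [AddCommGroup V]
    [Module k V] (s : S) : V →ₗ[k] (S → V) := LinearMap.single k (fun _ => V) s

theorem sum_sg_ev (v : S → V) : (∑ s : S, sg k V s (ev k V s v)) = v := by
  ext t
  simp [Pi.single_apply]

theorem ext_left {x y : (S → V) ⊗[k] M}
    (h : ∀ s, (ev k V s).rTensor M x = (ev k V s).rTensor M y) : x = y := by
  have key : ∀ z : (S → V) ⊗[k] M,
      (∑ s : S, (sg k V s).rTensor M ((ev k V s).rTensor M z)) = z := by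
    intro z
    induction z with
    | zero => simp
    | add a b ha hb => simp only [map_add, Finset.sum_add_distrib, ha, hb]
    | tmul a b => simp only [LinearMap.rTensor_tmul, ← TensorProduct.sum_tmul, sum_sg_ev]
  rw [← key x, ← key y]
  exact Finset.sum_congr rfl fun s _ => by rw [h s]

theorem ext_right {x y : M ⊗[k] (S → V)}
    (h : ∀ s, (ev k V s).lTensor M x = (ev k V s).lTensor M y) : x = y := by
  have key : ∀ z : M ⊗[k] (S → V),
      (∑ s : S, (sg k V s).lTensor M ((ev k V s).lTensor M z)) = z := by
    intro z
    induction z with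
    | zero => simp
    | add a b ha hb => simp only [map_add, Finset.sum_add_distrib, ha, hb]
    | tmul a b => simp only [LinearMap.lTensor_tmul, ← TensorProduct.tmul_sum, sum_sg_ev]
  rw [← key x, ← key y]
  exact Finset.sum_congr rfl fun s _ => by rw [h s]

theorem ext_two {W : Type*} [AddCommGroup W] [Module k W] {x y : (S → V) ⊗[k] (S → W)}
    (h : ∀ s t, TensorProduct.map (ev k V s) (ev k W t) x =
      TensorProduct.map (ev k V s) (ev k W t) y) : x = y := by
  refine ext_left fun s => ext_right fun t => ?_
  have := h s t
  rwa [← LinearMap.lTensor_comp_rTensor, LinearMap.comp_apply, LinearMap.comp_apply] at this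

theorem ext_three {x y : (S → V) ⊗[k] ((S → V) ⊗[k] (S → V))}
    (h : ∀ r s t, TensorProduct.map (ev k V r) (TensorProduct.map (ev k V s) (ev k V t)) x =
      TensorProduct.map (ev k V r) (TensorProduct.map (ev k V s) (ev k V t)) y) : x = y := by
  have key : ∀ z : V ⊗[k] ((S → V) ⊗[k] (S → V)),
      (∑ s : S, ∑ t : S, (TensorProduct.map (sg k V s) (sg k V t)).lTensor V
        ((TensorProduct.map (ev k V s) (ev k V t)).lTensor V z)) = z := by
    intro z
    induction z with
    | zero => simp
    | add a b ha hb => simp only [map_add, Finset.sum_add_distrib, ha, hb]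
    | tmul v w =>
      induction w with
      | zero => simp
      | add a b ha hb => simp only [TensorProduct.tmul_add, map_add, Finset.sum_add_distrib, ha, hb]
      | tmul a b =>
        simp only [LinearMap.lTensor_tmul, TensorProduct.map_tmul, ← TensorProduct.tmul_sum,
          ← TensorProduct.sum_tmul, sum_sg_ev]
  refine ext_left fun r => ?_
  rw [← key ((ev k V r).rTensor _ x), ← key ((ev k V r).rTensor _ y)]
  refine Finset.sum_congr rfl fun s _ => Finset.sum_congr rfl fun t _ => ?_
  have := h r s t
  rw [← LinearMap.lTensor_comp_rTensor, LinearMap.comp_apply, LinearMap.comp_apply] at this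
  rw [this]

theorem mul_apply {T A : Type*} [CommRing A] [Algebra k A] (z : (T → A) ⊗[k] (T → A)) (r : T) :
    LinearMap.mul' k (T → A) z r =
      LinearMap.mul' k A (TensorProduct.map (ev k A r) (ev k A r) z) := by
  induction z with
  | zero => simp
  | add a b ha hb => simp only [map_add, Pi.add_apply, ha, hb]
  | tmul a b => simp

end FinFun

/-! ### Semidirect products with a finite constant group -/

/-- The coordinate ring of the semidirect product `V ⋊ S` of an affine group scheme `V` and a finite
constant group `S`; its underlying algebra consists of the functions from `S` to `O(V)`. The action
of `S` on `V` by group automorphisms is given as the left action `ρ` on `O(V)`, that is,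
`(ρ s f)(v) = f (s⁻¹ • v)`. -/
def SemidirectCoord {k : Type*} [Field k] {V : Type*} [CommRing V] [HopfAlgebra k V]
    {S : Type*} [Group S] (_ρ : S →* (V →ₐc[k] V)) : Type _ := S → V

namespace SemidirectCoord

open TensorProduct FinFun Coalgebra

variable {k : Type*} [Field k] {V : Type*} [CommRing V] [HopfAlgebra k V]
  {S : Type*} [Group S] (ρ : S →* (V →ₐc[k] V))

instance : CommRing (SemidirectCoord ρ) := inferInstanceAs (CommRing (S → V))

instance : Algebra k (SemidirectCoord ρ) := inferInstanceAs (Algebra k (S → V))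

/-- The pullback of functions along `v ↦ s • v`. -/
def act (s : S) : V →ₗ[k] V := (ρ s⁻¹ : V →ₐc[k] V)

theorem act_act (r s : S) (v : V) : act ρ s (act ρ r v) = act ρ (r * s) v := by
  simp [act]

theorem act_one (v : V) : act ρ 1 v = v := by
  simp [act]

theorem counit_act (s : S) (v : V) : counit (R := k) (act ρ s v) = counit (R := k) v :=
  CoalgHomClass.counit_comp_apply (ρ s⁻¹) v

theorem map_act_comul (s : S) (v : V) :
    TensorProduct.map (act ρ s) (act ρ s) (comul (R := k) v) = comul (R := k) (act ρ s v) :=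
  CoalgHomClass.map_comp_comul_apply (ρ s⁻¹) v

variable [Fintype S] [DecidableEq S]

/-- The comultiplication dual to `(v, s) * (w, t) = (v * (s • w), s * t)`. -/
def Δ : (S → V) →ₗ[k] (S → V) ⊗[k] (S → V) :=
  ∑ s : S, ∑ t : S, TensorProduct.map (sg k V s) (sg k V t) ∘ₗ
    (act ρ s).lTensor V ∘ₗ comul ∘ₗ ev k V (s * t)

theorem ev_Δ (s t : S) (f : S → V) : TensorProduct.map (ev k V s) (ev k V t) (Δ ρ f) =
    (act ρ s).lTensor V (comul (f (s * t))) := by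
  have h (s t s' t' : S) (z : V ⊗[k] V) : TensorProduct.map (ev k V s) (ev k V t)
      (TensorProduct.map (sg k V s') (sg k V t') z) = if s' = s ∧ t' = t then z else 0 := by
    induction z with
    | zero => simp
    | add a b ha hb => simp only [map_add, ha, hb]; split_ifs <;> simp
    | tmul a b =>
      by_cases h1 : s' = s
      · by_cases h2 : t' = t
        · subst h1 h2; simp
        · simp [h2, Pi.single_apply, Ne.symm h2]
      · simp [h1, Pi.single_apply, Ne.symm h1]
  simp only [Δ, LinearMap.sum_apply, LinearMap.comp_apply, map_sum, h]
  rw [Finset.sum_eq_single s, Finset.sum_eq_single t]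
  · simp
  · intro b _ hb; simp [hb]
  · simp
  · intro b _ hb; simp [hb]
  · simp

set_option synthInstance.maxHeartbeats 400000 in
theorem Δ_coassoc (f : S → V) : TensorProduct.assoc k (S → V) (S → V) (S → V)
    ((Δ ρ).rTensor (S → V) (Δ ρ f)) = (Δ ρ).lTensor (S → V) (Δ ρ f) := by
  refine ext_three fun r s t => ?_
  set F : V ⊗[k] V := comul (f (r * s * t)) with hF
  have h1 : ∀ z : (S → V) ⊗[k] (S → V),
      TensorProduct.map (ev k V r) (TensorProduct.map (ev k V s) (ev k V t))
        (TensorProduct.assoc k (S → V) (S → V) (S → V) ((Δ ρ).rTensor (S → V) z)) =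
      TensorProduct.assoc k V V V (((act ρ r).lTensor V ∘ₗ comul).rTensor V
        (TensorProduct.map (ev k V (r * s)) (ev k V t) z)) := by
    intro z
    induction z with
    | zero => simp
    | add a b ha hb => simp only [map_add, ha, hb]
    | tmul a b =>
      have h2 : ∀ w : (S → V) ⊗[k] (S → V),
          TensorProduct.map (ev k V r) (TensorProduct.map (ev k V s) (ev k V t))
            (TensorProduct.assoc k (S → V) (S → V) (S → V) (w ⊗ₜ b)) =
          TensorProduct.assoc k V V V (TensorProduct.map (ev k V r) (ev k V s) w ⊗ₜ b t) := by
        intro w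
        induction w with
        | zero => simp
        | add a b ha hb => simp only [map_add, TensorProduct.add_tmul, ha, hb]
        | tmul a b => simp
      simp only [LinearMap.rTensor_tmul, h2, ev_Δ, TensorProduct.map_tmul, LinearMap.comp_apply,
        LinearMap.proj_apply]
  have h3 : ∀ z : (S → V) ⊗[k] (S → V),
      TensorProduct.map (ev k V r) (TensorProduct.map (ev k V s) (ev k V t))
        ((Δ ρ).lTensor (S → V) z) =
      ((act ρ s).lTensor V ∘ₗ comul).lTensor V
        (TensorProduct.map (ev k V r) (ev k V (s * t)) z) := by
    intro z
    induction z with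
    | zero => simp
    | add a b ha hb => simp only [map_add, ha, hb]
    | tmul a b => simp [ev_Δ]
  rw [h1, h3, ev_Δ, ev_Δ, ← mul_assoc, ← hF]
  have h4 : ∀ z : V ⊗[k] V, TensorProduct.assoc k V V V
      (((act ρ r).lTensor V ∘ₗ comul).rTensor V ((act ρ (r * s)).lTensor V z)) =
      (TensorProduct.map (act ρ r) (act ρ (r * s))).lTensor V
        (TensorProduct.assoc k V V V ((comul (R := k)).rTensor V z)) := by
    intro z
    induction z with
    | zero => simp
    | add a b ha hb => simp only [map_add, ha, hb]
    | tmul a b =>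
      simp only [LinearMap.rTensor_tmul, LinearMap.lTensor_tmul, LinearMap.comp_apply]
      induction (comul (R := k) a) with
      | zero => simp
      | add a b ha hb => simp only [map_add, TensorProduct.add_tmul, ha, hb]
      | tmul a b => simp
  have h5 : ∀ z : V ⊗[k] V,
      ((act ρ s).lTensor V ∘ₗ comul).lTensor V ((act ρ r).lTensor V z) =
      (TensorProduct.map (act ρ r) (act ρ (r * s))).lTensor V
        ((comul (R := k)).lTensor V z) := by
    intro z
    induction z with
    | zero => simp
    | add a b ha hb => simp only [map_add, ha, hb]
    | tmul a b =>
      simp only [LinearMap.lTensor_tmul, LinearMap.comp_apply]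
      rw [← map_act_comul]
      congr 1
      induction (comul (R := k) b) with
      | zero => simp
      | add a b ha hb => simp only [map_add, ha, hb]
      | tmul a b => simp [act_act]
  rw [h4, h5, hF, Coalgebra.coassoc_apply]

theorem Δ_counit_left (f : S → V) :
    (counit (R := k) ∘ₗ ev k V (1 : S)).rTensor (S → V) (Δ ρ f) = (1 : k) ⊗ₜ[k] f := by
  refine ext_right fun t => ?_
  have h : ∀ z : (S → V) ⊗[k] (S → V),
      (ev k V t).lTensor k ((counit (R := k) ∘ₗ ev k V (1 : S)).rTensor (S → V) z) =
      (counit (R := k)).rTensor V (TensorProduct.map (ev k V 1) (ev k V t) z) := by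
    intro z
    induction z with
    | zero => simp
    | add a b ha hb => simp only [map_add, ha, hb]
    | tmul a b => simp
  have h1 : act ρ (1 : S) = LinearMap.id := LinearMap.ext (act_one ρ)
  rw [h, ev_Δ, h1]
  simp

theorem Δ_counit_right (f : S → V) :
    (counit (R := k) ∘ₗ ev k V (1 : S)).lTensor (S → V) (Δ ρ f) = f ⊗ₜ[k] (1 : k) := by
  refine ext_left fun s => ?_
  have h : ∀ z : (S → V) ⊗[k] (S → V),
      (ev k V s).rTensor k ((counit (R := k) ∘ₗ ev k V (1 : S)).lTensor (S → V) z) =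
      (counit (R := k)).lTensor V (TensorProduct.map (ev k V s) (ev k V 1) z) := by
    intro z
    induction z with
    | zero => simp
    | add a b ha hb => simp only [map_add, ha, hb]
    | tmul a b => simp
  have h1 : counit (R := k) ∘ₗ act ρ s = counit (R := k) := LinearMap.ext (counit_act ρ s)
  rw [h, ev_Δ, ← LinearMap.comp_apply, ← LinearMap.lTensor_comp, h1]
  simp

instance : Coalgebra k (SemidirectCoord ρ) where
  comul := Δ ρ
  counit := counit (R := k) ∘ₗ ev k V (1 : S)
  coassoc := LinearMap.ext (Δ_coassoc ρ)
  rTensor_counit_comp_comul := LinearMap.ext (Δ_counit_left ρ)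
  lTensor_counit_comp_comul := LinearMap.ext (Δ_counit_right ρ)

theorem Δ_one : Δ ρ (1 : S → V) = 1 := by
  refine ext_two fun s t => ?_
  rw [ev_Δ]
  simp [act, Algebra.TensorProduct.one_def]

theorem Δ_mul (f g : S → V) : Δ ρ (f * g) = Δ ρ f * Δ ρ g := by
  refine ext_two fun s t => ?_
  have h1 : ∀ x y : (S → V) ⊗[k] (S → V), TensorProduct.map (ev k V s) (ev k V t) (x * y) =
      TensorProduct.map (ev k V s) (ev k V t) x * TensorProduct.map (ev k V s) (ev k V t) y :=
    map_mul (Algebra.TensorProduct.map (Pi.evalAlgHom k (fun _ : S => V) s)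
      (Pi.evalAlgHom k (fun _ : S => V) t))
  have h2 : ∀ x y : V ⊗[k] V, (act ρ s).lTensor V (x * y) =
      (act ρ s).lTensor V x * (act ρ s).lTensor V y :=
    map_mul (Algebra.TensorProduct.map (AlgHom.id k V) (ρ s⁻¹ : V →ₐ[k] V))
  rw [h1, ev_Δ, ev_Δ, ev_Δ, Pi.mul_apply, Bialgebra.comul_mul, h2]

instance : Bialgebra k (SemidirectCoord ρ) :=
  Bialgebra.mk' k (SemidirectCoord ρ) (Bialgebra.counit_one (A := V))
    (fun {a b} => Bialgebra.counit_mul (R := k) (a 1 : V) (b 1)) (Δ_one ρ)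
    (fun {a b} => Δ_mul ρ a b)

/-- The antipode, dual to `(v, s)⁻¹ = (s⁻¹ • v⁻¹, s⁻¹)`. -/
def anti : (S → V) →ₗ[k] (S → V) :=
  LinearMap.pi fun s => HopfAlgebra.antipode k ∘ₗ act ρ s⁻¹ ∘ₗ ev k V s⁻¹

theorem anti_left (f : S → V) : LinearMap.mul' k (S → V) ((anti ρ).rTensor (S → V) (Δ ρ f)) =
    algebraMap k (S → V) (counit (R := k) (f 1)) := by
  ext r
  have h : ∀ z : (S → V) ⊗[k] (S → V),
      TensorProduct.map (ev k V r) (ev k V r) ((anti ρ).rTensor (S → V) z) =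
      (HopfAlgebra.antipode k).rTensor V ((act ρ r⁻¹).rTensor V
        (TensorProduct.map (ev k V r⁻¹) (ev k V r) z)) := by
    intro z
    induction z with
    | zero => simp
    | add a b ha hb => simp only [map_add, ha, hb]
    | tmul a b => simp [anti]
  rw [FinFun.mul_apply, h, ev_Δ, ← LinearMap.comp_apply (LinearMap.rTensor V (act ρ r⁻¹)),
    LinearMap.rTensor_comp_lTensor, map_act_comul, inv_mul_cancel]
  simp [counit_act]

theorem anti_right (f : S → V) : LinearMap.mul' k (S → V) ((anti ρ).lTensor (S → V) (Δ ρ f)) =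
    algebraMap k (S → V) (counit (R := k) (f 1)) := by
  ext r
  have h : ∀ z : (S → V) ⊗[k] (S → V),
      TensorProduct.map (ev k V r) (ev k V r) ((anti ρ).lTensor (S → V) z) =
      (HopfAlgebra.antipode k).lTensor V ((act ρ r⁻¹).lTensor V
        (TensorProduct.map (ev k V r) (ev k V r⁻¹) z)) := by
    intro z
    induction z with
    | zero => simp
    | add a b ha hb => simp only [map_add, ha, hb]
    | tmul a b => simp [anti]
  have h1 : act ρ r⁻¹ ∘ₗ act ρ r = LinearMap.id := by
    ext v
    simp [act_act, act_one]
  rw [FinFun.mul_apply, h, ev_Δ, ← LinearMap.comp_apply (LinearMap.lTensor V (act ρ r⁻¹)),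
    ← LinearMap.lTensor_comp, h1, mul_inv_cancel]
  simp

instance : HopfAlgebra k (SemidirectCoord ρ) where
  antipode := anti ρ
  mul_antipode_rTensor_comul := LinearMap.ext (anti_left ρ)
  mul_antipode_lTensor_comul := LinearMap.ext (anti_right ρ)

end SemidirectCoord

/-! ### Finite constant groups -/

/-- The coordinate ring of the constant group scheme over `k` attached to a finite group `S`: the
algebra of all functions from `S` to `k`, with `(Δ f)(s, t) = f (s * t)`, counit `f ↦ f 1` and
antipode `f ↦ (s ↦ f s⁻¹)`. -/
def ConstCoord (k : Type*) [Field k] (S : Type*) : Type _ := S → k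

namespace ConstCoord

open TensorProduct FinFun Coalgebra

variable (k : Type*) [Field k] (S : Type*)

instance : CommRing (ConstCoord k S) := inferInstanceAs (CommRing (S → k))

instance : Algebra k (ConstCoord k S) := inferInstanceAs (Algebra k (S → k))

variable [Group S]

/-- The antipode `f ↦ (s ↦ f s⁻¹)`. -/
def anti : (S → k) →ₗ[k] (S → k) := LinearMap.pi fun s => ev k k s⁻¹

theorem anti_eq : anti k S = SemidirectCoord.anti (1 : S →* (k →ₐc[k] k)) := by
  refine LinearMap.ext fun f => funext fun s => ?_
  simp [anti, SemidirectCoord.anti, SemidirectCoord.act]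

variable [Fintype S] [DecidableEq S]

/-- The comultiplication: `(s, t) ↦ f (s * t)` is the sum of the `f (s * t) • (δ_s ⊗ δ_t)`. -/
def Δ : (S → k) →ₗ[k] (S → k) ⊗[k] (S → k) :=
  ∑ s : S, ∑ t : S, (ev k k (s * t)).smulRight
    ((Pi.single s (1 : k) : S → k) ⊗ₜ[k] (Pi.single t (1 : k) : S → k))

theorem Δ_eq : Δ k S = SemidirectCoord.Δ (1 : S →* (k →ₐc[k] k)) := by
  refine LinearMap.ext fun f => ?_
  simp only [Δ, SemidirectCoord.Δ, LinearMap.sum_apply]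
  refine Finset.sum_congr rfl fun s _ => Finset.sum_congr rfl fun t _ => ?_
  have h : (Pi.single t (f (s * t)) : S → k) = f (s * t) • (Pi.single t (1 : k) : S → k) := by
    ext r
    simp [Pi.single_apply]
  simp [SemidirectCoord.act, h]

instance : Coalgebra k (ConstCoord k S) where
  comul := Δ k S
  counit := ev k k (1 : S)
  coassoc := by
    rw [Δ_eq]
    exact LinearMap.ext (SemidirectCoord.Δ_coassoc _)
  rTensor_counit_comp_comul := by
    rw [Δ_eq]
    exact LinearMap.ext (SemidirectCoord.Δ_counit_left _)
  lTensor_counit_comp_comul := by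
    rw [Δ_eq]
    exact LinearMap.ext (SemidirectCoord.Δ_counit_right _)

theorem Δ_one : Δ k S 1 = 1 := by
  rw [Δ_eq, SemidirectCoord.Δ_one]

theorem Δ_mul (f g : S → k) : Δ k S (f * g) = Δ k S f * Δ k S g := by
  rw [Δ_eq, SemidirectCoord.Δ_mul]

instance : Bialgebra k (ConstCoord k S) :=
  Bialgebra.mk' k (ConstCoord k S) (rfl : (1 : k) = 1)
    (fun {a b} => (rfl : ((a : S → k) * (b : S → k)) 1 = a 1 * b 1)) (Δ_one k S)
    (fun {a b} => Δ_mul k S a b)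

instance : HopfAlgebra k (ConstCoord k S) where
  antipode := anti k S
  mul_antipode_rTensor_comul := by
    rw [anti_eq]
    refine LinearMap.ext fun f => ?_
    have h := SemidirectCoord.anti_left (1 : S →* (k →ₐc[k] k)) f
    rw [← Δ_eq] at h
    exact h
  mul_antipode_lTensor_comul := by
    rw [anti_eq]
    refine LinearMap.ext fun f => ?_
    have h := SemidirectCoord.anti_right (1 : S →* (k →ₐc[k] k)) f
    rw [← Δ_eq] at h
    exact h

theorem ev_Δ (s t : S) (f : S → k) :
    TensorProduct.map (ev k k s) (ev k k t) (Δ k S f) = f (s * t) ⊗ₜ[k] (1 : k) := by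
  have h1 : SemidirectCoord.act (1 : S →* (k →ₐc[k] k)) s = LinearMap.id := by
    ext
    simp [SemidirectCoord.act]
  rw [Δ_eq, SemidirectCoord.ev_Δ, h1, LinearMap.lTensor_id]
  simpa using (TensorProduct.smul_tmul (f (s * t)) (1 : k) (1 : k)).symm

end ConstCoord

namespace SemidirectCoord

open TensorProduct FinFun Coalgebra

variable {k : Type*} [Field k] {V : Type*} [CommRing V] [HopfAlgebra k V]
  {S : Type*} [Group S] [Fintype S] [DecidableEq S] (ρ : S →* (V →ₐc[k] V))

/-- The inclusion `V ⟶ V ⋊ S`, `v ↦ (v, 1)`, on coordinate rings. -/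
def inl : SemidirectCoord ρ →ₐc[k] V :=
  BialgHom.ofAlgHom (Pi.evalAlgHom k (fun _ : S => V) 1) rfl (by
    refine AlgHom.ext fun f => ?_
    have h := ev_Δ ρ 1 1 f
    have h1 : act ρ (1 : S) = LinearMap.id := LinearMap.ext (act_one ρ)
    rw [h1, LinearMap.lTensor_id, mul_one] at h
    exact h)

/-- A scalar function on `S`, regarded as a function with values in the algebra `V`. -/
def projAlg (k V S : Type*) [Field k] [CommRing V] [Algebra k V] : (S → k) →ₐ[k] (S → V) :=
  AlgHom.pi fun s => (Algebra.ofId k V).comp (Pi.evalAlgHom k (fun _ => k) s)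

/-- The projection `V ⋊ S ⟶ S`, `(v, s) ↦ s`, on coordinate rings. -/
def proj : ConstCoord k S →ₐc[k] SemidirectCoord ρ :=
  BialgHom.ofAlgHom (projAlg k V S)
    (by
      refine AlgHom.ext fun f => ?_
      exact Bialgebra.counit_algebraMap (A := V) (f (1 : S)))
    (by
      refine AlgHom.ext fun f => ext_two (k := k) (V := V) (W := V) fun s t => ?_
      have h : ∀ z : (S → k) ⊗[k] (S → k), TensorProduct.map (ev k V s) (ev k V t)
          (Algebra.TensorProduct.map (projAlg k V S) (projAlg k V S) z) =
          TensorProduct.map (Algebra.linearMap k V) (Algebra.linearMap k V)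
            (TensorProduct.map (ev k k s) (ev k k t) z) := by
        intro z
        induction z with
        | zero => simp
        | add a b ha hb => simp only [map_add, ha, hb]
        | tmul a b => rfl
      have h1 := (h (ConstCoord.Δ k S f)).trans (congrArg
        (TensorProduct.map (Algebra.linearMap k V) (Algebra.linearMap k V))
        (ConstCoord.ev_Δ k S s t f))
      refine h1.trans ((ev_Δ ρ s t (projAlg k V S f)).trans ?_).symm
      have h2 : projAlg k V S f (s * t) = algebraMap k V (f (s * t)) := rfl
      rw [h2, Bialgebra.comul_algebraMap, Algebra.TensorProduct.algebraMap_apply]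
      simp [act])

end SemidirectCoord

/-! ### Extensions and prounipotent groups -/

/-- Exactness of the sequence `1 ⟶ U ⟶ H ⟶ Q ⟶ 1` of affine group schemes, with coordinate rings
`O(U) = B`, `O(H) = A` and `O(Q) = C`: the map `H ⟶ Q` is a quotient map (`C → A` is injective),
`U ⟶ H` is a closed immersion (`A → B` is surjective), and its image is the fibre of `H ⟶ Q` over
the neutral element. -/
structure IsExtension {k A B C : Type*} [Field k] [CommRing A] [HopfAlgebra k A] [CommRing B]
    [HopfAlgebra k B] [CommRing C] [HopfAlgebra k C] (i : A →ₐc[k] B) (p : C →ₐc[k] A) : Prop where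
  injective : Function.Injective p
  surjective : Function.Surjective i
  exact : RingHom.ker i = Ideal.map p (RingHom.ker (Bialgebra.counitAlgHom k C))

/-- A linear representation on `M` of the affine group scheme with coordinate ring `A`, that is, a
right comodule over `A`. -/
structure AffineGroupRep (k A M : Type*) [Field k] [CommRing A] [HopfAlgebra k A]
    [AddCommGroup M] [Module k M] where
  coact : M →ₗ[k] M ⊗[k] A
  coassoc : (TensorProduct.assoc k M A A).toLinearMap ∘ₗ coact.rTensor A ∘ₗ coact =
    (Coalgebra.comul (R := k) (A := A)).lTensor M ∘ₗ coact
  counit : (Coalgebra.counit (R := k) (A := A)).lTensor M ∘ₗ coact = (TensorProduct.mk k M k).flip 1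

/-- The affine group scheme with coordinate ring `A` is prounipotent: every nonzero linear
representation has a nonzero fixed vector. (For affine group schemes over a field this is equivalent
to being an inverse limit of unipotent algebraic groups.) -/
def IsProunipotent (k A : Type u) [Field k] [CommRing A] [HopfAlgebra k A] : Prop :=
  ∀ (M : Type u) [AddCommGroup M] [Module k M] [Nontrivial M] (ρ : AffineGroupRep k A M),
    ∃ m : M, m ≠ 0 ∧ ρ.coact m = m ⊗ₜ[k] (1 : A)

/-- The morphism of affine group schemes with pullback `p : C → A` is surjective (a quotient map)
with prounipotent kernel. -/
def IsSurjectiveWithProunipotentKernel {k A C : Type u} [Field k] [CommRing A] [HopfAlgebra k A]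
    [CommRing C] [HopfAlgebra k C] (p : C →ₐc[k] A) : Prop :=
  ∃ (B : Type u) (_ : CommRing B) (_ : HopfAlgebra k B) (i : A →ₐc[k] B),
    IsExtension i p ∧ IsProunipotent k B

/-! ### Completions -/

/-- The group of `k`-points of the affine group scheme with coordinate ring `A`. -/
abbrev Points (k A : Type*) [Field k] [CommRing A] [HopfAlgebra k A] : Type _ :=
  WithConv (A →ₐ[k] k)

/-- `(V, ι)`, with `ι : K → V(k)` a group morphism, is the `k`-prounipotent completion of the group
`K`: it is initial among all morphisms from `K` to the `k`-points of a prounipotent group. -/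
structure IsProunipotentCompletion {k K V : Type u} [Field k] [Group K] [CommRing V]
    [HopfAlgebra k V] (ι : K →* Points k V) : Prop where
  prounipotent : IsProunipotent k V
  initial : ∀ (V' : Type u) [CommRing V'] [HopfAlgebra k V'] (ι' : K →* Points k V'),
    IsProunipotent k V' → ∃! θ : V' →ₐc[k] V, ∀ (x : K) (f : V'), (ι x) (θ f) = (ι' x) f

/-- A commuting triangle formed by `φ : G → S`, a morphism `ψ : G → H(k)` to the `k`-points of a
pro-algebraic group `H` with coordinate ring `A`, and a surjective morphism `H ⟶ S` with
prounipotent kernel, whose pullback is `p`. -/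
structure IsRelativeTriangle {k G S A : Type u} [Field k] [Group G] [Group S] [Fintype S]
    [DecidableEq S] [CommRing A] [HopfAlgebra k A] (φ : G →* S) (p : ConstCoord k S →ₐc[k] A)
    (ψ : G →* Points k A) : Prop where
  kernel : IsSurjectiveWithProunipotentKernel p
  comm : ∀ (g : G) (f : ConstCoord k S), (ψ g) (p f) = f (φ g)

/-- `(H, p, ψ)` is the relative `k`-prounipotent completion of `G` with respect to `φ : G → S`: it is
an initial object of the category of triangles over `φ`. -/
structure IsRelativeCompletion {k G S A : Type u} [Field k] [Group G] [Group S] [Fintype S]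
    [DecidableEq S] [CommRing A] [HopfAlgebra k A] (φ : G →* S) (p : ConstCoord k S →ₐc[k] A)
    (ψ : G →* Points k A) : Prop where
  triangle : IsRelativeTriangle φ p ψ
  initial : ∀ (A' : Type u) [CommRing A'] [HopfAlgebra k A'] (p' : ConstCoord k S →ₐc[k] A')
    (ψ' : G →* Points k A'), IsRelativeTriangle φ p' ψ' →
      ∃! θ : A' →ₐc[k] A, θ.comp p' = p ∧ ∀ (g : G) (f : A'), (ψ g) (θ f) = (ψ' g) f

end

/-! The argument has two independent halves: a splitting theorem, and a description of the
completions by functions on the abstract group.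

Splitting. Zorn's lemma gives a minimal closed subgroup H' of H that still surjects onto S, that is,
a maximal Hopf ideal meeting O(S) trivially; the claim is that H' → S is an isomorphism
(`surjective_of_maximal`). Let K be the kernel of H' → S, acting on O(H') by right translations.
Prounipotence of U makes the filtration by iterated fixed vectors exhaustive
(`iSup_fixFilt_eq_top`), and the fixed functions are exactly O(S) (`mem_range_of_coactAlg_eq`). If
O(S) is not everything, the filtration has a second step, and summing over S yields a function b
with b(xu) = b(x) + f(u) for u in K and f nonzero (`exists_affineFun`). Let W be the space of all
functions of this affine type. Since K is normal, W is stable under right translations by H'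
(`comul_mem_left_affineFun`).

Fix a functional l on O(H') extending summation over S. The stabiliser in H' of the restriction of l
to W is a closed subgroup (`isHopfIdeal_stabIdeal`). It is proper, because u in K changes l(b) by
|S| f(u). It still surjects onto S: geometrically, K acts on W through a vector group that moves l
transitively among the functionals with the same restriction to O(S). Algebraically, the ideal of
the stabiliser is generated by functions c_i admitting locally nilpotent derivations D_i with D_i
c_j = δ_ij and D_i = 0 on O(S), and such an ideal contains no nonzero function killed by all D_i
(`eq_zero_of_mem_span_range_slices`). The D_i come from the coefficient of n in a(x u^n), which is
polynomial in n (`exists_derivation`). Minimality of H' is contradicted.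

Completions. For N = Ker φ, the functions on G killed by finitely many successive differences along
N form an algebra. As N is finitely generated of finite index, each step is finite-dimensional
(`fg_unipFun`), so this is a Hopf algebra of representative functions. It represents the relative
completion; the same construction for N inside itself gives the prounipotent completion. Restriction
of functions from G to N exhibits an extension of S by the completion of N
(`IsUnipCoord.exists_isExtension`), which splits by the first half and is therefore a semidirect
product (`exists_equiv_semidirect`). -/

/-! ### Subspaces of a tensor product -/

namespace TensorSub

open TensorProduct

variable {k : Type*} [Field k] {M : Type*} [AddCommGroup M] [Module k M]
  {M' : Type*} [AddCommGroup M'] [Module k M'] {B : Type*} [AddCommGroup B] [Module k B]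
  {B' : Type*} [AddCommGroup B'] [Module k B']

/-- The image of `N ⊗ B` in `M ⊗ B` for a subspace `N` of `M`. -/
def left (N : Submodule k M) (B : Type*) [AddCommGroup B] [Module k B] : Submodule k (M ⊗[k] B) :=
  LinearMap.range (N.subtype.rTensor B)

theorem tmul_mem {N : Submodule k M} {m : M} (hm : m ∈ N) (b : B) : m ⊗ₜ[k] b ∈ left N B :=
  ⟨(⟨m, hm⟩ : N) ⊗ₜ b, by simp⟩

@[elab_as_elim]
theorem left_induction {N : Submodule k M} {P : M ⊗[k] B → Prop} (zero : P 0)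
    (add : ∀ x y, P x → P y → P (x + y)) (tmul : ∀ m ∈ N, ∀ b : B, P (m ⊗ₜ b))
    {z : M ⊗[k] B} (hz : z ∈ left N B) : P z := by
  obtain ⟨w, rfl⟩ := hz
  induction w with
  | zero => simpa using zero
  | add a b ha hb => rw [map_add]; exact add _ _ ha hb
  | tmul n b => simpa using tmul n n.2 b

theorem left_le_iff {N : Submodule k M} {Q : Submodule k (M ⊗[k] B)} :
    left N B ≤ Q ↔ ∀ m ∈ N, ∀ b : B, m ⊗ₜ[k] b ∈ Q :=
  ⟨fun h _ hm b => h (tmul_mem hm b), fun h _ hz =>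
    left_induction Q.zero_mem (fun _ _ => Q.add_mem) h hz⟩

theorem left_mono {N N' : Submodule k M} (h : N ≤ N') : left N B ≤ left N' B :=
  left_le_iff.2 fun _ hm b => tmul_mem (h hm) b

theorem left_bot : left (⊥ : Submodule k M) B = ⊥ :=
  eq_bot_iff.2 <| left_le_iff.2 fun m hm b => by
    rw [Submodule.mem_bot] at hm
    simp [hm]

theorem map_mem_left {N : Submodule k M} {N' : Submodule k M'} (q : M →ₗ[k] M') (β : B →ₗ[k] B')
    (h : ∀ m ∈ N, q m ∈ N') {z : M ⊗[k] B} (hz : z ∈ left N B) :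
    TensorProduct.map q β z ∈ left N' B' := by
  have : left N B ≤ (left N' B').comap (TensorProduct.map q β) :=
    left_le_iff.2 fun m hm b => tmul_mem (h m hm) (β b)
  exact this hz

theorem mem_left_iff {N : Submodule k M} {z : M ⊗[k] B} :
    z ∈ left N B ↔ N.mkQ.rTensor B z = 0 :=
  ((rTensor_exact B (LinearMap.exact_subtype_mkQ N) N.mkQ_surjective) z).symm

/-- Slicing a tensor by a linear functional on the second factor. -/
def slice (M : Type*) [AddCommGroup M] [Module k M] (χ : B →ₗ[k] k) : M ⊗[k] B →ₗ[k] M :=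
  (TensorProduct.rid k M).toLinearMap ∘ₗ χ.lTensor M

@[simp]
theorem slice_tmul (χ : B →ₗ[k] k) (m : M) (b : B) : slice M χ (m ⊗ₜ[k] b) = χ b • m := by
  simp [slice]

theorem slice_map (q : M →ₗ[k] M') (χ : B →ₗ[k] k) (z : M ⊗[k] B) :
    slice M' χ (q.rTensor B z) = q (slice M χ z) := by
  induction z with
  | zero => simp
  | add a b ha hb => simp only [map_add, ha, hb]
  | tmul a b => simp

/-- Along a basis of `B`, the coefficients of a tensor are its slices by the coordinate functionals.
-/
theorem eq_zero_of_slice {z : M ⊗[k] B} (h : ∀ χ : B →ₗ[k] k, slice M χ z = 0) : z = 0 := by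
  let b := Module.Basis.ofVectorSpace k B
  have key : ∀ z : M ⊗[k] B, ∃ s : Finset _, z = ∑ i ∈ s, slice M (b.coord i) z ⊗ₜ[k] b i := by
    intro z
    -- Allowing every larger index set lets the expansions of two summands be written over a common
    -- set.
    have hz : ∃ s : Finset _, ∀ t, s ⊆ t → z = ∑ i ∈ t, slice M (b.coord i) z ⊗ₜ[k] b i := by
      classical
      induction z with
      | zero => exact ⟨∅, fun t _ => by simp⟩
      | add x y hx hy =>
        obtain ⟨s, hs⟩ := hx
        obtain ⟨t, ht⟩ := hy
        refine ⟨s ∪ t, fun r hr => ?_⟩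
        simp only [map_add, add_tmul, Finset.sum_add_distrib]
        rw [← hs r (Finset.union_subset_left hr), ← ht r (Finset.union_subset_right hr)]
      | tmul m c =>
        refine ⟨(b.repr c).support, fun t ht => ?_⟩
        simp only [slice_tmul, Module.Basis.coord_apply, smul_tmul, ← tmul_sum]
        congr 1
        conv_lhs => rw [← b.linearCombination_repr c]
        exact Finsupp.sum_of_support_subset _ ht _ (by simp)
    obtain ⟨s, hs⟩ := hz
    exact ⟨s, hs s le_rfl⟩
  obtain ⟨s, hs⟩ := key z
  rw [hs]
  exact Finset.sum_eq_zero fun i _ => by rw [h, zero_tmul]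

theorem mem_left_of_slice {N : Submodule k M} {z : M ⊗[k] B}
    (h : ∀ χ : B →ₗ[k] k, slice M χ z ∈ N) : z ∈ left N B := by
  refine mem_left_iff.2 (eq_zero_of_slice fun χ => ?_)
  rw [slice_map]
  simpa using h χ

theorem slice_mem {N : Submodule k M} {z : M ⊗[k] B} (hz : z ∈ left N B) (χ : B →ₗ[k] k) :
    slice M χ z ∈ N := by
  refine left_induction (by simp) (fun x y hx hy => ?_) (fun m hm b => ?_) hz
  · rw [map_add]; exact N.add_mem hx hy
  · rw [slice_tmul]; exact N.smul_mem _ hm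

end TensorSub

/-! ### The filtration by iterated fixed vectors -/

section FixFilt

open TensorProduct TensorSub

variable {k : Type*} [Field k] {M : Type*} [AddCommGroup M] [Module k M]
  {M' : Type*} [AddCommGroup M'] [Module k M'] {B : Type*} [Ring B] [Algebra k B]
  {B' : Type*} [Ring B'] [Algebra k B']

/-- The deviation of a coaction `κ` from the trivial coaction. -/
def coactSub (κ : M →ₗ[k] M ⊗[k] B) : M →ₗ[k] M ⊗[k] B := κ - (TensorProduct.mk k M B).flip 1

@[simp]
theorem coactSub_apply (κ : M →ₗ[k] M ⊗[k] B) (m : M) : coactSub κ m = κ m - m ⊗ₜ 1 := rfl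

/-- The filtration of a comodule whose successive quotients are the fixed vectors in the quotient by
the previous step. -/
def fixFilt (κ : M →ₗ[k] M ⊗[k] B) : ℕ → Submodule k M
  | 0 => ⊥
  | n + 1 => (left (fixFilt κ n) B).comap (coactSub κ)

theorem mem_fixFilt_succ {κ : M →ₗ[k] M ⊗[k] B} {n : ℕ} {m : M} :
    m ∈ fixFilt κ (n + 1) ↔ κ m - m ⊗ₜ 1 ∈ left (fixFilt κ n) B := Iff.rfl

theorem fixFilt_le_succ (κ : M →ₗ[k] M ⊗[k] B) (n : ℕ) : fixFilt κ n ≤ fixFilt κ (n + 1) := by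
  induction n with
  | zero => exact bot_le
  | succ n ih => exact Submodule.comap_mono (left_mono ih)

theorem fixFilt_mono (κ : M →ₗ[k] M ⊗[k] B) : Monotone (fixFilt κ) :=
  monotone_nat_of_le_succ (fixFilt_le_succ κ)

theorem coact_mem_of_mem_fixFilt {κ : M →ₗ[k] M ⊗[k] B} {n : ℕ} {m : M} (hm : m ∈ fixFilt κ n) :
    κ m ∈ left (fixFilt κ n) B := by
  have h : κ m - m ⊗ₜ 1 ∈ left (fixFilt κ n) B := by
    cases n with
    | zero => rw [fixFilt, Submodule.mem_bot] at hm; simp [hm]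
    | succ n => exact left_mono (fixFilt_le_succ κ n) (mem_fixFilt_succ.1 hm)
  simpa using Submodule.add_mem _ h (tmul_mem hm (1 : B))

/-- Carries exhaustiveness of the filtration from H, acted on by U, to a closed subgroup acted on by
its own kernel, without showing that this kernel is prounipotent. -/
theorem map_fixFilt_le {κ : M →ₗ[k] M ⊗[k] B} {κ' : M' →ₗ[k] M' ⊗[k] B'} (q : M →ₗ[k] M')
    (β : B →ₗ[k] B') (hβ : β 1 = 1) (h : ∀ m, κ' (q m) = TensorProduct.map q β (κ m)) {n : ℕ}
    {m : M} (hm : m ∈ fixFilt κ n) : q m ∈ fixFilt κ' n := by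
  induction n generalizing m with
  | zero => rw [fixFilt, Submodule.mem_bot] at hm ⊢; simp [hm]
  | succ n ih =>
    rw [mem_fixFilt_succ] at hm ⊢
    have := map_mem_left q β (fun m hm => ih hm) hm
    rwa [map_sub, ← h, TensorProduct.map_tmul, hβ] at this

theorem exists_mem_left_of_mem_iSup {F : ℕ → Submodule k M} (hF : Monotone F) {z : M ⊗[k] B}
    (hz : z ∈ left (⨆ n, F n) B) : ∃ n, z ∈ left (F n) B := by
  refine left_induction ⟨0, Submodule.zero_mem _⟩ ?_ ?_ hz
  · rintro x y ⟨n, hn⟩ ⟨m, hm⟩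
    exact ⟨max n m, Submodule.add_mem _ (left_mono (hF (le_max_left n m)) hn)
      (left_mono (hF (le_max_right n m)) hm)⟩
  · intro m hm b
    obtain ⟨n, hn⟩ := (Submodule.mem_iSup_of_directed _ hF.directed_le).1 hm
    exact ⟨n, tmul_mem hn b⟩

end FixFilt

namespace AffineGroupRep

open TensorProduct TensorSub

variable {k B M : Type*} [Field k] [CommRing B] [HopfAlgebra k B] [AddCommGroup M] [Module k M]

theorem coassoc_apply (ρ : AffineGroupRep k B M) (m : M) :
    TensorProduct.assoc k M B B (ρ.coact.rTensor B (ρ.coact m)) =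
      (Coalgebra.comul (R := k) (A := B)).lTensor M (ρ.coact m) :=
  LinearMap.congr_fun ρ.coassoc m

theorem counit_apply (ρ : AffineGroupRep k B M) (m : M) :
    (Coalgebra.counit (R := k) (A := B)).lTensor M (ρ.coact m) = m ⊗ₜ 1 :=
  LinearMap.congr_fun ρ.counit m

/-- The map induced on a quotient by a coaction for which the kernel is stable. -/
def quotientCoact (κ : M →ₗ[k] M ⊗[k] B) (N : Submodule k M) (hN : ∀ m ∈ N, κ m ∈ left N B) :
    M ⧸ N →ₗ[k] (M ⧸ N) ⊗[k] B :=
  N.liftQ (N.mkQ.rTensor B ∘ₗ κ) fun m hm => LinearMap.mem_ker.2 (mem_left_iff.1 (hN m hm))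

theorem quotientCoact_mkQ (κ : M →ₗ[k] M ⊗[k] B) (N : Submodule k M)
    (hN : ∀ m ∈ N, κ m ∈ left N B) (m : M) :
    quotientCoact κ N hN (N.mkQ m) = N.mkQ.rTensor B (κ m) := rfl

/-- The quotient of a representation by a stable subspace. -/
def quotient (ρ : AffineGroupRep k B M) (N : Submodule k M)
    (hN : ∀ m ∈ N, ρ.coact m ∈ left N B) : AffineGroupRep k B (M ⧸ N) where
  coact := quotientCoact ρ.coact N hN
  coassoc := by
    refine LinearMap.ext fun x => ?_
    obtain ⟨m, rfl⟩ := N.mkQ_surjective x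
    have h1 : ∀ z : M ⊗[k] B, TensorProduct.assoc k (M ⧸ N) B B
        ((quotientCoact ρ.coact N hN).rTensor B (N.mkQ.rTensor B z)) =
        N.mkQ.rTensor (B ⊗[k] B) (TensorProduct.assoc k M B B (ρ.coact.rTensor B z)) := by
      intro z
      induction z with
      | zero => simp
      | add a b ha hb => simp only [map_add, ha, hb]
      | tmul a b =>
        simp only [LinearMap.rTensor_tmul, quotientCoact_mkQ]
        induction ρ.coact a with
        | zero => simp
        | add a b ha hb => simp only [map_add, add_tmul, ha, hb]
        | tmul a b => simp
    rw [LinearMap.comp_apply, LinearMap.comp_apply, LinearMap.comp_apply, quotientCoact_mkQ,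
      LinearEquiv.coe_coe, h1, coassoc_apply,
      ← LinearMap.comp_apply (LinearMap.rTensor (B ⊗[k] B) N.mkQ), LinearMap.rTensor_comp_lTensor,
      ← LinearMap.comp_apply (LinearMap.lTensor (M ⧸ N) _), LinearMap.lTensor_comp_rTensor]
  counit := by
    refine LinearMap.ext fun x => ?_
    obtain ⟨m, rfl⟩ := N.mkQ_surjective x
    rw [LinearMap.comp_apply, quotientCoact_mkQ, ← LinearMap.comp_apply,
      LinearMap.lTensor_comp_rTensor, ← LinearMap.rTensor_comp_lTensor,
      LinearMap.comp_apply, counit_apply]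
    simp

end AffineGroupRep

section

open TensorProduct TensorSub

/-- Otherwise the quotient by the union would contain a nonzero fixed vector. The deviation of a
lift lies in the union tensored with `B`, hence already in one step of the filtration, which puts
the lift in the next step. -/
theorem iSup_fixFilt_eq_top {k B M : Type u} [Field k] [CommRing B] [HopfAlgebra k B]
    [AddCommGroup M] [Module k M] (hB : IsProunipotent k B) (ρ : AffineGroupRep k B M) :
    ⨆ n, fixFilt ρ.coact n = ⊤ := by
  set N := ⨆ n, fixFilt ρ.coact n with hN
  by_contra hne
  have hst : ∀ m ∈ N, ρ.coact m ∈ left N B := by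
    intro m hm
    obtain ⟨n, hn⟩ := (Submodule.mem_iSup_of_directed _ (fixFilt_mono ρ.coact).directed_le).1 hm
    exact left_mono (le_iSup _ n) (coact_mem_of_mem_fixFilt hn)
  have : Nontrivial (M ⧸ N) := Submodule.Quotient.nontrivial_iff.2 hne
  obtain ⟨x, hx0, hx⟩ := hB (M ⧸ N) (ρ.quotient N hst)
  obtain ⟨m, rfl⟩ := N.mkQ_surjective x
  have h : ρ.coact m - m ⊗ₜ 1 ∈ left N B := by
    rw [mem_left_iff, map_sub, sub_eq_zero]
    exact hx
  obtain ⟨n, hn⟩ := exists_mem_left_of_mem_iSup (fixFilt_mono ρ.coact) h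
  exact hx0 ((Submodule.Quotient.mk_eq_zero N).2
    ((le_iSup (fixFilt ρ.coact) (n + 1)) (mem_fixFilt_succ.2 hn)))

theorem exists_mem_fixFilt {k B M : Type u} [Field k] [CommRing B] [HopfAlgebra k B]
    [AddCommGroup M] [Module k M] (hB : IsProunipotent k B) (ρ : AffineGroupRep k B M) (m : M) :
    ∃ n, m ∈ fixFilt ρ.coact n :=
  (Submodule.mem_iSup_of_directed _ (fixFilt_mono ρ.coact).directed_le).1
    (iSup_fixFilt_eq_top hB ρ ▸ Submodule.mem_top)

end

/-! ### Points of affine group schemes and translations of functions -/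

namespace AffineGroup

open TensorProduct TensorSub WithConv Coalgebra

variable {k : Type*} [Field k] {A : Type*} [CommRing A] [HopfAlgebra k A]
  {B : Type*} [CommRing B] [Algebra k B] {R : Type*} [CommRing R] [Algebra k R]
  {R' : Type*} [CommRing R'] [Algebra k R']

/-- The inverse of a point with values in an algebra. -/
noncomputable def pinv (x : WithConv (A →ₐ[k] R)) : WithConv (A →ₐ[k] R) :=
  toConv (x.ofConv.comp (HopfAlgebra.antipodeAlgHom k A))

/-- The image of a point under a change of algebras. -/
def pmap (h : R →ₐ[k] R') (x : WithConv (A →ₐ[k] R)) : WithConv (A →ₐ[k] R') :=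
  toConv (h.comp x.ofConv)

@[simp]
theorem pmap_apply (h : R →ₐ[k] R') (x : WithConv (A →ₐ[k] R)) (a : A) : pmap h x a = h (x a) := rfl

theorem pmap_mul (h : R →ₐ[k] R') (x y : WithConv (A →ₐ[k] R)) :
    pmap h (x * y) = pmap h x * pmap h y :=
  WithConv.ext (AlgHom.comp_convMul_distrib h x y)

theorem pmap_one (h : R →ₐ[k] R') : pmap h (1 : WithConv (A →ₐ[k] R)) = 1 :=
  WithConv.ext (AlgHom.ext fun a => by
    change h (algebraMap k R (counit (R := k) a)) = algebraMap k R' (counit (R := k) a)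
    simp)

@[simp]
-- The identity of `A` is the generic point; its inverse law specialises to every point.
theorem pinv_mul_cancel (x : WithConv (A →ₐ[k] R)) : pinv x * x = 1 := by
  have h := congrArg (pmap x.ofConv) (AlgHom.antipode_id_cancel (R := k) (A := A))
  rw [pmap_mul, pmap_one] at h
  exact h

@[simp]
theorem mul_pinv_cancel (x : WithConv (A →ₐ[k] R)) : x * pinv x = 1 := by
  have h0 : (toConv (AlgHom.id k A) * toConv (HopfAlgebra.antipodeAlgHom k A) :
      WithConv (A →ₐ[k] A)) = 1 := by
    apply WithConv.ofConv_injective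
    apply AlgHom.toLinearMap_injective
    apply WithConv.toConv_injective
    rw [AlgHom.toLinearMap_convMul, AlgHom.toLinearMap_convOne]
    simp
  have h := congrArg (pmap x.ofConv) h0
  rw [pmap_mul, pmap_one] at h
  exact h

@[simp]
theorem mul_pinv_cancel_right (x y : WithConv (A →ₐ[k] R)) : x * y * pinv y = x := by
  rw [mul_assoc, mul_pinv_cancel, mul_one]

@[simp]
theorem pinv_mul_cancel_right (x y : WithConv (A →ₐ[k] R)) : x * pinv y * y = x := by
  rw [mul_assoc, pinv_mul_cancel, mul_one]

@[simp]
theorem pinv_mul_cancel_left (x y : WithConv (A →ₐ[k] R)) : pinv x * (x * y) = y := by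
  rw [← mul_assoc, pinv_mul_cancel, one_mul]

@[simp]
theorem mul_pinv_cancel_left (x y : WithConv (A →ₐ[k] R)) : x * (pinv x * y) = y := by
  rw [← mul_assoc, mul_pinv_cancel, one_mul]

/-- The value of a function at the product of two points. -/
theorem mul_apply (x y : WithConv (A →ₐ[k] R)) (a : A) :
    (x * y) a = Algebra.TensorProduct.productMap x.ofConv y.ofConv (comul (R := k) a) := by
  rw [AlgHom.convMul_apply]
  rfl

section Comp

variable {C : Type*} [CommRing C] [HopfAlgebra k C]

/-- The image of a point under a morphism of affine group schemes. -/
def pcomp (p : C →ₐc[k] A) (x : WithConv (A →ₐ[k] R)) : WithConv (C →ₐ[k] R) :=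
  toConv (x.ofConv.comp (p : C →ₐ[k] A))

theorem pcomp_mul (p : C →ₐc[k] A) (x y : WithConv (A →ₐ[k] R)) :
    pcomp p (x * y) = pcomp p x * pcomp p y :=
  WithConv.ext (AlgHom.convMul_comp_bialgHom_distrib x y p)

theorem pcomp_one (p : C →ₐc[k] A) : pcomp p (1 : WithConv (A →ₐ[k] R)) = 1 :=
  WithConv.ext (AlgHom.ext fun c => by
    change algebraMap k R (counit (R := k) (p c)) = algebraMap k R (counit (R := k) c)
    rw [CoalgHomClass.counit_comp_apply])

theorem pcomp_pinv (p : C →ₐc[k] A) (x : WithConv (A →ₐ[k] R)) :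
    pcomp p (pinv x) = pinv (pcomp p x) := by
  have h : pcomp p (pinv x) * pcomp p x = 1 := by
    rw [← pcomp_mul, pinv_mul_cancel, pcomp_one]
  rw [← mul_pinv_cancel_right (pcomp p (pinv x)) (pcomp p x), h, one_mul]

end Comp

/-- The restriction to `A ⊗ B` of functions on the product of the group with itself. -/
noncomputable def coactAlg (π : A →ₐ[k] B) : A →ₐ[k] A ⊗[k] B :=
  (Algebra.TensorProduct.map (AlgHom.id k A) π).comp (Bialgebra.comulAlgHom k A)

theorem coactAlg_apply (π : A →ₐ[k] B) (a : A) :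
    coactAlg π a = π.toLinearMap.lTensor A (comul (R := k) a) := rfl

theorem mul_comp_apply (π : A →ₐ[k] B) (x : WithConv (A →ₐ[k] R)) (v : B →ₐ[k] R) (a : A) :
    (x * toConv (v.comp π)) a = Algebra.TensorProduct.productMap x.ofConv v (coactAlg π a) := by
  rw [mul_apply, coactAlg_apply]
  induction comul (R := k) a with
  | zero => simp
  | add a b ha hb => simp only [map_add, ha, hb]
  | tmul a b => simp

/-- The translate of a function by a linear functional, on the left. -/
noncomputable def leftTranslate (l : A →ₗ[k] k) : A →ₗ[k] A :=
  (TensorProduct.lid k A).toLinearMap ∘ₗ l.rTensor A ∘ₗ comul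

/-- Left and right translations commute; this is coassociativity. -/
theorem coactAlg_leftTranslate (π : A →ₐ[k] B) (l : A →ₗ[k] k) (a : A) :
    coactAlg π (leftTranslate l a) = (leftTranslate l).rTensor B (coactAlg π a) := by
  have h1 : ∀ z : A ⊗[k] A, coactAlg π (TensorProduct.lid k A (l.rTensor A z)) =
      TensorProduct.lid k (A ⊗[k] B) (TensorProduct.map l (π.toLinearMap.lTensor A)
        (comul.lTensor A z)) := by
    intro z
    induction z with
    | zero => simp
    | add a b ha hb => simp only [map_add, ha, hb]
    | tmul a b => simp [coactAlg_apply]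
  have h2 : ∀ z : A ⊗[k] A, (leftTranslate l).rTensor B (π.toLinearMap.lTensor A z) =
      TensorProduct.lid k (A ⊗[k] B) (TensorProduct.map l (π.toLinearMap.lTensor A)
        (TensorProduct.assoc k A A A (comul.rTensor A z))) := by
    intro z
    induction z with
    | zero => simp
    | add a b ha hb => simp only [map_add, ha, hb]
    | tmul a b =>
      simp only [LinearMap.lTensor_tmul, LinearMap.rTensor_tmul, leftTranslate,
        LinearMap.comp_apply]
      induction comul (R := k) a with
      | zero => simp
      | add a b ha hb => simp only [map_add, add_tmul, ha, hb]
      | tmul a b => simp [smul_tmul']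
  rw [coactAlg_apply π a, h2, Coalgebra.coassoc_apply, ← h1]
  rfl

end AffineGroup

/-! ### Polynomial sequences -/

namespace PolySeq

open Polynomial

variable {k : Type*} [Field k] [CharZero k] {R : Type*} [CommRing R] [Algebra k R]

/-- On monomials, the Bernoulli polynomial of degree j + 1 has difference (j + 1) n^j, and j + 1 is
invertible. -/
theorem exists_antidifference (k : Type*) [Field k] [CharZero k] {R : Type*} [CommRing R]
    [Algebra k R] (Q : R[X]) :
    ∃ P : R[X], ∀ n : ℕ, P.eval ((n + 1 : ℕ) : R) = P.eval (n : R) + Q.eval (n : R) := by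
  induction Q using Polynomial.induction_on' with
  | add p q hp hq =>
    obtain ⟨P, hP⟩ := hp
    obtain ⟨P', hP'⟩ := hq
    refine ⟨P + P', fun n => ?_⟩
    simp only [eval_add, hP, hP']
    ring
  | monomial j c =>
    let f : ℚ →+* R := (algebraMap k R).comp (algebraMap ℚ k)
    refine ⟨(Polynomial.bernoulli (j + 1)).map f * C (f ((j + 1 : ℕ) : ℚ)⁻¹ * c), fun n => ?_⟩
    have h := bernoulli_eval_one_add (j + 1) (n : ℚ)
    have h0 : f ((j + 1 : ℕ) : ℚ)⁻¹ * f ((j + 1 : ℕ) : ℚ) = 1 := by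
      rw [← map_mul, inv_mul_cancel₀ (by exact_mod_cast j.succ_ne_zero), map_one]
    have h1 : (n : ℚ) + 1 = ((n + 1 : ℕ) : ℚ) := by push_cast; ring
    rw [add_comm, h1] at h
    simp only [eval_mul, eval_C, eval_natCast_map, h, eval_monomial, map_add, map_mul, map_pow,
      Nat.add_sub_cancel, map_natCast]
    simp only [map_natCast] at h0
    linear_combination (n : R) ^ j * c * h0

/-- A functional killing `Z` but not the coefficient would turn `Q` into a nonzero polynomial over
`k` vanishing at all natural numbers. -/
theorem coeff_mem_of_eval_mem (Z : Submodule k R) (Q : R[X]) (h : ∀ n : ℕ, Q.eval (n : R) ∈ Z)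
    (i : ℕ) : Q.coeff i ∈ Z := by
  by_contra hi
  obtain ⟨ν, hν, hZ⟩ := Submodule.exists_le_ker_of_notMem hi
  let P : k[X] := ∑ j ∈ Finset.range (Q.natDegree + 1), monomial j (ν (Q.coeff j))
  have hP : P = 0 := by
    refine eq_zero_of_infinite_isRoot P (Set.infinite_of_injective_forall_mem
      (f := fun n : ℕ => (n : k)) Nat.cast_injective fun n => ?_)
    have h1 : ν (Q.eval (n : R)) = 0 := hZ (h n)
    rw [eval_eq_sum_range, map_sum] at h1
    change P.eval (n : k) = 0
    rw [eval_finsetSum, ← h1]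
    refine Finset.sum_congr rfl fun j _ => ?_
    have h2 : Q.coeff j * (n : R) ^ j = ((n : k) ^ j) • Q.coeff j := by
      rw [Algebra.smul_def, map_pow, map_natCast, mul_comm]
    rw [h2, map_smul, eval_monomial, smul_eq_mul, mul_comm]
  have h3 : P.coeff i = ν (Q.coeff i) := by
    simp only [P, finsetSum_coeff, coeff_monomial, Finset.sum_ite_eq', Finset.mem_range]
    split_ifs with h4
    · rfl
    · rw [coeff_eq_zero_of_natDegree_lt (by omega), map_zero]
  rw [hP, coeff_zero] at h3
  exact hν h3.symm

theorem eq_of_eval_eq (k : Type*) [Field k] [CharZero k] {R : Type*} [CommRing R] [Algebra k R]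
    {P Q : R[X]} (h : ∀ n : ℕ, P.eval (n : R) = Q.eval (n : R)) : P = Q := by
  rw [← sub_eq_zero]
  ext i
  have := coeff_mem_of_eval_mem (k := k) ⊥ (P - Q) (fun n => by simp [h]) i
  simpa using this

end PolySeq

/-! ### Locally nilpotent derivations -/

section Derivation

variable {k : Type*} [Field k] {A : Type*} [CommRing A] [Algebra k A]

theorem Derivation.iterate_succ_mul_of_eq_one (D : Derivation k A A) {b : A} (hb : D b = 1) (a : A)
    (m : ℕ) : D^[m + 1] (b * a) = b * D^[m + 1] a + (m + 1 : k) • D^[m] a := by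
  induction m with
  | zero => simp [hb]
  | succ m ih =>
    rw [Function.iterate_succ_apply', ih, map_add, D.leibniz, hb, D.map_smul,
      ← Function.iterate_succ_apply' D (m + 1), ← Function.iterate_succ_apply' D m]
    simp only [smul_eq_mul, mul_one, Nat.cast_add, Nat.cast_one, add_smul, one_smul]
    ring

theorem Derivation.iterate_eq_zero (D : Derivation k A A) {q : A} (hq : D q = 0) (m : ℕ) :
    D^[m + 1] q = 0 := by
  rw [Function.iterate_succ_apply, hq]
  exact iterate_map_zero D m

/-- A locally nilpotent derivation with a slice: constants in the ideal of the slice vanish. -/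
theorem Derivation.mem_of_mem_sup_span_slice [CharZero k] (D : Derivation k A A) (I : Ideal A)
    (hI : ∀ i ∈ I, D i ∈ I) {b q : A} (hb : D b = 1) (hq : D q = 0)
    (hD : ∀ a, ∃ n, D^[n] a = 0) (h : q ∈ I ⊔ Ideal.span {b}) : q ∈ I := by
  obtain ⟨i, hi, c, hc, rfl⟩ := Submodule.mem_sup.1 h
  obtain ⟨a, rfl⟩ := Ideal.mem_span_singleton'.1 hc
  have hIm : ∀ m, D^[m] i ∈ I := by
    intro m
    induction m with
    | zero => exact hi
    | succ m ih => rw [Function.iterate_succ_apply']; exact hI _ ih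
  -- Applying D^(m+1) to q = i + ab kills q, so (m + 1) D^m a is congruent to -b D^(m+1) a modulo
  -- `I`. Local nilpotence starts the descent to a itself.
  have step : ∀ m, D^[m + 1] a ∈ I → D^[m] a ∈ I := by
    intro m hm
    have h1 := D.iterate_eq_zero hq m
    rw [iterate_map_add, mul_comm, D.iterate_succ_mul_of_eq_one hb] at h1
    have h2 : (m + 1 : k) • D^[m] a ∈ I := by
      have : (m + 1 : k) • D^[m] a = -(D^[m + 1] i + b * D^[m + 1] a) := by
        linear_combination h1
      rw [this]
      exact I.neg_mem (I.add_mem (hIm _) (I.mul_mem_left _ hm))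
    have h3 := Submodule.smul_of_tower_mem I ((m + 1 : k)⁻¹) h2
    rwa [smul_smul, inv_mul_cancel₀ (by exact_mod_cast m.succ_ne_zero), one_smul] at h3
  obtain ⟨n, hn⟩ := hD a
  have hmem : ∀ j, D^[j] a ∈ I → a ∈ I := by
    intro j
    induction j with
    | zero => exact id
    | succ j ih => exact fun h => ih (step j h)
  exact I.add_mem hi (I.mul_mem_right _ (hmem n (by rw [hn]; exact I.zero_mem)))

/-- The slices are removed one at a time: the ideal of the remaining ones is stable under D_i,
because D_i kills its generators. -/
theorem eq_zero_of_mem_span_slices [CharZero k] {ι : Type*} [DecidableEq ι] (s : Finset ι) (c : ι → A)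
    (D : ι → Derivation k A A) (hD : ∀ i a, ∃ n, (D i)^[n] a = 0)
    (hc : ∀ i ∈ s, ∀ j ∈ s, D i (c j) = if i = j then 1 else 0) {q : A}
    (hq : ∀ i ∈ s, D i q = 0) (h : q ∈ Ideal.span (c '' s)) : q = 0 := by
  induction s using Finset.induction_on with
  | empty => simpa using h
  | insert i s hi ih =>
    refine ih (fun i hi j hj => hc i (Finset.mem_insert_of_mem hi) j (Finset.mem_insert_of_mem hj))
      (fun i hi => hq i (Finset.mem_insert_of_mem hi)) ?_
    refine (D i).mem_of_mem_sup_span_slice _ ?_ (b := c i) ?_ (hq i (Finset.mem_insert_self _ _))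
      (hD i) ?_
    · intro a ha
      induction ha using Submodule.span_induction with
      | mem x hx =>
        obtain ⟨j, hj, rfl⟩ := hx
        have hj : j ∈ s := hj
        rw [hc i (Finset.mem_insert_self _ _) j (Finset.mem_insert_of_mem hj),
          if_neg (by rintro rfl; exact hi hj)]
        exact Submodule.zero_mem _
      | zero => simp
      | add x y _ _ hx hy => rw [map_add]; exact Submodule.add_mem _ hx hy
      | smul a x hx' hx =>
        rw [smul_eq_mul, Derivation.leibniz, smul_eq_mul, smul_eq_mul]
        exact Submodule.add_mem _ (Ideal.mul_mem_left _ _ hx) (Ideal.mul_mem_right _ _ hx')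
    · simp [hc i (Finset.mem_insert_self _ _) i (Finset.mem_insert_self _ _)]
    · rw [Finset.coe_insert, Set.image_insert_eq, Ideal.span_insert] at h
      rwa [sup_comm]

theorem eq_zero_of_mem_span_range_slices [CharZero k] {ι : Type*} [DecidableEq ι] (c : ι → A)
    (D : ι → Derivation k A A) (hD : ∀ i a, ∃ n, (D i)^[n] a = 0)
    (hc : ∀ i j, D i (c j) = if i = j then 1 else 0) {q : A} (hq : ∀ i, D i q = 0)
    (h : q ∈ Ideal.span (Set.range c)) : q = 0 := by
  classical
  rw [← Set.image_univ] at h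
  obtain ⟨t, ht, ht'⟩ := Submodule.mem_span_finite_of_mem_span h
  obtain ⟨s, -, hs⟩ := Finset.subset_set_image_iff.1 ht
  rw [← hs, Finset.coe_image] at ht'
  exact eq_zero_of_mem_span_slices s c D hD (fun i _ j _ => hc i j) (fun i _ => hq i) ht'

theorem Ideal.span_le_span_range_basis {ι : Type*} {W : Submodule k A}
    (b : Module.Basis ι k W) : Ideal.span (W : Set A) ≤ Ideal.span (Set.range fun i => (b i : A)) := by
  refine Ideal.span_le.2 fun w hw => ?_
  have h1 : (⟨w, hw⟩ : W) ∈ Submodule.span k (Set.range b) := by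
    rw [b.span_eq]; exact Submodule.mem_top
  have h2 : ∀ v ∈ Submodule.span k (Set.range b),
      (v : A) ∈ Ideal.span (Set.range fun i => (b i : A)) := by
    intro v hv
    induction hv using Submodule.span_induction with
    | mem x hx => obtain ⟨i, rfl⟩ := hx; exact Ideal.subset_span ⟨i, rfl⟩
    | zero => exact Submodule.zero_mem _
    | add x y _ _ hx hy => exact Submodule.add_mem _ hx hy
    | smul a x _ hx => exact Submodule.smul_of_tower_mem _ a hx
  exact h2 _ h1

end Derivation

/-! ### Infinitesimal translations by the elements of a unipotent subgroup -/

namespace AffineGroup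

open TensorProduct TensorSub WithConv Coalgebra Polynomial

variable {k : Type*} [Field k] {A : Type*} [CommRing A] [HopfAlgebra k A]
  {B : Type*} [CommRing B] [Algebra k B]

/-- The point `x * u ^ n`, where `x` and `u` are the generic points of the group and of its
subscheme with pullback `π`. -/
noncomputable def genericMulPow (π : A →ₐ[k] B) (n : ℕ) : WithConv (A →ₐ[k] A ⊗[k] B) :=
  toConv Algebra.TensorProduct.includeLeft *
    (toConv (Algebra.TensorProduct.includeRight.comp π) : WithConv (A →ₐ[k] A ⊗[k] B)) ^ n

theorem genericMulPow_zero_apply (π : A →ₐ[k] B) (a : A) : genericMulPow π 0 a = a ⊗ₜ 1 := by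
  simp [genericMulPow]

/-- The increment from a(x u^n) to a(x u^(n+1)) is the deviation of a evaluated at (x u^n, u). It
involves only the previous filtration step, which permits induction. -/
theorem genericMulPow_succ_apply (π : A →ₐ[k] B) (n : ℕ) (a : A) :
    genericMulPow π (n + 1) a = genericMulPow π n a +
      Algebra.TensorProduct.productMap (genericMulPow π n).ofConv
        Algebra.TensorProduct.includeRight (coactAlg π a - a ⊗ₜ 1) := by
  rw [map_sub, ← mul_comp_apply, toConv_ofConv, genericMulPow, genericMulPow, pow_succ, mul_assoc,
    Algebra.TensorProduct.productMap_apply_tmul, map_one, mul_one, add_sub_cancel]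

/-- The infinitesimal coaction: the linear coefficient of the polynomial `n ↦ a (x * u ^ n)`. -/
theorem exists_polynomial_of_mem_fixFilt [CharZero k] (π : A →ₐ[k] B) {m : ℕ} {a : A}
    (ha : a ∈ fixFilt (coactAlg π).toLinearMap m) :
    ∃ P : (A ⊗[k] B)[X], ∀ n : ℕ, genericMulPow π n a = P.eval (n : A ⊗[k] B) := by
  induction m generalizing a with
  | zero =>
    rw [fixFilt, Submodule.mem_bot] at ha
    exact ⟨0, fun n => by simp [ha]⟩
  | succ m ih =>
    have h1 : ∃ Q : (A ⊗[k] B)[X], ∀ n : ℕ,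
        Algebra.TensorProduct.productMap (genericMulPow π n).ofConv
        Algebra.TensorProduct.includeRight (coactAlg π a - a ⊗ₜ 1) = Q.eval (n : A ⊗[k] B) := by
      refine left_induction ⟨0, fun n => by simp⟩ ?_ ?_ (mem_fixFilt_succ.1 ha)
      · rintro x y ⟨P, hP⟩ ⟨Q, hQ⟩
        exact ⟨P + Q, fun n => by rw [map_add, hP, hQ, eval_add]⟩
      · intro b hb c
        obtain ⟨P, hP⟩ := ih hb
        refine ⟨P * C (1 ⊗ₜ c), fun n => ?_⟩
        rw [Algebra.TensorProduct.productMap_apply_tmul, eval_mul, eval_C, ← hP]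
        rfl
    obtain ⟨Q, hQ⟩ := h1
    obtain ⟨P, hP⟩ := PolySeq.exists_antidifference k Q
    -- The antidifference is determined up to a constant, fixed here by the value a ⊗ 1 at n = 0.
    refine ⟨P + C (a ⊗ₜ 1 - P.eval 0), fun n => ?_⟩
    induction n with
    | zero => simp [genericMulPow_zero_apply]
    | succ n ihn =>
      rw [genericMulPow_succ_apply, ihn, hQ]
      simp only [eval_add, eval_C, hP]
      ring

/-- Each increment lies in the m-th step tensored with `B`, since that step is stable under
translation by powers of u. This is what makes the derivation below lower the filtration. -/
theorem genericMulPow_sub_mem (π : A →ₐ[k] B) {m : ℕ} {a : A}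
    (ha : a ∈ fixFilt (coactAlg π).toLinearMap (m + 1)) (n : ℕ) :
    genericMulPow π n a - a ⊗ₜ 1 ∈ left (fixFilt (coactAlg π).toLinearMap m) B := by
  have key : ∀ (m n : ℕ), (∀ a ∈ fixFilt (coactAlg π).toLinearMap m,
      genericMulPow π n a ∈ left (fixFilt (coactAlg π).toLinearMap m) B) →
      ∀ z ∈ left (fixFilt (coactAlg π).toLinearMap m) B,
      Algebra.TensorProduct.productMap (genericMulPow π n).ofConv
        Algebra.TensorProduct.includeRight z ∈ left (fixFilt (coactAlg π).toLinearMap m) B := by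
    intro m n h z hz
    refine left_induction (by simp) ?_ ?_ hz
    · intro x y hx hy
      rw [map_add]
      exact Submodule.add_mem _ hx hy
    · intro b hb c
      rw [Algebra.TensorProduct.productMap_apply_tmul]
      refine left_induction (by simp) ?_ ?_ (h b hb)
      · intro x y hx hy
        rw [add_mul]
        exact Submodule.add_mem _ hx hy
      · intro b' hb' c'
        simpa using tmul_mem hb' (c' * c)
  have stable : ∀ (n m : ℕ), ∀ a ∈ fixFilt (coactAlg π).toLinearMap m,
      genericMulPow π n a ∈ left (fixFilt (coactAlg π).toLinearMap m) B := by
    intro n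
    induction n with
    | zero => exact fun m a ha => by rw [genericMulPow_zero_apply]; exact tmul_mem ha 1
    | succ n ih =>
      intro m a ha
      rw [genericMulPow_succ_apply]
      refine Submodule.add_mem _ (ih m a ha) (key m n (ih m) _ ?_)
      exact Submodule.sub_mem _ (coact_mem_of_mem_fixFilt ha) (tmul_mem ha 1)
  induction n with
  | zero => simp [genericMulPow_zero_apply]
  | succ n ih =>
    rw [genericMulPow_succ_apply, add_sub_right_comm]
    exact Submodule.add_mem _ ih (key m n (stable n m) _ (mem_fixFilt_succ.1 ha))

/-- A linear functional on functions on a unipotent subgroup gives rise to a locally nilpotent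
derivation on functions on the group, the infinitesimal right translation. -/
theorem exists_derivation [CharZero k] (π : A →ₐ[k] B)
    (hF : ∀ a, ∃ n, a ∈ fixFilt (coactAlg π).toLinearMap n) (l : B →ₗ[k] k) :
    ∃ D : Derivation k A A, (∀ a, ∃ n, D^[n] a = 0) ∧
      ∀ (a : A) (f : B), coactAlg π a = a ⊗ₜ 1 + 1 ⊗ₜ f → D a = algebraMap k A (l f) := by
  have hex : ∀ a : A, ∃ P : (A ⊗[k] B)[X],
      ∀ n : ℕ, genericMulPow π n a = P.eval (n : A ⊗[k] B) := fun a =>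
    (hF a).elim fun n hn => exists_polynomial_of_mem_fixFilt π hn
  choose P hP using hex
  have huniq : ∀ (a : A) (Q : (A ⊗[k] B)[X]),
      (∀ n : ℕ, genericMulPow π n a = Q.eval (n : A ⊗[k] B)) → P a = Q := fun a Q hQ =>
    PolySeq.eq_of_eval_eq k fun n => by rw [← hP, hQ]
  have hadd : ∀ a b, P (a + b) = P a + P b := fun a b => huniq _ _ fun n => by
    rw [eval_add, ← hP, ← hP]; exact map_add (genericMulPow π n).ofConv a b
  have hmul : ∀ a b, P (a * b) = P a * P b := fun a b => huniq _ _ fun n => by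
    rw [eval_mul, ← hP, ← hP]; exact map_mul (genericMulPow π n).ofConv a b
  have hsmul : ∀ (c : k) a, P (c • a) = c • P a := fun c a => huniq _ _ fun n => by
    rw [eval_smul, ← hP]; exact map_smul (genericMulPow π n).ofConv c a
  have hzero : ∀ a, (P a).coeff 0 = a ⊗ₜ 1 := fun a => by
    rw [coeff_zero_eq_eval_zero, ← genericMulPow_zero_apply, hP]
    simp
  have hslice : ∀ (a : A) (z : A ⊗[k] B), slice A l (a ⊗ₜ 1 * z) = a * slice A l z := by
    intro a z
    induction z with
    | zero => simp
    | add x y hx hy => simp only [mul_add, map_add, hx, hy]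
    | tmul x y => simp
  let D₀ : A →ₗ[k] A := slice A l ∘ₗ
    { toFun := fun a => (P a).coeff 1
      map_add' := fun a b => by rw [hadd, coeff_add]
      map_smul' := fun c a => by rw [hsmul, coeff_smul]; rfl }
  have hD₀ : ∀ a, D₀ a = slice A l ((P a).coeff 1) := fun _ => rfl
  -- The Leibniz rule is the formula for the linear coefficient of a product, the constant
  -- coefficients being a ⊗ 1 and b ⊗ 1.
  let D : Derivation k A A := Derivation.mk' D₀ fun a b => by
    rw [hD₀, hmul, mul_coeff_one, hzero, hzero, map_add, hslice, mul_comm ((P a).coeff 1), hslice]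
    rfl
  have hD : ∀ a, D a = slice A l ((P a).coeff 1) := fun _ => rfl
  have hlow : ∀ n a, a ∈ fixFilt (coactAlg π).toLinearMap n → D^[n] a = 0 := by
    intro n
    induction n with
    | zero => exact fun a ha => by simpa [fixFilt] using ha
    | succ n ih =>
      intro a ha
      rw [Function.iterate_succ_apply]
      refine ih _ ?_
      rw [hD]
      refine slice_mem ?_ l
      have h1 := PolySeq.coeff_mem_of_eval_mem
        (left (fixFilt (coactAlg π).toLinearMap n) B) (P a - C (a ⊗ₜ 1)) (fun m => by
          rw [eval_sub, eval_C, ← hP]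
          exact genericMulPow_sub_mem π ha m) 1
      simpa [coeff_C] using h1
  refine ⟨D, fun a => (hF a).imp fun n hn => hlow n a hn, fun a f hf => ?_⟩
  -- For an affine function, a(x u^n) = a(x) + n f(u).
  have h1 : P a = C (a ⊗ₜ 1) + X * C (1 ⊗ₜ f) := huniq _ _ fun n => by
    induction n with
    | zero => simp [genericMulPow_zero_apply]
    | succ n ih =>
      rw [genericMulPow_succ_apply, ih, hf, add_sub_cancel_left,
        Algebra.TensorProduct.productMap_apply_tmul]
      simp
      ring
  rw [hD, h1]
  simp [coeff_C, Algebra.smul_def]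

end AffineGroup

/-! ### The kernel of a morphism to a finite constant group -/

namespace AffineGroup

open TensorProduct TensorSub WithConv Coalgebra

section Kernel

variable {k A C B R : Type u} [Field k] [CommRing A] [HopfAlgebra k A] [CommRing C]
  [HopfAlgebra k C] [CommRing B] [Algebra k B] [CommRing R] [Algebra k R]

/-- The morphism `π` is the restriction of functions to the kernel of the morphism of affine group
schemes with pullback `p`, in terms of points. -/
structure IsKernel (p : C →ₐc[k] A) (π : A →ₐ[k] B) : Prop where
  pcomp_eq_one : pcomp p (toConv π) = 1
  exists_eq_comp : ∀ (R : Type u) [CommRing R] [Algebra k R] (x : WithConv (A →ₐ[k] R)),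
    pcomp p x = 1 → ∃ v : B →ₐ[k] R, x = toConv (v.comp π)

/-- Universal property of the quotient by the ideal of the fibre over 1. `B` is only an algebra, so
the kernel of H' → S can be used without a Hopf structure on its coordinate ring. -/
theorem IsKernel.of_ker_eq {p : C →ₐc[k] A} {π : A →ₐ[k] B} (hπ : Function.Surjective π)
    (h : RingHom.ker π = Ideal.map p (RingHom.ker (Bialgebra.counitAlgHom k C))) :
    IsKernel p π where
  pcomp_eq_one := by
    refine WithConv.ext (AlgHom.ext fun c => ?_)
    have h0 : c - algebraMap k C (counit (R := k) c) ∈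
        RingHom.ker (Bialgebra.counitAlgHom k C) := by
      rw [RingHom.mem_ker, map_sub]
      simp
    have h1 : p (c - algebraMap k C (counit (R := k) c)) ∈ RingHom.ker π :=
      h ▸ Ideal.mem_map_of_mem p h0
    rw [RingHom.mem_ker, map_sub, map_sub, sub_eq_zero] at h1
    change π (p c) = algebraMap k B (counit (R := k) c)
    rw [h1, AlgHomClass.commutes, AlgHomClass.commutes]
  exists_eq_comp R _ _ x hx := by
    have h1 : RingHom.ker π ≤ RingHom.ker x.ofConv := by
      rw [h]
      refine Ideal.map_le_iff_le_comap.2 fun c hc => ?_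
      have h1 : x (p c) = (1 : WithConv (C →ₐ[k] R)) c := by rw [← hx]; rfl
      have h2 : counit (R := k) c = 0 := hc
      rw [Ideal.mem_comap, RingHom.mem_ker]
      exact h1.trans (by simp [h2])
    let e := Ideal.quotientKerAlgEquivOfSurjective hπ
    refine ⟨(Ideal.Quotient.liftₐ (RingHom.ker π) x.ofConv fun a ha => h1 ha).comp
      e.symm.toAlgHom, WithConv.ext (AlgHom.ext fun a => ?_)⟩
    have h2 : e.symm (π a) = Ideal.Quotient.mk _ a := by
      rw [AlgEquiv.symm_apply_eq]
      rfl
    exact (congrArg (Ideal.Quotient.liftₐ (RingHom.ker π) x.ofConv fun a ha => h1 ha) h2).symm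

theorem IsKernel.pcomp_comp {p : C →ₐc[k] A} {π : A →ₐ[k] B} (h : IsKernel p π) (v : B →ₐ[k] R) :
    pcomp p (toConv (v.comp π)) = 1 := by
  have h1 := congrArg (pmap v) h.pcomp_eq_one
  rwa [pmap_one] at h1

theorem IsKernel.exists_conj_eq {p : C →ₐc[k] A} {π : A →ₐ[k] B} (h : IsKernel p π) (v : B →ₐ[k] R)
    (y : WithConv (A →ₐ[k] R)) :
    ∃ w : B →ₐ[k] R, pinv y * toConv (v.comp π) * y = toConv (w.comp π) :=
  h.exists_eq_comp R _ (by
    rw [pcomp_mul, pcomp_mul, h.pcomp_comp, pcomp_pinv, mul_one, pinv_mul_cancel])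

theorem mul_eq_mul_conj {T T' : Type*} [CommRing T] [Algebra k T] [CommRing T'] [Algebra k T']
    {π : A →ₐ[k] B} (x : WithConv (A →ₐ[k] T')) (h : T →ₐ[k] T') {u y : WithConv (A →ₐ[k] T)}
    {w : B →ₐ[k] T} (hw : pinv y * u * y = toConv (w.comp π)) :
    x * pmap h u * pmap h y = x * pmap h y * toConv ((h.comp w).comp π) := by
  have h2 : (toConv ((h.comp w).comp π) : WithConv (A →ₐ[k] T')) = pmap h (pinv y * u * y) := by
    rw [hw]; rfl
  rw [h2, mul_assoc, mul_assoc, ← pmap_mul, ← pmap_mul, mul_assoc, mul_pinv_cancel_left]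

/-- The functions on which the subgroup with pullback `π` acts by translations by constants. -/
noncomputable def affineFun (π : A →ₐ[k] B) : Submodule k A :=
  (LinearMap.range (TensorProduct.mk k A B 1)).comap (coactSub (coactAlg π).toLinearMap)

theorem mem_affineFun {π : A →ₐ[k] B} {b : A} :
    b ∈ affineFun π ↔ ∃ f, coactAlg π b = b ⊗ₜ 1 + 1 ⊗ₜ f := by
  simp only [affineFun, Submodule.mem_comap, LinearMap.mem_range, coactSub_apply, mk_apply]
  exact exists_congr fun f => by
    rw [eq_comm, sub_eq_iff_eq_add, add_comm]
    rfl

/-- Normality: b(xuy) = b(xy · y⁻¹uy) = b(xy) + f(y⁻¹uy), so slicing in y shows that the right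
translates of b are again affine. -/
theorem comul_mem_left_affineFun {p : C →ₐc[k] A} {π : A →ₐ[k] B} (h : IsKernel p π) {b : A}
    (hb : b ∈ affineFun π) : comul (R := k) b ∈ left (affineFun π) A := by
  obtain ⟨f, hf⟩ := mem_affineFun.1 hb
  refine mem_left_of_slice fun χ => mem_affineFun.2 ?_
  let u : WithConv (A →ₐ[k] B ⊗[k] A) :=
    toConv (Algebra.TensorProduct.includeLeft.comp π)
  let y : WithConv (A →ₐ[k] B ⊗[k] A) := toConv Algebra.TensorProduct.includeRight
  obtain ⟨w, hw⟩ := h.exists_conj_eq (R := B ⊗[k] A) Algebra.TensorProduct.includeLeft y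
  let x : WithConv (A →ₐ[k] A ⊗[k] (B ⊗[k] A)) := toConv Algebra.TensorProduct.includeLeft
  let inr : B ⊗[k] A →ₐ[k] A ⊗[k] (B ⊗[k] A) := Algebra.TensorProduct.includeRight
  have h3 : (x * pmap inr u * pmap inr y).ofConv b =
      (x * pmap inr y * toConv ((inr.comp w).comp π)).ofConv b :=
    congrArg (fun g => g.ofConv b) (mul_eq_mul_conj x inr hw)
  rw [mul_comp_apply, hf, mul_apply] at h3
  -- Slicing b(xu · y) in y gives the coaction on the sliced function; `h6` below is the same
  -- computation without u.
  have h4 : ∀ z : A ⊗[k] A, (slice B χ).lTensor A (Algebra.TensorProduct.productMap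
      (x * pmap inr u).ofConv (pmap inr y).ofConv z) = coactAlg π (slice A χ z) := by
    intro z
    induction z with
    | zero => simp
    | add a b ha hb => simp only [map_add, ha, hb]
    | tmul a c =>
      have h5 : (x * pmap inr u) a = Algebra.TensorProduct.productMap x.ofConv
          (inr.comp Algebra.TensorProduct.includeLeft) (coactAlg π a) :=
        mul_comp_apply π x (inr.comp Algebra.TensorProduct.includeLeft) a
      rw [Algebra.TensorProduct.productMap_apply_tmul, h5, slice_tmul, map_smul]
      induction coactAlg π a with
      | zero => simp
      | add a b ha hb => simp only [map_add, add_mul, ha, hb, smul_add]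
      | tmul a b => simp [x, y, inr]
  have h6 : ∀ z : A ⊗[k] A, (slice B χ).lTensor A (Algebra.TensorProduct.productMap
      x.ofConv (pmap inr y).ofConv z) = slice A χ z ⊗ₜ 1 := by
    intro z
    induction z with
    | zero => simp
    | add a b ha hb => simp only [map_add, add_tmul, ha, hb]
    | tmul a c => simp [x, y, inr, smul_tmul]
  refine ⟨slice B χ (w f), ?_⟩
  rw [← h4, h3, map_add, Algebra.TensorProduct.productMap_apply_tmul,
    Algebra.TensorProduct.productMap_apply_tmul, map_one, map_one, mul_one, one_mul, map_add]
  have h7 : (x * pmap inr y).ofConv b = Algebra.TensorProduct.productMap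
      x.ofConv (pmap inr y).ofConv (comul (R := k) b) := mul_apply _ _ _
  rw [h7, h6]
  simp [inr]

theorem comul_leftTranslate (l : A →ₗ[k] k) (a : A) :
    comul (R := k) (leftTranslate l a) = (leftTranslate l).rTensor A (comul (R := k) a) := by
  have h : ∀ a : A, coactAlg (AlgHom.id k A) a = comul (R := k) a := fun a => by
    rw [coactAlg_apply, AlgHom.toLinearMap_id, LinearMap.lTensor_id, LinearMap.id_apply]
  rw [← h, coactAlg_leftTranslate, h]

/-- Write Δb as a sum of b_i ⊗ c_i with b_i affine, and L for `leftTranslate l`. Then (Lb)(xy) is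
the sum of (Lb_i)(x) c_i(y), and x may be replaced by 1. -/
theorem mul_leftTranslate_apply {p : C →ₐc[k] A} {π : A →ₐ[k] B} (h : IsKernel p π) {b : A} (hb : b ∈ affineFun π) (l : A →ₗ[k] k)
    {x : WithConv (A →ₐ[k] R)}
    (hx : ∀ b ∈ affineFun π, x (leftTranslate l b) =
      algebraMap k R (counit (R := k) (leftTranslate l b)))
    (y : WithConv (A →ₐ[k] R)) : (x * y) (leftTranslate l b) = y (leftTranslate l b) := by
  have h1 : ∀ z ∈ left (affineFun π) A,
      Algebra.TensorProduct.productMap x.ofConv y.ofConv ((leftTranslate l).rTensor A z) =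
      Algebra.TensorProduct.productMap (1 : WithConv (A →ₐ[k] R)).ofConv y.ofConv
        ((leftTranslate l).rTensor A z) := by
    intro z hz
    refine left_induction (by simp) ?_ ?_ hz
    · intro z w hz hw
      simp only [map_add, hz, hw]
    · intro b hb c
      simp only [LinearMap.rTensor_tmul, Algebra.TensorProduct.productMap_apply_tmul, hx b hb]
      rfl
  rw [mul_apply, comul_leftTranslate, h1 _ (comul_mem_left_affineFun h hb), ← comul_leftTranslate,
    ← mul_apply, one_mul]

end Kernel

end AffineGroup

/-! ### Points of finite constant groups -/

namespace ConstCoord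

open TensorProduct WithConv Coalgebra AffineGroup

variable {k S : Type*} [Field k] [DecidableEq S]

/-- The indicator function of a point. -/
def delta (k : Type*) {S : Type*} [Field k] [DecidableEq S] (s : S) : ConstCoord k S :=
  (Pi.single s 1 : S → k)

theorem delta_apply (s t : S) : (delta k s : S → k) t = if t = s then 1 else 0 := by
  simp [delta, Pi.single_apply]

theorem mul_delta (g : ConstCoord k S) (s : S) : g * delta k s = (g s : k) • delta k s := by
  refine funext fun t => ?_
  change g t * (delta k s : S → k) t = g s * (delta k s : S → k) t
  rw [delta_apply]
  split_ifs with h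
  · rw [h]
  · simp

theorem delta_mul_delta (s t : S) :
    delta k s * delta k t = if t = s then delta k s else 0 := by
  rw [mul_delta, delta_apply]
  split_ifs with h
  · rw [one_smul, h]
  · rw [zero_smul]

theorem delta_ne_zero (s : S) : delta k s ≠ 0 := fun h => by
  have h1 := congrFun h s
  have h2 : (delta k s : S → k) s = 1 := by rw [delta_apply, if_pos rfl]
  exact one_ne_zero (h2.symm.trans h1)

variable {R : Type*} [CommRing R] [Algebra k R]

/-- The point of a constant group attached to an element. -/
def point (k R : Type*) {S : Type*} [Field k] [CommRing R] [Algebra k R] (s : S) :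
    WithConv (ConstCoord k S →ₐ[k] R) :=
  toConv ((Algebra.ofId k R).comp (Pi.evalAlgHom k (fun _ : S => k) s))

theorem point_apply {k R S : Type*} [Field k] [CommRing R] [Algebra k R] (s : S) (g : ConstCoord k S) :
    point k R s g = algebraMap k R (g s) := rfl

theorem eq_point_of_delta {y : WithConv (ConstCoord k S →ₐ[k] R)} {s : S}
    (h : y (delta k s) = 1) : y = point k R s := by
  refine WithConv.ext (AlgHom.ext fun g => ?_)
  have h1 : y (g * delta k s) = algebraMap k R (g s) := by
    rw [mul_delta, map_smul, h, Algebra.smul_def, mul_one]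
  rw [map_mul, h, mul_one] at h1
  exact h1

variable [Fintype S]

theorem eq_sum_delta (g : ConstCoord k S) : g = ∑ s, (g s : k) • delta k s := by
  have h : ∀ f : S → k, f = ∑ s, f s • (Pi.single s 1 : S → k) := fun f => by
    ext t
    simp [Pi.single_apply]
  exact h g

theorem sum_delta : ∑ s, delta k s = (1 : ConstCoord k S) := by
  conv_rhs => rw [eq_sum_delta (1 : ConstCoord k S)]
  exact Finset.sum_congr rfl fun s _ => (one_smul k _).symm

variable [Group S]

theorem comul_eq (g : ConstCoord k S) :
    comul (R := k) g = ∑ s : S, ∑ t : S, (g (s * t) : k) • (delta k s ⊗ₜ[k] delta k t) := by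
  have h : ∀ f : S → k, Δ k S f = ∑ s : S, ∑ t : S,
      f (s * t) • ((Pi.single s (1 : k) : S → k) ⊗ₜ[k] (Pi.single t (1 : k) : S → k)) := fun f => by
    simp only [Δ, LinearMap.sum_apply, LinearMap.smulRight_apply, LinearMap.proj_apply]
  exact h g

theorem point_one : point k R (1 : S) = 1 := rfl

theorem point_mul (s t : S) : point k R (s * t) = point k R s * point k R t := by
  refine WithConv.ext (AlgHom.ext fun g => ?_)
  refine Eq.trans ?_ (mul_apply (point k R s) (point k R t) g).symm
  rw [comul_eq, map_sum]
  simp only [map_sum, map_smul, Algebra.TensorProduct.productMap_apply_tmul, point_apply,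
    delta_apply]
  rw [Finset.sum_eq_single s, Finset.sum_eq_single t]
  · simp [Algebra.smul_def]
  · intro b _ hb; simp [Ne.symm hb]
  · simp
  · intro b _ hb; simp [Ne.symm hb]
  · simp

theorem pinv_point (s : S) : pinv (point k R s) = point k R s⁻¹ := by
  rw [← mul_pinv_cancel_right (point k R s⁻¹) (point k R s), ← point_mul, inv_mul_cancel,
    point_one, one_mul]

end ConstCoord

/-! ### Reduction of an extension of a finite group by a prounipotent group -/

namespace AffineGroup

open TensorProduct TensorSub WithConv Coalgebra ConstCoord

/-! ### Functions invariant under the kernel come from the finite quotient -/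

section Fixed

variable {k A B S : Type u} [Field k] [CommRing A] [HopfAlgebra k A] [CommRing B] [Algebra k B]
  [Group S] [Fintype S] [DecidableEq S] {p : ConstCoord k S →ₐc[k] A} {π : A →ₐ[k] B}

theorem coactAlg_map (h : IsKernel p π) (g : ConstCoord k S) : coactAlg π (p g) = p g ⊗ₜ 1 := by
  let x : WithConv (A →ₐ[k] A ⊗[k] B) := toConv Algebra.TensorProduct.includeLeft
  have h1 : pcomp p (x * toConv (Algebra.TensorProduct.includeRight.comp π)) = pcomp p x := by
    rw [pcomp_mul, h.pcomp_comp, mul_one]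
  have h2 : (x * toConv (Algebra.TensorProduct.includeRight.comp π)).ofConv (p g) = x (p g) :=
    congrArg (fun y => y.ofConv g) h1
  rw [mul_comp_apply] at h2
  have h3 : ∀ z : A ⊗[k] B, Algebra.TensorProduct.productMap x.ofConv
      Algebra.TensorProduct.includeRight z = z := by
    intro z
    induction z with
    | zero => simp
    | add a b ha hb => rw [map_add, ha, hb]
    | tmul a b => simp [x]
  rw [h3] at h2
  exact h2

/-- Two points over the same s differ on the right by a point of the kernel. -/
theorem apply_eq_apply_of_coactAlg_eq (h : IsKernel p π) {a : A} (ha : coactAlg π a = a ⊗ₜ 1)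
    {R : Type u} [CommRing R] [Algebra k R] {x y : WithConv (A →ₐ[k] R)} {s : S}
    (hx : x (p (delta k s)) = 1) (hy : y (p (delta k s)) = 1) : x a = y a := by
  obtain ⟨v, hv⟩ := h.exists_eq_comp R (pinv x * y) (by
    rw [pcomp_mul, pcomp_pinv, eq_point_of_delta (y := pcomp p x) hx,
      eq_point_of_delta (y := pcomp p y) hy, pinv_mul_cancel])
  have h1 : y = x * toConv (v.comp π) := by rw [← hv, mul_pinv_cancel_left]
  rw [h1, mul_comp_apply, ha, Algebra.TensorProduct.productMap_apply_tmul, map_one, mul_one]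

theorem exists_eq_algebraMap_of_tmul_eq {k A : Type*} [Field k] [CommRing A] [Algebra k A]
    [Nontrivial A] {a : A} (h : a ⊗ₜ[k] (1 : A) = (1 : A) ⊗ₜ[k] a) : ∃ c, a = algebraMap k A c := by
  obtain ⟨l, hl⟩ := LinearMap.exists_leftInverse_of_injective (Algebra.linearMap k A)
    (LinearMap.ker_eq_bot.2 (algebraMap k A).injective)
  have hl1 : l 1 = 1 := by simpa using LinearMap.congr_fun hl 1
  have h1 := congrArg (slice A l) h
  rw [slice_tmul, slice_tmul, hl1, one_smul, ← Algebra.algebraMap_eq_smul_one] at h1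
  exact ⟨_, h1⟩

/-- The fibre over s has coordinate ring A/(1 - e). Its two tautological points with values in the
tensor square lie over s, so an invariant a satisfies a ⊗ 1 = 1 ⊗ a there and is constant on the
fibre. -/
theorem exists_mul_delta_eq (hp : Function.Injective p) (h : IsKernel p π) {a : A}
    (ha : coactAlg π a = a ⊗ₜ 1) (s : S) : ∃ c : k, a * p (delta k s) = c • p (delta k s) := by
  set e := p (delta k s) with he
  have hee : e * e = e := by rw [he, ← map_mul, delta_mul_delta, if_pos rfl]
  have he0 : e ≠ 0 := fun h0 => delta_ne_zero s (hp (h0.trans (map_zero p).symm))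
  have hI : ∀ b, b ∈ Ideal.span {1 - e} → b * e = 0 := by
    intro b hb
    obtain ⟨c, rfl⟩ := Ideal.mem_span_singleton'.1 hb
    rw [mul_assoc, sub_mul, one_mul, hee, sub_self, mul_zero]
  obtain ⟨A', _, _, _, m, hm, hm0⟩ : ∃ (A' : Type u) (_ : CommRing A') (_ : Algebra k A')
      (_ : Nontrivial A') (m : A →ₐ[k] A'), m e = 1 ∧ ∀ b, m b = 0 → b * e = 0 := by
    refine ⟨A ⧸ Ideal.span {1 - e}, inferInstance, inferInstance,
      Ideal.Quotient.nontrivial_iff.2 fun h1 => he0 ?_, Ideal.Quotient.mkₐ k _, ?_,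
      fun b hb => hI b (Ideal.Quotient.eq_zero_iff_mem.1 hb)⟩
    · rw [← one_mul e]
      exact hI 1 (h1 ▸ Submodule.mem_top)
    · rw [← map_one (Ideal.Quotient.mkₐ k (Ideal.span {1 - e})), eq_comm]
      exact Ideal.Quotient.eq.2 (Ideal.subset_span rfl)
  let inl : A' →ₐ[k] A' ⊗[k] A' := Algebra.TensorProduct.includeLeft
  let inr : A' →ₐ[k] A' ⊗[k] A' := Algebra.TensorProduct.includeRight
  have hxy : m a ⊗ₜ[k] (1 : A') = (1 : A') ⊗ₜ[k] m a :=
    apply_eq_apply_of_coactAlg_eq h ha (s := s) (x := toConv (inl.comp m))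
      (y := toConv (inr.comp m)) ((congrArg inl hm).trans (map_one inl))
      ((congrArg inr hm).trans (map_one inr))
  obtain ⟨c, hc⟩ := exists_eq_algebraMap_of_tmul_eq hxy
  refine ⟨c, ?_⟩
  have h1 := hm0 (a - algebraMap k A c) (by rw [map_sub, hc, m.commutes, sub_self])
  rwa [sub_mul, sub_eq_zero, ← Algebra.smul_def] at h1

theorem mem_range_of_coactAlg_eq (hp : Function.Injective p) (h : IsKernel p π) {a : A}
    (ha : coactAlg π a = a ⊗ₜ 1) : ∃ g, p g = a := by
  have key := exists_mul_delta_eq hp h ha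
  choose c hc using key
  refine ⟨c, ?_⟩
  rw [eq_sum_delta (k := k) (S := S) c, map_sum]
  simp only [map_smul, ← hc]
  rw [← Finset.mul_sum, ← map_sum, sum_delta, map_one, mul_one]

end Fixed

end AffineGroup

namespace AffineGroup

open TensorProduct TensorSub WithConv Coalgebra ConstCoord

/-! ### The stabiliser of an averaged functional on affine functions -/

section Reduction

variable {k A B S : Type u} [Field k] [CommRing A] [HopfAlgebra k A] [CommRing B] [Algebra k B]
  [Group S] [Fintype S] [DecidableEq S] {p : ConstCoord k S →ₐc[k] A} {π : A →ₐ[k] B}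

theorem exists_functional (hp : Function.Injective p) :
    ∃ l : A →ₗ[k] k, ∀ g, l (p g) = ∑ s, (g s : k) := by
  obtain ⟨r, hr⟩ := LinearMap.exists_leftInverse_of_injective (p : ConstCoord k S →ₗ[k] A)
    (LinearMap.ker_eq_bot.2 hp)
  let t : ConstCoord k S →ₗ[k] k :=
    { toFun := fun g => ∑ s, (g s : k)
      map_add' := fun _ _ => Finset.sum_add_distrib
      map_smul' := fun _ _ => (Finset.mul_sum _ _ _).symm }
  have h1 : ∀ g, r (p g) = g := LinearMap.congr_fun hr
  exact ⟨t ∘ₗ r, fun g => congrArg t (h1 g)⟩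

/-- Summation over S is translation invariant, so the averaged functions on S are constant. -/
theorem leftTranslate_map {l : A →ₗ[k] k} (hl : ∀ g, l (p g) = ∑ s, (g s : k))
    (g : ConstCoord k S) : leftTranslate l (p g) = algebraMap k A (∑ s, (g s : k)) := by
  have h0 : ∀ s, l (p (delta k s)) = 1 := fun s => by
    rw [hl]
    simp [delta_apply]
  have h1 : comul (R := k) (p g) = TensorProduct.map (p : ConstCoord k S →ₗ[k] A)
      (p : ConstCoord k S →ₗ[k] A) (comul (R := k) g) :=
    (CoalgHomClass.map_comp_comul_apply p g).symm
  rw [leftTranslate, LinearMap.comp_apply, LinearMap.comp_apply, h1, comul_eq]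
  have h2 : ∀ s t, TensorProduct.lid k A (l.rTensor A (TensorProduct.map
      (p : ConstCoord k S →ₗ[k] A) (p : ConstCoord k S →ₗ[k] A) (delta k s ⊗ₜ[k] delta k t))) =
      p (delta k t) := fun s t => by
    simp [h0]
  simp only [map_sum, map_smul, LinearEquiv.coe_coe, h2]
  rw [Finset.sum_comm]
  have h3 : ∀ t : S, ∑ s, (g (s * t) : k) = ∑ s, (g s : k) := fun t =>
    Equiv.sum_comp (Equiv.mulRight t) fun s => (g s : k)
  simp only [← Finset.sum_smul, h3]
  rw [← Finset.smul_sum, ← map_sum, sum_delta, map_one, Algebra.algebraMap_eq_smul_one]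

theorem coactAlg_leftTranslate_of_eq {l : A →ₗ[k] k} (hl : ∀ g, l (p g) = ∑ s, (g s : k))
    {b : A} {g : ConstCoord k S} {f : B} (hb : coactAlg π b = b ⊗ₜ 1 + p g ⊗ₜ f) :
    coactAlg π (leftTranslate l b) =
      leftTranslate l b ⊗ₜ 1 + 1 ⊗ₜ ((∑ s, (g s : k)) • f) := by
  rw [coactAlg_leftTranslate, hb, map_add, LinearMap.rTensor_tmul, LinearMap.rTensor_tmul,
    leftTranslate_map hl, Algebra.algebraMap_eq_smul_one, smul_tmul]

theorem fixFilt_le_one {κ : A →ₗ[k] A ⊗[k] B} (h : fixFilt κ 2 ≤ fixFilt κ 1) (n : ℕ) :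
    fixFilt κ n ≤ fixFilt κ 1 := by
  induction n with
  | zero => exact bot_le
  | succ n ih => exact (Submodule.comap_mono (left_mono ih)).trans h

theorem mem_fixFilt_one {a : A} : a ∈ fixFilt (coactAlg π).toLinearMap 1 ↔
    coactAlg π a = a ⊗ₜ 1 := by
  rw [mem_fixFilt_succ, fixFilt, left_bot, Submodule.mem_bot, sub_eq_zero]
  rfl

/-- If the second filtration step equalled the first, the filtration would stop at O(S) and `p`
would be surjective. An element of the second step becomes affine after localising at one point of S
and averaging. -/
theorem exists_affineFun (hp : Function.Injective p) (h : IsKernel p π)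
    (hF : ∀ a, ∃ n, a ∈ fixFilt (coactAlg π).toLinearMap n) (hs : ¬ Function.Surjective p) :
    ∃ b ∈ affineFun π, coactAlg π b ≠ b ⊗ₜ 1 := by
  obtain ⟨l, hl⟩ := exists_functional hp
  have h1 : ∀ a, a ∈ fixFilt (coactAlg π).toLinearMap 1 → ∃ g, p g = a := fun a ha =>
    mem_range_of_coactAlg_eq hp h (mem_fixFilt_one.1 ha)
  have h2 : ¬ fixFilt (coactAlg π).toLinearMap 2 ≤ fixFilt (coactAlg π).toLinearMap 1 :=
    fun h2 => hs fun a => (hF a).elim fun n hn => h1 a (fixFilt_le_one h2 n hn)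
  obtain ⟨b₀, hb₀, hb₁⟩ := SetLike.not_le_iff_exists.1 h2
  have h3 : ∃ f : S → B, coactAlg π b₀ - b₀ ⊗ₜ 1 = ∑ s, p (delta k s) ⊗ₜ f s := by
    refine left_induction ⟨0, by simp⟩ ?_ ?_ (mem_fixFilt_succ.1 hb₀)
    · rintro x y ⟨f, rfl⟩ ⟨f', rfl⟩
      exact ⟨f + f', by simp [tmul_add, Finset.sum_add_distrib]⟩
    · intro m hm c
      obtain ⟨g, rfl⟩ := h1 m hm
      refine ⟨fun s => (g s : k) • c, ?_⟩
      conv_lhs => rw [eq_sum_delta g]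
      simp only [map_sum, map_smul, sum_tmul, smul_tmul]
  obtain ⟨f, hf⟩ := h3
  have h4 : ∃ s, f s ≠ 0 := by
    by_contra! h4
    rw [mem_fixFilt_one, ← sub_eq_zero, hf] at hb₁
    exact hb₁ (Finset.sum_eq_zero fun s _ => by rw [h4, tmul_zero])
  obtain ⟨s, hs⟩ := h4
  -- Multiplication by the idempotent of s leaves a single coefficient f s; averaging then turns
  -- that idempotent into the constant 1.
  have h5 : coactAlg π (p (delta k s) * b₀) =
      (p (delta k s) * b₀) ⊗ₜ 1 + p (delta k s) ⊗ₜ f s := by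
    rw [map_mul, coactAlg_map h, eq_add_of_sub_eq hf, mul_add, Finset.mul_sum, add_comm]
    simp only [Algebra.TensorProduct.tmul_mul_tmul, one_mul, ← map_mul, delta_mul_delta]
    congr 1
    rw [Finset.sum_eq_single s]
    · simp
    · intro t _ ht; simp [ht]
    · simp
  have h6 := coactAlg_leftTranslate_of_eq hl h5
  refine ⟨_, mem_affineFun.2 ⟨_, h6⟩, fun h7 => hs ?_⟩
  rw [h6, add_eq_left] at h7
  have h8 : ∑ t, ((delta k s : S → k) t) = 1 := by simp [delta_apply]
  have h9 := congrArg (fun z => TensorProduct.lid k B ((counit (R := k) (A := A)).rTensor B z)) h7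
  simpa [h8] using h9

/-- The translate of a function by a functional, normalised to vanish at the neutral element. -/
noncomputable def deviation (l : A →ₗ[k] k) : A →ₗ[k] A :=
  leftTranslate l - Algebra.linearMap k A ∘ₗ counit ∘ₗ leftTranslate l

theorem deviation_apply (l : A →ₗ[k] k) (b : A) :
    deviation l b = leftTranslate l b - algebraMap k A (counit (R := k) (leftTranslate l b)) := rfl

/-- The factor |S| is l(1). -/
theorem coactAlg_deviation {l : A →ₗ[k] k} (hl : ∀ g, l (p g) = ∑ s, (g s : k)) {b : A} {f : B}
    (hb : coactAlg π b = b ⊗ₜ 1 + 1 ⊗ₜ f) :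
    coactAlg π (deviation l b) = deviation l b ⊗ₜ 1 + 1 ⊗ₜ ((Fintype.card S : k) • f) := by
  have h1 : coactAlg π b = b ⊗ₜ 1 + p 1 ⊗ₜ f := by rw [map_one, hb]
  have h2 : ∑ s : S, ((1 : ConstCoord k S) s : k) = Fintype.card S := by
    have h3 : ∀ s : S, ((1 : ConstCoord k S) s : k) = 1 := fun _ => rfl
    simp [h3]
  rw [deviation_apply, map_sub, coactAlg_leftTranslate_of_eq hl h1, h2, AlgHom.commutes,
    Algebra.TensorProduct.algebraMap_apply, sub_tmul]
  abel

/-- Invariance forces |S| f = 0, hence f = 0; then b comes from S and its average is constant. Thus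
a deviation is determined by its translation part. -/
theorem deviation_eq_zero [CharZero k] (hp : Function.Injective p) (h : IsKernel p π)
    {l : A →ₗ[k] k} (hl : ∀ g, l (p g) = ∑ s, (g s : k)) {b : A} (hb : b ∈ affineFun π)
    (h1 : coactAlg π (deviation l b) = deviation l b ⊗ₜ 1) : deviation l b = 0 := by
  obtain ⟨f, hf⟩ := mem_affineFun.1 hb
  have h2 : (1 : A) ⊗ₜ[k] f = 0 := by
    rw [coactAlg_deviation hl hf, add_eq_left, tmul_smul, smul_eq_zero] at h1
    exact h1.resolve_left (Nat.cast_ne_zero.2 Fintype.card_ne_zero)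
  rw [h2, add_zero] at hf
  obtain ⟨g, rfl⟩ := mem_range_of_coactAlg_eq hp h hf
  rw [deviation_apply, leftTranslate_map hl, Bialgebra.counit_algebraMap, sub_self]

/-- The ideal of the stabiliser of an equivariant splitting. -/
noncomputable def stabIdeal (π : A →ₐ[k] B) (l : A →ₗ[k] k) : Ideal A :=
  Ideal.span ((affineFun π).map (deviation l))

theorem apply_leftTranslate_of_stabIdeal_le {R : Type u} [CommRing R] [Algebra k R]
    {l : A →ₗ[k] k} {x : WithConv (A →ₐ[k] R)} (hx : ∀ a ∈ stabIdeal π l, x a = 0) :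
    ∀ b ∈ affineFun π, x (leftTranslate l b) =
      algebraMap k R (counit (R := k) (leftTranslate l b)) := by
  intro b hb
  have h1 := hx _ (Ideal.subset_span ⟨b, hb, rfl⟩)
  rwa [deviation_apply, map_sub, AlgHom.commutes, sub_eq_zero] at h1

theorem eq_zero_of_mem_stabIdeal {R : Type u} [CommRing R] [Algebra k R]
    {l : A →ₗ[k] k} {x : WithConv (A →ₐ[k] R)} (hx : ∀ b ∈ affineFun π, x (leftTranslate l b) =
      algebraMap k R (counit (R := k) (leftTranslate l b))) {a : A} (ha : a ∈ stabIdeal π l) :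
    x a = 0 := by
  have h : stabIdeal π l ≤ RingHom.ker x.ofConv := by
    refine Ideal.span_le.2 ?_
    rintro _ ⟨b, hb, rfl⟩
    rw [SetLike.mem_coe, RingHom.mem_ker, deviation_apply, map_sub, AlgHom.commutes, hx b hb,
      sub_self]
  exact h ha

theorem mul_apply_of_stabIdeal {R : Type u} [CommRing R] [Algebra k R] (h : IsKernel p π)
    {l : A →ₗ[k] k} {x y : WithConv (A →ₐ[k] R)} (hx : ∀ a ∈ stabIdeal π l, x a = 0)
    (hy : ∀ a ∈ stabIdeal π l, y a = 0) {a : A} (ha : a ∈ stabIdeal π l) : (x * y) a = 0 :=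
  eq_zero_of_mem_stabIdeal (fun b hb => by
    rw [mul_leftTranslate_apply h hb l (apply_leftTranslate_of_stabIdeal_le hx),
      apply_leftTranslate_of_stabIdeal_le hy b hb]) ha

theorem pinv_apply_of_stabIdeal {R : Type u} [CommRing R] [Algebra k R] (h : IsKernel p π)
    {l : A →ₗ[k] k} {x : WithConv (A →ₐ[k] R)} (hx : ∀ a ∈ stabIdeal π l, x a = 0) {a : A}
    (ha : a ∈ stabIdeal π l) : pinv x a = 0 :=
  eq_zero_of_mem_stabIdeal (fun b hb => by
    rw [← mul_leftTranslate_apply h hb l (apply_leftTranslate_of_stabIdeal_le hx) (pinv x),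
      mul_pinv_cancel]
    rfl) ha

/-- The points killing the ideal contain 1 and are closed under products and inverses; applying this
to the generic points of the quotient gives the Hopf ideal axioms. -/
theorem isHopfIdeal_stabIdeal (h : IsKernel p π) (l : A →ₗ[k] k) :
    (stabIdeal π l).IsHopfIdeal k where
  counit_eq_zero a ha := by
    refine eq_zero_of_mem_stabIdeal (R := k) (x := toConv (Bialgebra.counitAlgHom k A))
      (fun b _ => rfl) ha
  map_mkQ_comul_eq_zero a ha := by
    let m : A →ₐ[k] A ⧸ stabIdeal π l := Ideal.Quotient.mkₐ k _
    have hm : ∀ a ∈ stabIdeal π l, m a = 0 := fun a ha => Ideal.Quotient.eq_zero_iff_mem.2 ha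
    let inl : A ⧸ stabIdeal π l →ₐ[k] (A ⧸ stabIdeal π l) ⊗[k] (A ⧸ stabIdeal π l) :=
      Algebra.TensorProduct.includeLeft
    let inr : A ⧸ stabIdeal π l →ₐ[k] (A ⧸ stabIdeal π l) ⊗[k] (A ⧸ stabIdeal π l) :=
      Algebra.TensorProduct.includeRight
    have h1 := mul_apply_of_stabIdeal h (x := toConv (inl.comp m)) (y := toConv (inr.comp m))
      (fun a ha => (congrArg inl (hm a ha)).trans (map_zero inl))
      (fun a ha => (congrArg inr (hm a ha)).trans (map_zero inr)) ha
    rw [mul_apply] at h1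
    have h2 : Algebra.TensorProduct.productMap (inl.comp m) (inr.comp m) =
        Algebra.TensorProduct.map m m := by
      ext <;> simp [inl, inr]
    exact (DFunLike.congr_fun h2 _).symm.trans h1
  antipode_mem a ha := by
    have h1 := pinv_apply_of_stabIdeal h
      (x := toConv (Ideal.Quotient.mkₐ k (stabIdeal π l)))
      (fun a ha => Ideal.Quotient.eq_zero_iff_mem.2 ha) ha
    exact Ideal.Quotient.eq_zero_iff_mem.1 h1

/-- The differential of a function on which the kernel acts by translations. -/
noncomputable def translationPart (π : A →ₐ[k] B) : A →ₗ[k] B :=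
  (TensorProduct.lid k B).toLinearMap ∘ₗ (counit (R := k) (A := A)).rTensor B ∘ₗ
    coactSub (coactAlg π).toLinearMap

theorem translationPart_eq {b : A} {f : B} (hb : coactAlg π b = b ⊗ₜ 1 + 1 ⊗ₜ f) :
    translationPart π b = f := by
  simp only [translationPart, LinearMap.comp_apply, coactSub_apply, AlgHom.toLinearMap_apply, hb,
    add_sub_cancel_left]
  simp

theorem coactAlg_of_mem_map_deviation {l : A →ₗ[k] k} (hl : ∀ g, l (p g) = ∑ s, (g s : k)) {c : A}
    (hc : c ∈ (affineFun π).map (deviation l)) :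
    coactAlg π c = c ⊗ₜ 1 + 1 ⊗ₜ translationPart π c := by
  obtain ⟨b, hb, rfl⟩ := hc
  obtain ⟨f, hf⟩ := mem_affineFun.1 hb
  have h1 := coactAlg_deviation hl hf
  rw [translationPart_eq h1, h1]

/-- Surjectivity of the stabiliser onto S: functions from S are constants for derivations for which
a basis of the deviations consists of slices. -/
theorem eq_zero_of_map_mem_stabIdeal [CharZero k] (hp : Function.Injective p) (h : IsKernel p π)
    (hF : ∀ a, ∃ n, a ∈ fixFilt (coactAlg π).toLinearMap n)
    {l : A →ₗ[k] k} (hl : ∀ g, l (p g) = ∑ s, (g s : k)) {g : ConstCoord k S}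
    (hg : p g ∈ stabIdeal π l) : p g = 0 := by
  classical
  let φ : (affineFun π).map (deviation l) →ₗ[k] B :=
    translationPart π ∘ₗ ((affineFun π).map (deviation l)).subtype
  have hφ : ∀ c, coactAlg π c.1 = c.1 ⊗ₜ 1 + 1 ⊗ₜ φ c := fun c =>
    coactAlg_of_mem_map_deviation hl c.2
  have hker : LinearMap.ker φ = ⊥ := by
    refine LinearMap.ker_eq_bot'.2 ?_
    intro c hc
    have h1 := hφ c
    rw [hc, tmul_zero, add_zero] at h1
    obtain ⟨_, b, hb, rfl⟩ := c
    exact Subtype.ext (deviation_eq_zero hp h hl hb h1)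
  -- Since translation parts determine deviations, the coordinates of a basis of deviations extend
  -- to functionals on `B`; these define the dual derivations.
  obtain ⟨r, hr⟩ := LinearMap.exists_leftInverse_of_injective φ hker
  obtain ⟨ι, ⟨bs⟩⟩ : ∃ ι : Type u, Nonempty (Module.Basis ι k ((affineFun π).map (deviation l))) :=
    ⟨_, ⟨Module.Basis.ofVectorSpace k _⟩⟩
  have hD := fun i => exists_derivation π hF (bs.coord i ∘ₗ r)
  choose D hDn hDc using hD
  refine eq_zero_of_mem_span_range_slices (fun i => (bs i).1) D hDn (fun i j => ?_) (fun i => ?_)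
    (Ideal.span_le_span_range_basis bs hg)
  · have h1 : r (φ (bs j)) = bs j := LinearMap.congr_fun hr (bs j)
    rw [hDc i _ _ (hφ (bs j)), LinearMap.comp_apply, h1, Module.Basis.coord_apply,
      Module.Basis.repr_self, Finsupp.single_apply]
    split_ifs with h2 h3 h3
    · exact map_one _
    · exact absurd h2.symm h3
    · exact absurd h3.symm h2
    · exact map_zero _
  · rw [hDc i (p g) 0 (by rw [coactAlg_map h, tmul_zero, add_zero]), map_zero, map_zero]

/-- If the kernel of a morphism to a finite constant group is nontrivial, there is a proper closed
subgroup which still surjects onto the finite group. -/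
theorem exists_isHopfIdeal [CharZero k] (hp : Function.Injective p) (h : IsKernel p π)
    (hF : ∀ a, ∃ n, a ∈ fixFilt (coactAlg π).toLinearMap n) (hs : ¬ Function.Surjective p) :
    ∃ J : Ideal A, J.IsHopfIdeal k ∧ J ≠ ⊥ ∧ ∀ g, p g ∈ J → p g = 0 := by
  obtain ⟨l, hl⟩ := exists_functional hp
  refine ⟨stabIdeal π l, isHopfIdeal_stabIdeal h l, fun h0 => ?_, fun g hg =>
    eq_zero_of_map_mem_stabIdeal hp h hF hl hg⟩
  obtain ⟨b, hb, hb1⟩ := exists_affineFun hp h hF hs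
  obtain ⟨f, hf⟩ := mem_affineFun.1 hb
  have h1 : deviation l b = 0 := by
    have : deviation l b ∈ stabIdeal π l := Ideal.subset_span ⟨b, hb, rfl⟩
    rwa [h0, Ideal.mem_bot] at this
  have h2 := coactAlg_deviation hl hf
  rw [h1, map_zero, zero_tmul, zero_add, tmul_smul, eq_comm, smul_eq_zero] at h2
  refine hb1 ?_
  rw [hf, h2.resolve_left (Nat.cast_ne_zero.2 Fintype.card_ne_zero), add_zero]

end Reduction

end AffineGroup

/-! ### Splitting of extensions of finite groups by prounipotent groups -/

namespace AffineGroup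

open TensorProduct TensorSub WithConv Coalgebra ConstCoord

theorem map_antipode {k A C : Type*} [Field k] [CommRing A] [HopfAlgebra k A] [CommRing C]
    [HopfAlgebra k C] (p : C →ₐc[k] A) (c : C) :
    p (HopfAlgebra.antipode k c) = HopfAlgebra.antipode k (p c) :=
  (congrArg (fun x => x.ofConv c) (pcomp_pinv p (toConv (AlgHom.id k A)))).symm

theorem isHopfIdeal_ker {k A C : Type*} [Field k] [CommRing A] [HopfAlgebra k A] [CommRing C]
    [HopfAlgebra k C] (p : C →ₐc[k] A) :
    (RingHom.ker (p : C →ₐ[k] A)).IsHopfIdeal k where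
  counit_eq_zero c hc := by
    have hc : p c = 0 := hc
    rw [← CoalgHomClass.counit_comp_apply p, hc, map_zero]
  map_mkQ_comul_eq_zero c hc := by
    have hc : p c = 0 := hc
    let K := (RingHom.ker (p : C →ₐ[k] A)).restrictScalars k
    let j : C ⧸ K →ₗ[k] A := K.liftQ (p : C →ₗ[k] A) fun c hc => hc
    have hjK : j ∘ₗ K.mkQ = (p : C →ₗ[k] A) := Submodule.liftQ_mkQ _ _ _
    have hj : Function.Injective j := by
      rw [← LinearMap.ker_eq_bot]
      exact Submodule.ker_liftQ_eq_bot _ _ _ fun c hc => hc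
    -- Over a field the tensor square of an injection is injective, so the vanishing can be tested
    -- in A ⊗ A.
    refine TensorProduct.map_injective_of_flat_flat j j hj hj ?_
    rw [map_zero]
    have h : ∀ z : C ⊗[k] C, TensorProduct.map j j (TensorProduct.map K.mkQ K.mkQ z) =
        TensorProduct.map (p : C →ₗ[k] A) (p : C →ₗ[k] A) z := by
      intro z
      rw [← LinearMap.comp_apply, ← TensorProduct.map_comp, hjK]
    refine (h _).trans ?_
    have h1 := CoalgHomClass.map_comp_comul_apply p c
    rw [hc, map_zero] at h1
    exact h1
  antipode_mem c hc := by
    have hc : p c = 0 := hc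
    change p _ = 0
    rw [map_antipode, hc, map_zero]

section Restrict

variable {k A B : Type*} [Field k] [CommRing A] [HopfAlgebra k A] [CommRing B] [HopfAlgebra k B]

/-- The representation of a closed subgroup on functions by right translation. -/
noncomputable def restrictRep (i : A →ₐc[k] B) : AffineGroupRep k B A where
  coact := (coactAlg (i : A →ₐ[k] B)).toLinearMap
  coassoc := by
    have h1 : ∀ z : A ⊗[k] A, TensorProduct.assoc k A B B
        ((coactAlg (i : A →ₐ[k] B)).toLinearMap.rTensor B ((i : A →ₗ[k] B).lTensor A z)) =
        (TensorProduct.map (i : A →ₗ[k] B) (i : A →ₗ[k] B)).lTensor A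
          (TensorProduct.assoc k A A A (comul.rTensor A z)) := by
      intro z
      induction z with
      | zero => simp
      | add a b ha hb => simp only [map_add, ha, hb]
      | tmul a b =>
        simp only [LinearMap.lTensor_tmul, LinearMap.rTensor_tmul, AlgHom.toLinearMap_apply,
          coactAlg_apply]
        induction comul (R := k) a with
        | zero => simp
        | add a b ha hb => simp only [map_add, add_tmul, ha, hb]
        | tmul a b => simp
    have h2 : ∀ z : A ⊗[k] A, (comul (R := k) (A := B)).lTensor A ((i : A →ₗ[k] B).lTensor A z) =
        (TensorProduct.map (i : A →ₗ[k] B) (i : A →ₗ[k] B)).lTensor A (comul.lTensor A z) := by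
      intro z
      induction z with
      | zero => simp
      | add a b ha hb => simp only [map_add, ha, hb]
      | tmul a b =>
        simp only [LinearMap.lTensor_tmul]
        congr 1
        exact (CoalgHomClass.map_comp_comul_apply i b).symm
    refine LinearMap.ext fun a => ?_
    exact (h1 (comul a)).trans ((congrArg _ (Coalgebra.coassoc_apply a)).trans (h2 _).symm)
  counit := by
    refine LinearMap.ext fun a => ?_
    have h : ∀ z : A ⊗[k] A, (counit (R := k) (A := B)).lTensor A ((i : A →ₗ[k] B).lTensor A z) =
        (counit (R := k)).lTensor A z := by
      intro z
      induction z with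
      | zero => simp
      | add a b ha hb => simp only [map_add, ha, hb]
      | tmul a b => simp
    exact (h (comul a)).trans (Coalgebra.lTensor_counit_comul a)

end Restrict

theorem IsKernel.of_isExtension {k A B C : Type u} [Field k] [CommRing A] [HopfAlgebra k A]
    [CommRing B] [HopfAlgebra k B] [CommRing C] [HopfAlgebra k C] {i : A →ₐc[k] B}
    {p : C →ₐc[k] A} (h : IsExtension i p) : IsKernel p (i : A →ₐ[k] B) :=
  IsKernel.of_ker_eq h.surjective h.exact

/-- The supremum of a nonempty chain is its union, so each axiom concerns an element of one member.
-/
theorem isHopfIdeal_sSup {k A : Type*} [Field k] [CommRing A] [HopfAlgebra k A]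
    {c : Set (Ideal A)} (hne : c.Nonempty) (hc : IsChain (· ≤ ·) c)
    (h : ∀ I ∈ c, I.IsHopfIdeal k) : (sSup c).IsHopfIdeal k := by
  have hmem : ∀ x, x ∈ sSup c ↔ ∃ I ∈ c, x ∈ I := fun x =>
    Submodule.mem_sSup_of_directed hne hc.directedOn
  refine { counit_eq_zero := ?_, map_mkQ_comul_eq_zero := ?_, antipode_mem := ?_ }
  · intro x hx
    obtain ⟨I, hI, hx⟩ := (hmem x).1 hx
    exact (h I hI).counit_eq_zero hx
  · intro x hx
    obtain ⟨I, hI, hx⟩ := (hmem x).1 hx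
    have hle : I.restrictScalars k ≤ (sSup c).restrictScalars k := le_sSup (a := I) hI
    have h1 := (h I hI).map_mkQ_comul_eq_zero hx
    have h2 := congrArg (TensorProduct.map (Submodule.factor hle) (Submodule.factor hle)) h1
    rw [map_zero, ← LinearMap.comp_apply, ← TensorProduct.map_comp,
      Submodule.factor_comp_mk] at h2
    exact h2
  · intro x hx
    obtain ⟨I, hI, hx⟩ := (hmem x).1 hx
    exact (hmem _).2 ⟨I, hI, (h I hI).antipode_mem hx⟩

variable {k A B S : Type u} [Field k] [CharZero k] [CommRing A] [HopfAlgebra k A] [CommRing B]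
  [HopfAlgebra k B] [Group S] [Fintype S] [DecidableEq S]

/-- A closed subgroup which is minimal among those surjecting onto the finite quotient of an
extension by a prounipotent group is a complement of the prounipotent group. -/
theorem surjective_of_maximal {i : A →ₐc[k] B} {p : ConstCoord k S →ₐc[k] A}
    (h : IsExtension i p) (hB : IsProunipotent k B) (I : Ideal A) [I.IsHopfIdeal k]
    (hI : ∀ g, p g ∈ I → p g = 0)
    (hmax : ∀ J : Ideal A, J.IsHopfIdeal k → (∀ g, p g ∈ J → p g = 0) → I ≤ J → J ≤ I) :
    Function.Surjective ((Bialgebra.Quotient.mkBialgHom I).comp p) := by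
  by_contra hs
  let q : A →ₐc[k] A ⧸ I := Bialgebra.Quotient.mkBialgHom I
  let p' := q.comp p
  have hp' : Function.Injective p' := by
    refine (injective_iff_map_eq_zero p').2 fun g hg => ?_
    have h1 : p g = 0 := hI g (Ideal.Quotient.eq_zero_iff_mem.1 hg)
    exact h.injective (h1.trans (map_zero p).symm)
  let π : A ⧸ I →ₐ[k] (A ⧸ I) ⧸ Ideal.map p' (RingHom.ker (Bialgebra.counitAlgHom k _)) :=
    Ideal.Quotient.mkₐ k _
  have hπ : IsKernel p' π := IsKernel.of_ker_eq (Ideal.Quotient.mkₐ_surjective k _)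
    (Ideal.Quotient.mkₐ_ker k _)
  -- `v` is the inclusion into U of the kernel of H' → S; through it the filtration of O(H) maps to
  -- that of O(H').
  obtain ⟨v, hv⟩ := (IsKernel.of_isExtension h).exists_eq_comp _ (toConv (π.comp (q : A →ₐ[k] A ⧸ I)))
    hπ.pcomp_eq_one
  have hF : ∀ a, ∃ n, a ∈ fixFilt (coactAlg π).toLinearMap n := by
    intro a
    obtain ⟨a, rfl⟩ := Ideal.Quotient.mk_surjective a
    obtain ⟨n, hn⟩ := exists_mem_fixFilt hB (restrictRep i) a
    refine ⟨n, map_fixFilt_le (q : A →ₗ[k] A ⧸ I) v.toLinearMap (map_one v) (fun a => ?_) hn⟩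
    have h1 := CoalgHomClass.map_comp_comul_apply q a
    have h2 : ∀ z : A ⊗[k] A, π.toLinearMap.lTensor _ (TensorProduct.map (q : A →ₗ[k] A ⧸ I)
        (q : A →ₗ[k] A ⧸ I) z) = TensorProduct.map (q : A →ₗ[k] A ⧸ I) v.toLinearMap
          ((i : A →ₗ[k] B).lTensor A z) := by
      intro z
      induction z with
      | zero => simp
      | add a b ha hb => simp only [map_add, ha, hb]
      | tmul a b =>
        have h3 : π (q b) = v (i b) := congrArg (fun x => x.ofConv b) hv
        simp only [TensorProduct.map_tmul, LinearMap.lTensor_tmul]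
        exact congrArg _ h3
    exact ((congrArg _ h1).symm.trans (h2 (comul a)) :)
  obtain ⟨J, hJ, hJ0, hJp⟩ := exists_isHopfIdeal hp' hπ hF hs
  have hker : ∀ a, a ∈ RingHom.ker (((Bialgebra.Quotient.mkBialgHom J).comp q :
      A →ₐc[k] (A ⧸ I) ⧸ J) : A →ₐ[k] (A ⧸ I) ⧸ J) ↔ q a ∈ J := fun a => Ideal.Quotient.eq_zero_iff_mem
  -- The preimage of `J` in `A` defines a closed subgroup of H' that still surjects onto S;
  -- maximality of `I` forces `J` to be zero.
  have h1 := hmax _ (isHopfIdeal_ker ((Bialgebra.Quotient.mkBialgHom J).comp q)) (fun g hg =>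
      hI g (Ideal.Quotient.eq_zero_iff_mem.1 (hJp g ((hker _).1 hg)))) (fun a ha => (hker a).2 (by
      have h2 : q a = 0 := Ideal.Quotient.eq_zero_iff_mem.2 ha
      rw [h2]; exact J.zero_mem))
  refine hJ0 (eq_bot_iff.2 fun x hx => ?_)
  obtain ⟨a, rfl⟩ := Ideal.Quotient.mk_surjective x
  exact Ideal.Quotient.eq_zero_iff_mem.2 (h1 ((hker a).2 hx))

/-- Every extension of a finite group by a prounipotent group splits. -/
theorem exists_section {i : A →ₐc[k] B} {p : ConstCoord k S →ₐc[k] A}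
    (h : IsExtension i p) (hB : IsProunipotent k B) :
    ∃ σ : A →ₐc[k] ConstCoord k S, σ.comp p = BialgHom.id k (ConstCoord k S) := by
  let Z : Set (Ideal A) := {I | I.IsHopfIdeal k ∧ ∀ g, p g ∈ I → p g = 0}
  have h0 : (⊥ : Ideal A) ∈ Z := by
    refine ⟨?_, fun g hg => hg⟩
    have h1 := isHopfIdeal_ker (BialgHom.id k A)
    have h2 : RingHom.ker (BialgHom.id k A : A →ₐ[k] A) = ⊥ :=
      (RingHom.injective_iff_ker_eq_bot _).1 Function.injective_id
    rwa [h2] at h1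
  obtain ⟨I, -, hI⟩ := zorn_le_nonempty₀ Z (fun c hcZ hc J hJ =>
    ⟨sSup c, ⟨isHopfIdeal_sSup ⟨J, hJ⟩ hc fun I hI => (hcZ hI).1, fun g hg => by
      obtain ⟨I, hI, hgI⟩ := (Submodule.mem_sSup_of_directed ⟨J, hJ⟩ hc.directedOn).1 hg
      exact (hcZ hI).2 g hgI⟩, fun _ => le_sSup⟩) ⊥ h0
  have : I.IsHopfIdeal k := hI.prop.1
  let q := Bialgebra.Quotient.mkBialgHom (R := k) I
  have hs : Function.Surjective (q.comp p) := surjective_of_maximal h hB I hI.prop.2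
    fun J hJ hJp hIJ => hI.le_of_ge ⟨hJ, hJp⟩ hIJ
  have hinj : Function.Injective (q.comp p) := by
    refine (injective_iff_map_eq_zero (q.comp p)).2 fun g hg => ?_
    have h1 : p g = 0 := hI.prop.2 g (Ideal.Quotient.eq_zero_iff_mem.1 hg)
    exact h.injective (h1.trans (map_zero p).symm)
  let e := BialgEquiv.ofBijective (q.comp p) ⟨hinj, hs⟩
  refine ⟨(e.symm : A ⧸ I →ₐc[k] ConstCoord k S).comp q, BialgHom.ext fun g => ?_⟩
  exact e.symm_apply_apply g

end AffineGroup

/-! ### Hopf algebras of representative functions -/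

/-- An algebra `A` of functions on a group `G` (given by the evaluations at the elements of `G`) is
representative if it is stable under inversion and if, for each `f` in it, the function
`(g, h) ↦ f (g * h)` is a finite sum of products of functions of `g` and functions of `h` in `A`. -/
structure IsRepresentative {k G A : Type*} [Field k] [Group G] [CommRing A] [Algebra k A]
    (ev : G → A →ₐ[k] k) : Prop where
  eq_zero : ∀ f, (∀ g, ev g f = 0) → f = 0
  exists_comul : ∀ f : A, ∃ z : A ⊗[k] A, ∀ g h : G,
    Algebra.TensorProduct.productMap (ev g) (ev h) z = ev (g * h) f
  exists_inv : ∀ f : A, ∃ f' : A, ∀ g, ev g f' = ev g⁻¹ f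

namespace IsRepresentative

open TensorProduct TensorSub WithConv

variable {k G A : Type*} [Field k] [Group G] [CommRing A] [Algebra k A] {ev : G → A →ₐ[k] k}

theorem eq_of_ev (hA : IsRepresentative ev) {f f' : A} (h : ∀ g, ev g f = ev g f') : f = f' :=
  sub_eq_zero.1 <| hA.eq_zero _ fun g => by rw [map_sub, h, sub_self]

theorem eq_of_ev_rTensor (hA : IsRepresentative ev) {M : Type*} [AddCommGroup M] [Module k M]
    {z w : A ⊗[k] M}
    (h : ∀ g, (ev g).toLinearMap.rTensor M z = (ev g).toLinearMap.rTensor M w) : z = w := by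
  rw [← sub_eq_zero]
  refine eq_zero_of_slice fun χ => hA.eq_zero _ fun g => ?_
  have h1 := slice_map (ev g).toLinearMap χ (z - w)
  rw [map_sub, h g, sub_self, map_zero] at h1
  exact h1.symm

theorem eq_of_ev_lTensor (hA : IsRepresentative ev) {M : Type*} [AddCommGroup M] [Module k M]
    {z w : M ⊗[k] A}
    (h : ∀ g, (ev g).toLinearMap.lTensor M z = (ev g).toLinearMap.lTensor M w) : z = w := by
  refine (TensorProduct.comm k M A).injective (hA.eq_of_ev_rTensor fun g => ?_)
  have h1 : ∀ z : M ⊗[k] A, (ev g).toLinearMap.rTensor M (TensorProduct.comm k M A z) =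
      TensorProduct.comm k M k ((ev g).toLinearMap.lTensor M z) := by
    intro z
    induction z with
    | zero => simp
    | add a b ha hb => simp only [map_add, ha, hb]
    | tmul a b => simp
  rw [h1, h1, h]

theorem one_tmul_lid {M : Type*} [AddCommGroup M] [Module k M] (y : k ⊗[k] M) :
    (1 : k) ⊗ₜ TensorProduct.lid k M y = y := by
  induction y with
  | zero => simp
  | add a b ha hb => rw [map_add, tmul_add, ha, hb]
  | tmul a b => rw [TensorProduct.lid_tmul, tmul_smul, smul_tmul', smul_eq_mul, mul_one]

/-- The tensor square embeds in the functions on G × G, so identities in it can be checked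
pointwise. -/
theorem ext_two (hA : IsRepresentative ev) {z w : A ⊗[k] A}
    (h : ∀ g h, Algebra.TensorProduct.productMap (ev g) (ev h) z =
      Algebra.TensorProduct.productMap (ev g) (ev h) w) : z = w := by
  refine hA.eq_of_ev_rTensor fun g => ?_
  rw [← one_tmul_lid ((ev g).toLinearMap.rTensor A z),
    ← one_tmul_lid ((ev g).toLinearMap.rTensor A w)]
  congr 1
  refine hA.eq_of_ev fun l => ?_
  have h1 : ∀ z : A ⊗[k] A, ev l (TensorProduct.lid k A ((ev g).toLinearMap.rTensor A z)) =
      Algebra.TensorProduct.productMap (ev g) (ev l) z := by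
    intro z
    induction z with
    | zero => simp
    | add a b ha hb => simp only [map_add, ha, hb]
    | tmul a b => simp
  rw [h1, h1, h]

theorem ext_three (hA : IsRepresentative ev) {z w : A ⊗[k] (A ⊗[k] A)}
    (h : ∀ g h l, Algebra.TensorProduct.productMap (ev g)
      (Algebra.TensorProduct.productMap (ev h) (ev l)) z =
      Algebra.TensorProduct.productMap (ev g)
        (Algebra.TensorProduct.productMap (ev h) (ev l)) w) : z = w := by
  refine hA.eq_of_ev_rTensor fun g => ?_
  rw [← one_tmul_lid ((ev g).toLinearMap.rTensor _ z),
    ← one_tmul_lid ((ev g).toLinearMap.rTensor _ w)]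
  congr 1
  refine hA.ext_two fun l m => ?_
  have h2 : ∀ z : A ⊗[k] (A ⊗[k] A), Algebra.TensorProduct.productMap (ev l) (ev m)
      (TensorProduct.lid k _ ((ev g).toLinearMap.rTensor _ z)) =
      Algebra.TensorProduct.productMap (ev g)
        (Algebra.TensorProduct.productMap (ev l) (ev m)) z := by
    intro z
    induction z with
    | zero => simp
    | add a b ha hb => simp only [map_add, ha, hb]
    | tmul a b => simp
  rw [h2, h2, h]

/-- The comultiplication of a representative algebra of functions. -/
noncomputable def comulAlgHom (hA : IsRepresentative ev) : A →ₐ[k] A ⊗[k] A where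
  toFun f := (hA.exists_comul f).choose
  map_one' := hA.ext_two fun g h => by
    rw [(hA.exists_comul 1).choose_spec, map_one, map_one]
  map_mul' a b := hA.ext_two fun g h => by
    rw [map_mul, (hA.exists_comul _).choose_spec, (hA.exists_comul a).choose_spec,
      (hA.exists_comul b).choose_spec, map_mul]
  map_zero' := hA.ext_two fun g h => by
    rw [(hA.exists_comul 0).choose_spec, map_zero, map_zero]
  map_add' a b := hA.ext_two fun g h => by
    rw [map_add, (hA.exists_comul _).choose_spec, (hA.exists_comul a).choose_spec,
      (hA.exists_comul b).choose_spec, map_add]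
  commutes' c := hA.ext_two fun g h => by
    rw [(hA.exists_comul _).choose_spec, AlgHom.commutes, AlgHom.commutes]

theorem productMap_comulAlgHom (hA : IsRepresentative ev) (g h : G) (f : A) :
    Algebra.TensorProduct.productMap (ev g) (ev h) (hA.comulAlgHom f) = ev (g * h) f :=
  (hA.exists_comul f).choose_spec g h

theorem coassoc (hA : IsRepresentative ev) :
    (Algebra.TensorProduct.assoc k k k A A A).toAlgHom.comp
      ((Algebra.TensorProduct.map hA.comulAlgHom (.id k A)).comp hA.comulAlgHom) =
      (Algebra.TensorProduct.map (.id k A) hA.comulAlgHom).comp hA.comulAlgHom := by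
  refine AlgHom.ext fun f => hA.ext_three fun g h l => ?_
  have h1 : ∀ z : A ⊗[k] A, Algebra.TensorProduct.productMap (ev g)
      (Algebra.TensorProduct.productMap (ev h) (ev l)) (Algebra.TensorProduct.assoc k k k A A A
        (Algebra.TensorProduct.map hA.comulAlgHom (AlgHom.id k A) z)) =
      Algebra.TensorProduct.productMap (ev (g * h)) (ev l) z := by
    intro z
    induction z with
    | zero => simp
    | add a b ha hb => simp only [map_add, ha, hb]
    | tmul a b =>
      have h2 : ∀ w : A ⊗[k] A, Algebra.TensorProduct.productMap (ev g)
          (Algebra.TensorProduct.productMap (ev h) (ev l))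
          (Algebra.TensorProduct.assoc k k k A A A (w ⊗ₜ b)) =
          Algebra.TensorProduct.productMap (ev g) (ev h) w * ev l b := by
        intro w
        induction w with
        | zero => simp
        | add a b ha hb => simp only [map_add, add_tmul, ha, hb, add_mul]
        | tmul c d => simp [mul_assoc]
      rw [Algebra.TensorProduct.map_tmul, AlgHom.id_apply, h2, productMap_comulAlgHom,
        Algebra.TensorProduct.productMap_apply_tmul]
  have h2 : ∀ z : A ⊗[k] A, Algebra.TensorProduct.productMap (ev g)
      (Algebra.TensorProduct.productMap (ev h) (ev l)) (Algebra.TensorProduct.map (AlgHom.id k A)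
        hA.comulAlgHom z) = Algebra.TensorProduct.productMap (ev g) (ev (h * l)) z := by
    intro z
    induction z with
    | zero => simp
    | add a b ha hb => simp only [map_add, ha, hb]
    | tmul a b =>
      rw [Algebra.TensorProduct.map_tmul, Algebra.TensorProduct.productMap_apply_tmul,
        productMap_comulAlgHom, Algebra.TensorProduct.productMap_apply_tmul, AlgHom.id_apply]
  refine (h1 (hA.comulAlgHom f)).trans (Eq.trans ?_ (h2 (hA.comulAlgHom f)).symm)
  rw [productMap_comulAlgHom, productMap_comulAlgHom, mul_assoc]

theorem rTensor_counit (hA : IsRepresentative ev) :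
    (Algebra.TensorProduct.map (ev 1) (.id k A)).comp hA.comulAlgHom =
      (Algebra.TensorProduct.lid k A).symm.toAlgHom := by
  refine AlgHom.ext fun f => ?_
  have h1 : ∀ z : A ⊗[k] A, Algebra.TensorProduct.map (ev 1) (AlgHom.id k A) z =
      (ev 1).toLinearMap.rTensor A z := fun _ => rfl
  change Algebra.TensorProduct.map (ev 1) (AlgHom.id k A) (hA.comulAlgHom f) = (1 : k) ⊗ₜ[k] f
  rw [h1, ← one_tmul_lid ((ev 1).toLinearMap.rTensor A _)]
  congr 1
  refine hA.eq_of_ev fun g => ?_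
  have h2 : ∀ z : A ⊗[k] A, ev g (TensorProduct.lid k A ((ev 1).toLinearMap.rTensor A z)) =
      Algebra.TensorProduct.productMap (ev 1) (ev g) z := by
    intro z
    induction z with
    | zero => simp
    | add a b ha hb => simp only [map_add, ha, hb]
    | tmul a b => simp
  rw [h2, productMap_comulAlgHom, one_mul]

theorem lTensor_counit (hA : IsRepresentative ev) :
    (Algebra.TensorProduct.map (.id k A) (ev 1)).comp hA.comulAlgHom =
      (Algebra.TensorProduct.rid k k A).symm.toAlgHom := by
  refine AlgHom.ext fun f => hA.eq_of_ev_rTensor fun g => ?_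
  have h1 : ∀ z : A ⊗[k] A, (ev g).toLinearMap.rTensor k
      (Algebra.TensorProduct.map (AlgHom.id k A) (ev 1) z) =
      Algebra.TensorProduct.productMap (ev g) (ev 1) z ⊗ₜ[k] (1 : k) := by
    intro z
    induction z with
    | zero => simp
    | add a b ha hb => simp only [map_add, add_tmul, ha, hb]
    | tmul a b =>
      rw [Algebra.TensorProduct.productMap_apply_tmul, mul_comm, ← smul_eq_mul (ev 1 b),
        ← smul_tmul', ← tmul_smul, smul_eq_mul, mul_one]
      rfl
  refine (h1 (hA.comulAlgHom f)).trans ?_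
  rw [productMap_comulAlgHom, mul_one]
  rfl

/-- The bialgebra structure on a representative algebra of functions. -/
noncomputable abbrev bialgebra (hA : IsRepresentative ev) : Bialgebra k A :=
  Bialgebra.ofAlgHom hA.comulAlgHom (ev 1) hA.coassoc hA.rTensor_counit hA.lTensor_counit

/-- The antipode of a representative algebra of functions. -/
noncomputable def antipode (hA : IsRepresentative ev) : A →ₗ[k] A where
  toFun f := (hA.exists_inv f).choose
  map_add' a b := hA.eq_of_ev fun g => by
    rw [map_add]
    refine ((hA.exists_inv (a + b)).choose_spec g).trans ?_
    rw [map_add]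
    exact (congrArg₂ (· + ·) ((hA.exists_inv a).choose_spec g) ((hA.exists_inv b).choose_spec g)).symm
  map_smul' c a := hA.eq_of_ev fun g => by
    refine ((hA.exists_inv (c • a)).choose_spec g).trans ?_
    rw [map_smul, map_smul]
    exact (congrArg (c • ·) ((hA.exists_inv a).choose_spec g)).symm

theorem ev_antipode (hA : IsRepresentative ev) (g : G) (f : A) :
    ev g (hA.antipode f) = ev g⁻¹ f :=
  (hA.exists_inv f).choose_spec g

/-- The Hopf algebra structure on a representative algebra of functions. -/
noncomputable abbrev hopfAlgebra (hA : IsRepresentative ev) : HopfAlgebra k A :=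
  { hA.bialgebra with
    antipode := hA.antipode
    mul_antipode_rTensor_comul := by
      refine LinearMap.ext fun f => hA.eq_of_ev fun g => ?_
      have h1 : ∀ z : A ⊗[k] A, ev g (LinearMap.mul' k A (hA.antipode.rTensor A z)) =
          Algebra.TensorProduct.productMap (ev g⁻¹) (ev g) z := by
        intro z
        induction z with
        | zero => simp
        | add a b ha hb => simp only [map_add, ha, hb]
        | tmul a b => simp [ev_antipode]
      refine (h1 (hA.comulAlgHom f)).trans ?_
      rw [productMap_comulAlgHom, inv_mul_cancel]
      exact ((ev g).commutes _).symm
    mul_antipode_lTensor_comul := by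
      refine LinearMap.ext fun f => hA.eq_of_ev fun g => ?_
      have h1 : ∀ z : A ⊗[k] A, ev g (LinearMap.mul' k A (hA.antipode.lTensor A z)) =
          Algebra.TensorProduct.productMap (ev g) (ev g⁻¹) z := by
        intro z
        induction z with
        | zero => simp
        | add a b ha hb => simp only [map_add, ha, hb]
        | tmul a b => simp [ev_antipode]
      refine (h1 (hA.comulAlgHom f)).trans ?_
      rw [productMap_comulAlgHom, mul_inv_cancel]
      exact ((ev g).commutes _).symm }

end IsRepresentative

/-- Functions `(g, h) ↦ f (g * h)` for `f` in a finite-dimensional space of functions stable under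
translations. -/
theorem exists_sum_of_translates {k G : Type*} [Field k] [Group G] (E : Submodule k (G → k))
    [FiniteDimensional k E] (f : G → k) (hr : ∀ h, (fun g => f (g * h)) ∈ E)
    (hl : ∀ g, (fun h => f (g * h)) ∈ E) :
    ∃ (n : ℕ) (a b : Fin n → E), ∀ g h, ∑ i, (a i).1 g * (b i).1 h = f (g * h) := by
  let r : G → E := fun h => ⟨_, hr h⟩
  let c : Module.Dual k E →ₗ[k] (G → k) := LinearMap.pi fun h => LinearMap.applyₗ (r h)
  -- For evaluation at g, the image under `c` is h ↦ f(gh), which lies in `E`. Evaluations separate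
  -- `E` and so span its finite-dimensional dual, hence `c` maps the whole dual into `E`.
  have htop : E.comap c = ⊤ := by
    rw [← Subspace.dualCoannihilator_dualAnnihilator_eq (W := E.comap c)]
    have h1 : (E.comap c).dualCoannihilator = ⊥ := by
      refine eq_bot_iff.2 fun e he => Subtype.ext (funext fun g => ?_)
      rw [Submodule.mem_dualCoannihilator] at he
      exact he ((LinearMap.proj g).comp E.subtype) (hl g)
    rw [h1, Submodule.dualAnnihilator_bot]
  let b := Module.finBasis k E
  have hb : ∀ i, c (b.coord i) ∈ E := fun i => by
    have : b.coord i ∈ E.comap c := htop ▸ Submodule.mem_top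
    exact this
  refine ⟨_, b, fun i => ⟨_, hb i⟩, fun g h => ?_⟩
  have h1 := congrArg (fun e : E => e.1 g) (b.sum_repr (r h))
  simp only [AddSubmonoidClass.coe_finsetSum, Finset.sum_apply] at h1
  exact Eq.trans (Finset.sum_congr rfl fun i _ => mul_comm _ _) h1

/-! ### Functions which are unipotent along a normal subgroup -/

section UnipFun

variable (k : Type*) {G : Type*} [Field k] [Group G]

/-- The functions on `G` which are killed by `n` successive differences along the right translations
by elements of `N`. -/
def unipFun (N : Subgroup G) : ℕ → Submodule k (G → k)
  | 0 => ⊥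
  | n + 1 => ⨅ x : N, (unipFun N n).comap (LinearMap.funLeft k k (· * (x : G)) - LinearMap.id)

variable {k} {N : Subgroup G}

theorem mem_unipFun_succ {n : ℕ} {f : G → k} :
    f ∈ unipFun k N (n + 1) ↔ ∀ x ∈ N, (fun g => f (g * x) - f g) ∈ unipFun k N n := by
  simp only [unipFun, Submodule.mem_iInf, Submodule.mem_comap, Subtype.forall]
  rfl

theorem mem_unipFun_zero {f : G → k} : f ∈ unipFun k N 0 ↔ ∀ g, f g = 0 :=
  funext_iff

theorem mem_unipFun_one {f : G → k} : f ∈ unipFun k N 1 ↔ ∀ x ∈ N, ∀ g, f (g * x) = f g := by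
  simp only [mem_unipFun_succ, mem_unipFun_zero, sub_eq_zero]

theorem unipFun_le_succ (n : ℕ) : unipFun k N n ≤ unipFun k N (n + 1) := by
  induction n with
  | zero => exact bot_le
  | succ n ih =>
    intro f hf
    rw [mem_unipFun_succ] at hf ⊢
    exact fun x hx => ih (hf x hx)

theorem unipFun_mono : Monotone (unipFun k N) := monotone_nat_of_le_succ unipFun_le_succ

theorem left_translate_mem_unipFun {n : ℕ} {f : G → k} (hf : f ∈ unipFun k N n) (h : G) :
    (fun g => f (h * g)) ∈ unipFun k N n := by
  induction n generalizing f with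
  | zero => exact mem_unipFun_zero.2 fun g => mem_unipFun_zero.1 hf _
  | succ n ih =>
    rw [mem_unipFun_succ] at hf ⊢
    intro x hx
    simpa only [mul_assoc] using ih (hf x hx)

theorem right_translate_mem_unipFun [N.Normal] {n : ℕ} {f : G → k} (hf : f ∈ unipFun k N n)
    (h : G) : (fun g => f (g * h)) ∈ unipFun k N n := by
  induction n generalizing f with
  | zero => exact mem_unipFun_zero.2 fun g => mem_unipFun_zero.1 hf _
  | succ n ih =>
    rw [mem_unipFun_succ] at hf ⊢
    intro x hx
    have hx' : h⁻¹ * x * h ∈ N := by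
      simpa using Subgroup.Normal.conj_mem ‹N.Normal› x hx h⁻¹
    refine (congrArg (· ∈ unipFun k N n) (funext fun g => ?_)).mp (ih (hf _ hx'))
    simp [mul_assoc]

/-- For invariant f, normality gives xg = g(g⁻¹xg). In general, left differences commute with right
ones. -/
theorem left_sub_mem_unipFun [N.Normal] {n : ℕ} {f : G → k} (hf : f ∈ unipFun k N (n + 1)) {x : G}
    (hx : x ∈ N) : (fun g => f (x * g) - f g) ∈ unipFun k N n := by
  induction n generalizing f with
  | zero =>
    rw [mem_unipFun_one] at hf
    refine mem_unipFun_zero.2 fun g => sub_eq_zero.2 ?_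
    have hx' : g⁻¹ * x * g ∈ N := by
      simpa using Subgroup.Normal.conj_mem ‹N.Normal› x hx g⁻¹
    rw [← hf _ hx' g]
    simp [mul_assoc]
  | succ n ih =>
    rw [mem_unipFun_succ] at hf ⊢
    intro y hy
    refine (congrArg (· ∈ unipFun k N n) (funext fun g => ?_)).mp (ih (hf y hy))
    rw [mul_assoc]
    ring

/-- The difference of a product is (difference of f) times a translate of f', plus f times
(difference of f'). -/
theorem mul_mem_unipFun [N.Normal] {n m : ℕ} {f f' : G → k} (hf : f ∈ unipFun k N n)
    (hf' : f' ∈ unipFun k N m) : f * f' ∈ unipFun k N (n + m) := by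
  induction hl : n + m generalizing n m f f' with
  | zero =>
    obtain ⟨rfl, rfl⟩ := Nat.add_eq_zero_iff.1 hl
    exact mem_unipFun_zero.2 fun g => mul_eq_zero_of_left (mem_unipFun_zero.1 hf g) _
  | succ l ih =>
    rcases n with _ | n
    · have h0 : f = 0 := funext (mem_unipFun_zero.1 hf)
      rw [h0, zero_mul]
      exact Submodule.zero_mem _
    rcases m with _ | m
    · have h0 : f' = 0 := funext (mem_unipFun_zero.1 hf')
      rw [h0, mul_zero]
      exact Submodule.zero_mem _
    refine mem_unipFun_succ.2 fun x hx => ?_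
    have h1 := ih (mem_unipFun_succ.1 hf x hx) (right_translate_mem_unipFun hf' x) (by omega)
    have h2 := ih hf (mem_unipFun_succ.1 hf' x hx) (by omega)
    refine (congrArg (· ∈ unipFun k N l) (funext fun g => ?_)).mp (Submodule.add_mem _ h1 h2)
    simp only [Pi.add_apply, Pi.mul_apply]
    ring

theorem inv_mem_unipFun [N.Normal] {n : ℕ} {f : G → k} (hf : f ∈ unipFun k N n) :
    (fun g => f g⁻¹) ∈ unipFun k N n := by
  induction n generalizing f with
  | zero => exact mem_unipFun_zero.2 fun g => mem_unipFun_zero.1 hf _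
  | succ n ih =>
    refine mem_unipFun_succ.2 fun x hx => ?_
    simpa only [mul_inv_rev] using ih (left_sub_mem_unipFun hf (N.inv_mem hx))

theorem fg_unipFun_one [N.FiniteIndex] : (unipFun k N 1).FG := by
  have : Finite (G ⧸ N) := Subgroup.finite_quotient_of_finiteIndex
  have h : unipFun k N 1 ≤ LinearMap.range (LinearMap.funLeft k k (QuotientGroup.mk : G → G ⧸ N)) := by
    intro f hf
    rw [mem_unipFun_one] at hf
    refine ⟨fun q => f q.out, funext fun g => ?_⟩
    obtain ⟨x, hx⟩ := QuotientGroup.mk_out_eq_mul N g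
    change f (QuotientGroup.mk g : G ⧸ N).out = f g
    rw [hx, hf _ x.2]
  have := Submodule.finiteDimensional_of_le h
  exact (Submodule.fg_iff_finiteDimensional _).2 this

/-- Differences along finitely many generators map step n + 1 to a finite power of step n. Their
kernel consists of N-invariant functions, that is, functions on the finite set G/N. -/
theorem fg_unipFun [N.FiniteIndex] (hN : N.FG) (n : ℕ) : (unipFun k N n).FG := by
  obtain ⟨T, hT⟩ := hN
  have hTN : ∀ t ∈ T, t ∈ N := fun t ht => hT ▸ Subgroup.subset_closure ht
  induction n with
  | zero => exact Submodule.fg_bot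
  | succ n ih =>
    let D : (G → k) →ₗ[k] (T → G → k) := LinearMap.pi fun t =>
      LinearMap.funLeft k k (· * (t : G)) - LinearMap.id
    refine Submodule.fg_of_fg_map_of_fg_inf_ker D ?_ ?_
    · have h1 : (Submodule.pi Set.univ fun _ : T => unipFun k N n).FG := Submodule.fg_pi fun _ => ih
      have := (Submodule.fg_iff_finiteDimensional _).1 h1
      have h2 : (unipFun k N (n + 1)).map D ≤ Submodule.pi Set.univ fun _ : T => unipFun k N n := by
        rintro _ ⟨f, hf, rfl⟩ t -
        exact mem_unipFun_succ.1 hf t (hTN t t.2)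
      have := Submodule.finiteDimensional_of_le h2
      exact (Submodule.fg_iff_finiteDimensional _).2 this
    · have h1 : unipFun k N (n + 1) ⊓ LinearMap.ker D ≤ unipFun k N 1 := by
        rintro f ⟨-, hf⟩
        refine mem_unipFun_one.2 fun x hx => ?_
        rw [← hT] at hx
        induction hx using Subgroup.closure_induction with
        | mem t ht => exact fun g => sub_eq_zero.1 (congrFun (congrFun hf ⟨t, ht⟩) g)
        | one => simp
        | mul x y _ _ h1 h2 => exact fun g => by rw [← mul_assoc, h2, h1]
        | inv x _ h1 => exact fun g => by rw [← h1, inv_mul_cancel_right]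
      have := (Submodule.fg_iff_finiteDimensional _).1 (fg_unipFun_one (k := k) (N := N))
      have := Submodule.finiteDimensional_of_le h1
      exact (Submodule.fg_iff_finiteDimensional _).2 this

variable (k N)

/-- The algebra of functions which are unipotent along a normal subgroup. -/
def unipAlg [N.Normal] : Subalgebra k (G → k) where
  carrier := {f | ∃ n, f ∈ unipFun k N n}
  mul_mem' := fun ⟨_, hn⟩ ⟨_, hm⟩ => ⟨_, mul_mem_unipFun hn hm⟩
  add_mem' := fun ⟨n, hn⟩ ⟨m, hm⟩ => ⟨max n m, Submodule.add_mem _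
    (unipFun_mono (le_max_left n m) hn) (unipFun_mono (le_max_right n m) hm)⟩
  algebraMap_mem' _ := ⟨1, mem_unipFun_one.2 fun _ _ _ => rfl⟩

variable {k N}

theorem isRepresentative_unipAlg [N.Normal] [N.FiniteIndex] (hN : N.FG) :
    IsRepresentative fun g => (Pi.evalAlgHom k (fun _ : G => k) g).comp (unipAlg k N).val where
  eq_zero f h := Subtype.ext (funext h)
  exists_comul f := by
    obtain ⟨f, m, hm⟩ := f
    have := (Submodule.fg_iff_finiteDimensional _).1 (fg_unipFun (k := k) hN m)
    obtain ⟨n, a, b, h⟩ := exists_sum_of_translates (unipFun k N m) f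
      (right_translate_mem_unipFun hm) (left_translate_mem_unipFun hm)
    let e : unipFun k N m → unipAlg k N := fun f => ⟨f, m, f.2⟩
    refine ⟨∑ i, e (a i) ⊗ₜ e (b i), fun g h' => ?_⟩
    rw [map_sum]
    exact (Finset.sum_congr rfl fun i _ => Algebra.TensorProduct.productMap_apply_tmul ..).trans
      (h g h')
  exists_inv f := by
    obtain ⟨f, m, hm⟩ := f
    exact ⟨⟨fun g => f g⁻¹, m, inv_mem_unipFun hm⟩, fun g => rfl⟩

end UnipFun

/-- A group scheme with coordinate ring `A`, with a morphism of `G` to its `k`-points, such that `A`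
is identified with the functions on `G` which are unipotent along `N`. -/
structure IsUnipCoord {k G A : Type*} [Field k] [Group G] [CommRing A] [HopfAlgebra k A]
    (N : Subgroup G) (ψ : G →* Points k A) : Prop where
  eq_zero : ∀ f, (∀ g, ψ g f = 0) → f = 0
  exists_mem : ∀ f, ∃ n, (fun g => ψ g f) ∈ unipFun k N n
  exists_eq : ∀ (n : ℕ), ∀ f ∈ unipFun k N n, ∃ a, ∀ g, ψ g a = f g

theorem exists_isUnipCoord (k : Type u) {G : Type u} [Field k] [Group G] (N : Subgroup G)
    [N.Normal] [N.FiniteIndex] (hN : N.FG) :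
    ∃ (A : Type u) (_ : CommRing A) (_ : HopfAlgebra k A) (ψ : G →* Points k A),
      IsUnipCoord N ψ := by
  have hA := isRepresentative_unipAlg (k := k) hN
  let := hA.hopfAlgebra
  let ψ : G →* Points k (unipAlg k N) :=
    { toFun := fun g => WithConv.toConv ((Pi.evalAlgHom k (fun _ : G => k) g).comp (unipAlg k N).val)
      map_one' := rfl
      map_mul' := fun g h => WithConv.ext (AlgHom.ext fun f =>
        ((AffineGroup.mul_apply _ _ f).trans (hA.productMap_comulAlgHom g h f)).symm) }
  exact ⟨unipAlg k N, inferInstance, hA.hopfAlgebra, ψ,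
    { eq_zero := fun f h => Subtype.ext (funext h)
      exists_mem := fun f => f.2
      exists_eq := fun n f hf => ⟨⟨f, n, hf⟩, fun _ => rfl⟩ }⟩

/-! ### Completions -/

namespace IsUnipCoord

open TensorProduct TensorSub WithConv Coalgebra AffineGroup

section Basic

variable {k G A : Type*} [Field k] [Group G] [CommRing A] [HopfAlgebra k A] {N : Subgroup G}
  {ψ : G →* Points k A}

theorem isRepresentative (h : IsUnipCoord N ψ) : IsRepresentative fun g => (ψ g).ofConv where
  eq_zero := h.eq_zero
  exists_comul f := ⟨comul (R := k) f, fun g g' => by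
    rw [map_mul]
    exact (mul_apply (ψ g) (ψ g') f).symm⟩
  exists_inv f := ⟨HopfAlgebra.antipode k f, fun g => by
    have h1 : pinv (ψ g) = ψ g⁻¹ := by
      rw [← mul_pinv_cancel_right (ψ g⁻¹) (ψ g), ← map_mul, inv_mul_cancel, map_one, one_mul]
    rw [← h1]
    rfl⟩

theorem eq_of_forall (h : IsUnipCoord N ψ) {f f' : A} (hf : ∀ g, ψ g f = ψ g f') : f = f' :=
  h.isRepresentative.eq_of_ev hf

theorem bialgHom_ext (h : IsUnipCoord N ψ) {A' : Type*} [CommRing A'] [HopfAlgebra k A']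
    {θ θ' : A' →ₐc[k] A} (hθ : ∀ g f, ψ g (θ f) = ψ g (θ' f)) : θ = θ' :=
  BialgHom.ext fun f => h.eq_of_forall fun g => hθ g f

/-- Pull functions back to G and recognise them in `A`; compatibility with all structure is checked
pointwise on G. -/
theorem exists_bialgHom (h : IsUnipCoord N ψ) {A' : Type*} [CommRing A'] [HopfAlgebra k A']
    (ψ' : G →* Points k A') (hψ' : ∀ f, ∃ n, (fun g => ψ' g f) ∈ unipFun k N n) :
    ∃ θ : A' →ₐc[k] A, ∀ g f, ψ g (θ f) = ψ' g f := by
  have h1 : ∀ f, ∃ a, ∀ g, ψ g a = ψ' g f := fun f =>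
    let ⟨n, hn⟩ := hψ' f
    h.exists_eq n _ hn
  choose t ht using h1
  let θ : A' →ₐ[k] A :=
    { toFun := t
      map_one' := h.eq_of_forall fun g => by rw [ht, map_one, map_one]
      map_mul' := fun a b => h.eq_of_forall fun g => by rw [ht, map_mul, map_mul, ht, ht]
      map_zero' := h.eq_of_forall fun g => by rw [ht, map_zero, map_zero]
      map_add' := fun a b => h.eq_of_forall fun g => by rw [ht, map_add, map_add, ht, ht]
      commutes' := fun c => h.eq_of_forall fun g => by
        rw [ht]
        exact ((ψ' g).ofConv.commutes c).trans ((ψ g).ofConv.commutes c).symm }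
  have hθ : ∀ g f, ψ g (θ f) = ψ' g f := fun g f => ht f g
  refine ⟨BialgHom.ofAlgHom θ (AlgHom.ext fun f => ?_) (AlgHom.ext fun f => ?_), hθ⟩
  · have h2 := hθ 1 f
    rw [map_one, map_one] at h2
    exact h2
  · refine h.isRepresentative.ext_two fun g g' => ?_
    have h2 : ∀ z : A' ⊗[k] A', Algebra.TensorProduct.productMap (ψ g).ofConv (ψ g').ofConv
        (Algebra.TensorProduct.map θ θ z) =
        Algebra.TensorProduct.productMap (ψ' g).ofConv (ψ' g').ofConv z := by
      intro z
      induction z with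
      | zero => simp
      | add a b ha hb => simp only [map_add, ha, hb]
      | tmul a b =>
        rw [Algebra.TensorProduct.map_tmul, Algebra.TensorProduct.productMap_apply_tmul,
          Algebra.TensorProduct.productMap_apply_tmul]
        exact congrArg₂ (· * ·) (hθ g a) (hθ g' b)
    refine (h2 (comul f)).trans ((mul_apply (ψ' g) (ψ' g') f).symm.trans ?_)
    refine Eq.trans ?_ (mul_apply (ψ g) (ψ g') (θ f))
    rw [← map_mul, ← map_mul, hθ]

theorem of_equiv (h : IsUnipCoord N ψ) {A' : Type*} [CommRing A'] [HopfAlgebra k A']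
    {ψ' : G →* Points k A'} (θ : A →ₐc[k] A') (θ' : A' →ₐc[k] A)
    (hθ : ∀ g f, ψ' g (θ f) = ψ g f) (hθ' : ∀ g f, ψ g (θ' f) = ψ' g f)
    (hinv : ∀ f, θ (θ' f) = f) : IsUnipCoord N ψ' where
  eq_zero f hf := by
    rw [← hinv f, h.eq_zero (θ' f) fun g => (hθ' g f).trans (hf g), map_zero]
  exists_mem f := by
    obtain ⟨n, hn⟩ := h.exists_mem (θ' f)
    exact ⟨n, by simpa only [hθ'] using hn⟩
  exists_eq n f hf := by
    obtain ⟨a, ha⟩ := h.exists_eq n f hf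
    exact ⟨θ a, fun g => (hθ g a).trans (ha g)⟩

end Basic

/-- The action of a point on a representation. -/
noncomputable def _root_.AffineGroupRep.act {k A M : Type*} [Field k] [CommRing A]
    [HopfAlgebra k A] [AddCommGroup M] [Module k M] (ρ : AffineGroupRep k A M) (x : Points k A) :
    M →ₗ[k] M :=
  (TensorProduct.rid k M).toLinearMap ∘ₗ x.ofConv.toLinearMap.lTensor M ∘ₗ ρ.coact

theorem _root_.AffineGroupRep.act_mul {k A M : Type*} [Field k] [CommRing A]
    [HopfAlgebra k A] [AddCommGroup M] [Module k M] (ρ : AffineGroupRep k A M) (x y : Points k A)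
    (m : M) : ρ.act (x * y) m = ρ.act x (ρ.act y m) := by
  have h1 : ∀ z : M ⊗[k] A, TensorProduct.rid k M (x.ofConv.toLinearMap.lTensor M (ρ.coact
      (TensorProduct.rid k M (y.ofConv.toLinearMap.lTensor M z)))) =
      TensorProduct.rid k M
        ((Algebra.TensorProduct.productMap x.ofConv y.ofConv).toLinearMap.lTensor M
          (TensorProduct.assoc k M A A (ρ.coact.rTensor A z))) := by
    intro z
    induction z with
    | zero => simp
    | add a b ha hb => simp only [map_add, ha, hb]
    | tmul a b =>
      simp only [LinearMap.lTensor_tmul, LinearMap.rTensor_tmul, TensorProduct.rid_tmul, map_smul]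
      induction ρ.coact a with
      | zero => simp
      | add a b ha hb => simp only [map_add, add_tmul, smul_add, ha, hb]
      | tmul c d =>
        simp [smul_smul, mul_comm]
  have h2 : ∀ z : M ⊗[k] A, (x * y).ofConv.toLinearMap.lTensor M z =
      (Algebra.TensorProduct.productMap x.ofConv y.ofConv).toLinearMap.lTensor M
        ((comul (R := k)).lTensor M z) := by
    intro z
    induction z with
    | zero => simp
    | add a b ha hb => simp only [map_add, ha, hb]
    | tmul a b => exact congrArg (a ⊗ₜ[k] ·) (mul_apply x y b)
  refine Eq.trans ?_ (h1 (ρ.coact m)).symm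
  refine (congrArg (TensorProduct.rid k M) (h2 (ρ.coact m))).trans ?_
  exact congrArg (fun z => TensorProduct.rid k M
    ((Algebra.TensorProduct.productMap x.ofConv y.ofConv).toLinearMap.lTensor M z))
    (LinearMap.congr_fun ρ.coassoc m).symm

theorem _root_.AffineGroupRep.act_one {k A M : Type*} [Field k] [CommRing A]
    [HopfAlgebra k A] [AddCommGroup M] [Module k M] (ρ : AffineGroupRep k A M) (m : M) :
    ρ.act (1 : Points k A) m = m := by
  have h := congrArg (TensorProduct.rid k M) (LinearMap.congr_fun ρ.counit m)
  refine Eq.trans h ?_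
  simp

/-- The matrix coefficients of a vector m are unipotent of a common order n. If some x moves m, then
xm - m is nonzero of smaller order; the process ends at a vector fixed by K, hence by the group
scheme, as K is dense. -/
theorem isProunipotent {k K A : Type u} [Field k] [Group K] [CommRing A] [HopfAlgebra k A]
    {ι : K →* Points k A} (h : IsUnipCoord ⊤ ι) : IsProunipotent k A := by
  intro M _ _ _ ρ
  have hfix : ∀ m, (∀ x, ρ.act (ι x) m = m) → ρ.coact m = m ⊗ₜ[k] (1 : A) := by
    intro m hm
    refine h.isRepresentative.eq_of_ev_lTensor fun x => (TensorProduct.rid k M).injective ?_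
    refine (hm x).trans ?_
    simp
  have key : ∀ (n : ℕ) (m : M), m ≠ 0 →
      (∀ χ : Module.Dual k M, (fun x => χ (ρ.act (ι x) m)) ∈ unipFun k (⊤ : Subgroup K) n) →
      ∃ m : M, m ≠ 0 ∧ ρ.coact m = m ⊗ₜ[k] (1 : A) := by
    intro n
    induction n with
    | zero =>
      intro m hm h0
      refine absurd ((Module.forall_dual_apply_eq_zero_iff k m).1 fun χ => ?_) hm
      have h1 := mem_unipFun_zero.1 (h0 χ) 1
      rwa [map_one, ρ.act_one] at h1
    | succ n ih =>
      intro m hm h0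
      by_cases hx : ∀ x, ρ.act (ι x) m = m
      · exact ⟨m, hm, hfix m hx⟩
      push Not at hx
      obtain ⟨x, hx⟩ := hx
      refine ih (ρ.act (ι x) m - m) (sub_ne_zero.2 hx) fun χ => ?_
      refine (congrArg (· ∈ unipFun k (⊤ : Subgroup K) n) (funext fun y => ?_)).mp
        (mem_unipFun_succ.1 (h0 χ) x trivial)
      rw [map_mul, ρ.act_mul, map_sub, map_sub]
  obtain ⟨m, hm⟩ := exists_ne (0 : M)
  have hn : ∀ z : M ⊗[k] A, ∃ n, ∀ χ : Module.Dual k M,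
      (fun x => χ (TensorProduct.rid k M ((ι x).ofConv.toLinearMap.lTensor M z))) ∈
        unipFun k (⊤ : Subgroup K) n := by
    intro z
    induction z with
    | zero => exact ⟨0, fun χ => mem_unipFun_zero.2 fun x => by simp⟩
    | add a b ha hb =>
      obtain ⟨n, hn⟩ := ha
      obtain ⟨l, hl⟩ := hb
      refine ⟨max n l, fun χ => ?_⟩
      have h1 := Submodule.add_mem _ (unipFun_mono (le_max_left n l) (hn χ))
        (unipFun_mono (le_max_right n l) (hl χ))
      simp only [map_add]
      exact h1
    | tmul a b =>
      obtain ⟨n, hn⟩ := h.exists_mem b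
      refine ⟨n, fun χ => ?_⟩
      refine (congrArg (· ∈ unipFun k (⊤ : Subgroup K) n) (funext fun y => ?_)).mp
        (Submodule.smul_mem _ (χ a) hn)
      rw [LinearMap.lTensor_tmul, TensorProduct.rid_tmul, map_smul, Pi.smul_apply, smul_eq_mul,
        smul_eq_mul, mul_comm]
      rfl
  obtain ⟨n, hn⟩ := hn (ρ.coact m)
  exact key n m hm hn

/-- Functions on an affine group scheme restrict to unipotent functions along a subgroup which is
mapped to the points of a prounipotent subgroup. -/
theorem _root_.exists_mem_unipFun {k G A B : Type u} [Field k] [Group G] [CommRing A]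
    [HopfAlgebra k A] [CommRing B] [HopfAlgebra k B] {N : Subgroup G} (ψ : G →* Points k A)
    (i : A →ₐc[k] B) (hB : IsProunipotent k B)
    (hN : ∀ x ∈ N, ∃ v : B →ₐ[k] k, ψ x = toConv (v.comp (i : A →ₐ[k] B))) (f : A) :
    ∃ n, (fun g => ψ g f) ∈ unipFun k N n := by
  obtain ⟨n, hn⟩ := exists_mem_fixFilt hB (restrictRep i) f
  refine ⟨n, ?_⟩
  induction n generalizing f with
  | zero =>
    have h0 : f = 0 := hn
    exact mem_unipFun_zero.2 fun g => by rw [h0, map_zero]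
  | succ n ih =>
    refine mem_unipFun_succ.2 fun x hx => ?_
    obtain ⟨v, hv⟩ := hN x hx
    -- At x in N the second tensor factor takes scalar values, so f(gx) - f(g) is a combination of
    -- functions from the previous filtration step.
    have h1 : ∀ z ∈ left (fixFilt (restrictRep i).coact n) B,
        (fun g => Algebra.TensorProduct.productMap (ψ g).ofConv v z) ∈ unipFun k N n := by
      intro z hz
      refine left_induction (P := fun z =>
        (fun g => Algebra.TensorProduct.productMap (ψ g).ofConv v z) ∈ unipFun k N n)
        (by simp only [map_zero]; exact (unipFun k N n).zero_mem) (fun a b ha hb => ?_) (fun a ha b => ?_) hz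
      · simp only [map_add]
        exact Submodule.add_mem _ ha hb
      · simp only [Algebra.TensorProduct.productMap_apply_tmul]
        refine (congrArg (· ∈ unipFun k N n) (funext fun g => ?_)).mp
          (Submodule.smul_mem _ (v b) (ih a ha))
        exact mul_comm _ _
    refine (congrArg (· ∈ unipFun k N n) (funext fun g => ?_)).mp (h1 _ (mem_fixFilt_succ.1 hn))
    rw [map_sub, Algebra.TensorProduct.productMap_apply_tmul, map_one, mul_one, map_mul, hv]
    exact congrArg (· - ψ g f) (mul_comp_apply _ _ _ _).symm

end IsUnipCoord

/-! ### Unipotent functions and the universal properties -/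

section Existence

open WithConv AffineGroup ConstCoord

theorem restrict_mem_unipFun {k G : Type*} [Field k] [Group G] {N : Subgroup G} {n : ℕ}
    {f : G → k} (hf : f ∈ unipFun k N n) : (fun x : N => f x) ∈ unipFun k (⊤ : Subgroup N) n := by
  induction n generalizing f with
  | zero => exact mem_unipFun_zero.2 fun g => mem_unipFun_zero.1 hf _
  | succ n ih => exact mem_unipFun_succ.2 fun x _ => ih (mem_unipFun_succ.1 hf x x.2)

open Classical in
theorem extend_mem_unipFun {k G : Type*} [Field k] [Group G] {N : Subgroup G} {n : ℕ}
    {f : N → k} (hf : f ∈ unipFun k (⊤ : Subgroup N) n) :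
    (fun g => if h : g ∈ N then f ⟨g, h⟩ else 0) ∈ unipFun k N n := by
  induction n generalizing f with
  | zero =>
    refine mem_unipFun_zero.2 fun g => ?_
    split_ifs
    exacts [mem_unipFun_zero.1 hf _, rfl]
  | succ n ih =>
    refine mem_unipFun_succ.2 fun x hx => ?_
    refine (congrArg (· ∈ unipFun k N n) (funext fun g => ?_)).mp
      (ih (mem_unipFun_succ.1 hf ⟨x, hx⟩ trivial))
    by_cases hg : g ∈ N
    · rw [dif_pos hg, dif_pos hg, dif_pos (N.mul_mem hg hx)]
      rfl
    · rw [dif_neg hg, dif_neg hg, dif_neg fun h => hg ((N.mul_mem_cancel_right hx).1 h), sub_zero]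

theorem IsUnipCoord.isProunipotentCompletion {k K V : Type u} [Field k] [Group K] [CommRing V]
    [HopfAlgebra k V] {ι : K →* Points k V} (h : IsUnipCoord ⊤ ι) : IsProunipotentCompletion ι where
  prounipotent := h.isProunipotent
  initial V' _ _ ι' hV' := by
    obtain ⟨θ, hθ⟩ := h.exists_bialgHom ι' (exists_mem_unipFun ι' (BialgHom.id k V') hV'
      fun x _ => ⟨(ι' x).ofConv, rfl⟩)
    exact ⟨θ, hθ, fun θ' hθ' => h.bialgHom_ext fun g f => (hθ' g f).trans (hθ g f).symm⟩

/-- Initial objects are isomorphic, so the description by unipotent functions transfers to any given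
completion. -/
theorem IsProunipotentCompletion.isUnipCoord {k K V : Type u} [Field k] [Group K] [CommRing V]
    [HopfAlgebra k V] {ι : K →* Points k V} (h : IsProunipotentCompletion ι) (hK : Group.FG K) :
    IsUnipCoord ⊤ ι := by
  obtain ⟨A, _, _, ψ, hA⟩ := exists_isUnipCoord k (⊤ : Subgroup K) hK.out
  obtain ⟨θ, hθ, -⟩ := h.initial A ψ hA.isProunipotentCompletion.prounipotent
  obtain ⟨θ', hθ', -⟩ := hA.isProunipotentCompletion.initial V ι h.prounipotent
  refine hA.of_equiv θ θ' hθ hθ' fun f => ?_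
  obtain ⟨θ'', -, huniq⟩ := h.initial V ι h.prounipotent
  have h1 : θ.comp θ' = BialgHom.id k V := (huniq _ fun x f => (hθ x _).trans (hθ' x f)).trans
    (huniq _ fun x f => rfl).symm
  exact DFunLike.congr_fun h1 f

variable {k G S A : Type u} [Field k] [Group G] [Group S] [Fintype S] [DecidableEq S]
  [CommRing A] [HopfAlgebra k A] {φ : G →* S} {ψ : G →* Points k A}

theorem IsUnipCoord.exists_proj (h : IsUnipCoord φ.ker ψ) :
    ∃ p : ConstCoord k S →ₐc[k] A, ∀ g f, ψ g (p f) = f (φ g) := by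
  refine h.exists_bialgHom
    { toFun := fun g => point k k (φ g)
      map_one' := by rw [map_one, point_one]
      map_mul' := fun g g' => by rw [map_mul, point_mul] } fun f => ⟨1, ?_⟩
  refine mem_unipFun_one.2 fun x hx g => ?_
  change point k k (φ (g * x)) f = point k k (φ g) f
  rw [map_mul, MonoidHom.mem_ker.1 hx, mul_one]

/-- The functions unipotent along the kernel of a morphism to a finite group form an extension. -/
theorem IsUnipCoord.exists_isExtension (h : IsUnipCoord φ.ker ψ) (hφ : Function.Surjective φ)
    {p : ConstCoord k S →ₐc[k] A} (hp : ∀ g f, ψ g (p f) = f (φ g))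
    {B : Type u} [CommRing B] [HopfAlgebra k B] {ι : φ.ker →* Points k B}
    (hι : IsUnipCoord ⊤ ι) :
    ∃ i : A →ₐc[k] B, IsExtension i p ∧ ∀ (x : φ.ker) f, ι x (i f) = ψ x f := by
  obtain ⟨i, hi⟩ := hι.exists_bialgHom (ψ.comp φ.ker.subtype) fun f =>
    (h.exists_mem f).imp fun n hn => restrict_mem_unipFun hn
  refine ⟨i, ⟨?_, fun b => ?_, ?_⟩, hi⟩
  · refine (injective_iff_map_eq_zero p).2 fun f hf => funext fun s => ?_
    obtain ⟨g, rfl⟩ := hφ s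
    exact (hp g f).symm.trans (by rw [hf, map_zero]; rfl)
  · obtain ⟨n, hn⟩ := hι.exists_mem b
    -- Extension by zero off the kernel of φ shows that every unipotent function on the kernel is a
    -- restriction.
    obtain ⟨a, ha⟩ := h.exists_eq n _ (extend_mem_unipFun hn)
    refine ⟨a, hι.eq_of_forall fun x => (hi x a).trans ((ha x).trans ?_)⟩
    rw [dif_pos x.2]
  · refine le_antisymm (fun f hf => ?_) (Ideal.map_le_iff_le_comap.2 fun f hf => ?_)
    · have h1 : f = p (1 - delta k 1) * f := by
        refine h.eq_of_forall fun g => ?_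
        rw [map_mul, hp]
        by_cases hg : φ g = 1
        · have h2 : ψ g f = 0 := by
            have h3 := hi ⟨g, hg⟩ f
            rw [(hf : i f = 0), map_zero] at h3
            exact h3.symm
          rw [h2, mul_zero]
        · have h2 : (1 - delta k 1 : ConstCoord k S) (φ g) = 1 - (delta k 1 : S → k) (φ g) := rfl
          rw [h2, delta_apply, if_neg hg, sub_zero, one_mul]
      rw [h1]
      refine Ideal.mul_mem_right _ _ (Ideal.mem_map_of_mem _ ?_)
      have h2 : (1 - delta k 1 : ConstCoord k S) 1 = 1 - (delta k 1 : S → k) 1 := rfl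
      refine h2.trans ?_
      rw [delta_apply, if_pos rfl, sub_self]
    · refine hι.eq_of_forall fun x => (hi x _).trans ((hp x f).trans ?_)
      rw [map_zero, x.2]
      exact hf

theorem IsUnipCoord.isRelativeCompletion (h : IsUnipCoord φ.ker ψ) (hφ : Function.Surjective φ)
    (hK : φ.ker.FG) {p : ConstCoord k S →ₐc[k] A} (hp : ∀ g f, ψ g (p f) = f (φ g)) :
    IsRelativeCompletion φ p ψ where
  triangle := by
    have hK' : Group.FG φ.ker := Group.fg_iff_subgroup_fg _ |>.2 hK
    obtain ⟨B, _, _, ι, hι⟩ := exists_isUnipCoord k (⊤ : Subgroup φ.ker) hK'.out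
    obtain ⟨i, hi, -⟩ := h.exists_isExtension hφ hp hι
    exact ⟨⟨B, inferInstance, inferInstance, i, hi, hι.isProunipotent⟩, hp⟩
  initial A' _ _ p' ψ' h' := by
    obtain ⟨B', _, _, i', hi', hB'⟩ := h'.kernel
    obtain ⟨θ, hθ⟩ := h.exists_bialgHom ψ' (exists_mem_unipFun ψ' i' hB' fun x hx =>
      (IsKernel.of_isExtension hi').exists_eq_comp _ (ψ' x) (WithConv.ext (AlgHom.ext fun f => by
        refine (h'.comm x f).trans ?_
        rw [MonoidHom.mem_ker.1 hx]
        rfl)))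
    refine ⟨θ, ⟨h.bialgHom_ext fun g f => ?_, hθ⟩,
      fun θ' hθ' => h.bialgHom_ext fun g f => (hθ'.2 g f).trans (hθ g f).symm⟩
    exact (hθ g _).trans ((h'.comm g f).trans (hp g f).symm)

theorem IsRelativeCompletion.isUnipCoord {p : ConstCoord k S →ₐc[k] A}
    (h : IsRelativeCompletion φ p ψ) (hφ : Function.Surjective φ) (hK : φ.ker.FG) :
    IsUnipCoord φ.ker ψ := by
  obtain ⟨A₀, _, _, ψ₀, h₀⟩ := exists_isUnipCoord k φ.ker hK
  obtain ⟨p₀, hp₀⟩ := h₀.exists_proj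
  have h₁ := h₀.isRelativeCompletion hφ hK hp₀
  obtain ⟨θ, ⟨hp, hθ⟩, -⟩ := h.initial A₀ p₀ ψ₀ h₁.triangle
  obtain ⟨θ', ⟨hp', hθ'⟩, -⟩ := h₁.initial A p ψ h.triangle
  refine h₀.of_equiv θ θ' hθ hθ' fun f => ?_
  obtain ⟨θ'', -, huniq⟩ := h.initial A p ψ h.triangle
  have h2 : θ.comp θ' = BialgHom.id k A :=
    (huniq _ ⟨by rw [BialgHom.comp_assoc, hp', hp], fun x f => (hθ x _).trans (hθ' x f)⟩).trans
      (huniq _ ⟨BialgHom.id_comp _, fun x f => rfl⟩).symm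
  exact DFunLike.congr_fun h2 f

end Existence

/-! ### Split extensions are semidirect products -/

namespace IsExtension

open TensorProduct WithConv Coalgebra AffineGroup ConstCoord

variable {k A V S : Type u} [Field k] [CommRing A] [HopfAlgebra k A] [CommRing V]
  [HopfAlgebra k V] [Group S] [Fintype S] [DecidableEq S] {i : A →ₐc[k] V}
  {p : ConstCoord k S →ₐc[k] A}

/-- The points of a group attached to the elements of a finite constant subgroup. -/
def secPoint (σ : A →ₐc[k] ConstCoord k S) (R : Type*) [CommRing R] [Algebra k R] (s : S) :
    WithConv (A →ₐ[k] R) := pcomp σ (point k R s)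

section SecPoint

variable (σ : A →ₐc[k] ConstCoord k S) {R R' : Type*} [CommRing R] [Algebra k R] [CommRing R']
  [Algebra k R']

theorem secPoint_mul (s t : S) : secPoint σ R (s * t) = secPoint σ R s * secPoint σ R t := by
  rw [secPoint, point_mul, pcomp_mul]; rfl

theorem secPoint_one : secPoint σ R (1 : S) = 1 := by
  rw [secPoint, point_one, pcomp_one]

theorem pinv_secPoint (s : S) : pinv (secPoint σ R s) = secPoint σ R s⁻¹ := by
  rw [secPoint, ← pcomp_pinv, pinv_point]; rfl

theorem pmap_secPoint (h : R →ₐ[k] R') (s : S) : pmap h (secPoint σ R s) = secPoint σ R' s :=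
  WithConv.ext (AlgHom.ext fun _ => h.commutes _)

theorem pcomp_secPoint {σ : A →ₐc[k] ConstCoord k S} (hσ : σ.comp p = BialgHom.id k _) (s : S) :
    pcomp p (secPoint σ R s) = point k R s :=
  WithConv.ext (AlgHom.ext fun f => congrArg (point k R s) (DFunLike.congr_fun hσ f))

end SecPoint

theorem algHom_ext_comp {i : A →ₐc[k] V} (hi : Function.Surjective i) {R : Type*} [CommRing R]
    [Algebra k R] {v w : V →ₐ[k] R}
    (h : toConv (v.comp (i : A →ₐ[k] V)) = toConv (w.comp (i : A →ₐ[k] V))) : v = w := by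
  refine AlgHom.ext fun x => ?_
  obtain ⟨a, rfl⟩ := hi x
  exact congrArg (fun y => y.ofConv a) h

theorem pmap_comul (i : A →ₐc[k] V) : toConv ((Bialgebra.comulAlgHom k V).comp (i : A →ₐ[k] V)) =
    toConv (Algebra.TensorProduct.includeLeft.comp (i : A →ₐ[k] V)) *
      toConv (Algebra.TensorProduct.includeRight.comp (i : A →ₐ[k] V)) := by
  refine WithConv.ext (AlgHom.ext fun a => ?_)
  refine Eq.trans ?_ (mul_apply _ _ a).symm
  have h : ∀ z : A ⊗[k] A, Algebra.TensorProduct.productMap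
      ((Algebra.TensorProduct.includeLeft : V →ₐ[k] V ⊗[k] V).comp (i : A →ₐ[k] V))
      (Algebra.TensorProduct.includeRight.comp (i : A →ₐ[k] V)) z =
      TensorProduct.map (i : A →ₗ[k] V) (i : A →ₗ[k] V) z := by
    intro z
    induction z with
    | zero => simp
    | add a b ha hb => simp only [map_add, ha, hb]
    | tmul a b => simp
  exact ((h _).trans (CoalgHomClass.map_comp_comul_apply i a)).symm

theorem mul_mul_pinv {R : Type*} [CommRing R] [Algebra k R] (x u v : WithConv (A →ₐ[k] R)) :
    x * (u * v) * pinv x = x * u * pinv x * (x * v * pinv x) := by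
  simp only [mul_assoc, pinv_mul_cancel_left]

theorem mul_conj_mul {R : Type*} [CommRing R] [Algebra k R] (x u v z : WithConv (A →ₐ[k] R)) :
    u * (x * v * pinv x) * (x * z) = u * x * (v * z) := by
  simp only [mul_assoc, pinv_mul_cancel_left]

/-- Conjugating the generic point of the kernel by the section at s gives a point of the kernel,
whose pullback is `c`; the formula for all points follows by specialisation. -/
theorem exists_conj (h : IsExtension i p) (σ : A →ₐc[k] ConstCoord k S) (s : S) :
    ∃ c : V →ₐc[k] V, ∀ (R : Type u) [CommRing R] [Algebra k R] (v : V →ₐ[k] R),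
      toConv ((v.comp (c : V →ₐ[k] V)).comp (i : A →ₐ[k] V)) =
        secPoint σ R s * toConv (v.comp (i : A →ₐ[k] V)) * pinv (secPoint σ R s) := by
  have hK := IsKernel.of_isExtension h
  obtain ⟨c, hc⟩ := hK.exists_eq_comp V
    (secPoint σ V s * toConv (i : A →ₐ[k] V) * pinv (secPoint σ V s)) (by
      have h1 : pcomp p (toConv (i : A →ₐ[k] V)) = 1 := hK.pcomp_comp (AlgHom.id k V)
      rw [pcomp_mul, pcomp_mul, h1, mul_one, ← pcomp_mul, mul_pinv_cancel, pcomp_one])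
  have hc' : ∀ (R : Type u) [CommRing R] [Algebra k R] (v : V →ₐ[k] R),
      toConv ((v.comp c).comp (i : A →ₐ[k] V)) =
        secPoint σ R s * toConv (v.comp (i : A →ₐ[k] V)) * pinv (secPoint σ R s) := by
    intro R _ _ v
    have h1 := congrArg (pmap v) hc
    rw [pmap_mul, pmap_mul, pinv_secPoint, pmap_secPoint, pmap_secPoint, ← pinv_secPoint] at h1
    exact h1.symm
  refine ⟨BialgHom.ofAlgHom c (algHom_ext_comp h.surjective ?_)
    (algHom_ext_comp h.surjective ?_), hc'⟩
  · have h1 : toConv ((Bialgebra.counitAlgHom k V).comp (i : A →ₐ[k] V)) = 1 :=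
      WithConv.ext (AlgHom.ext fun a => CoalgHomClass.counit_comp_apply i a)
    rw [hc', h1, mul_one, mul_pinv_cancel]
  · rw [hc', pmap_comul]
    have h1 := congrArg (pmap (Algebra.TensorProduct.map c c)) (pmap_comul i)
    rw [pmap_mul] at h1
    refine h1.trans ?_
    have h2 : pmap (Algebra.TensorProduct.map c c)
        (toConv (Algebra.TensorProduct.includeLeft.comp (i : A →ₐ[k] V))) =
        toConv (((Algebra.TensorProduct.includeLeft : V →ₐ[k] V ⊗[k] V).comp c).comp
          (i : A →ₐ[k] V)) := WithConv.ext (AlgHom.ext fun a => by simp)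
    have h3 : pmap (Algebra.TensorProduct.map c c)
        (toConv (Algebra.TensorProduct.includeRight.comp (i : A →ₐ[k] V))) =
        toConv (((Algebra.TensorProduct.includeRight : V →ₐ[k] V ⊗[k] V).comp c).comp
          (i : A →ₐ[k] V)) := WithConv.ext (AlgHom.ext fun a => by simp)
    rw [h2, h3, hc', hc']
    exact (mul_mul_pinv _ _ _).symm

/-- This is (us)(vt) = u(svs⁻¹) · st for generic points u, v of the kernel. -/
theorem pmap_comul_mul_secPoint (σ : A →ₐc[k] ConstCoord k S) {c : V →ₐc[k] V} {s : S}
    (hc : toConv (((Algebra.TensorProduct.includeRight : V →ₐ[k] V ⊗[k] V).comp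
        (c : V →ₐ[k] V)).comp (i : A →ₐ[k] V)) =
      secPoint σ (V ⊗[k] V) s * toConv (Algebra.TensorProduct.includeRight.comp (i : A →ₐ[k] V)) *
        pinv (secPoint σ (V ⊗[k] V) s)) (t : S) :
    pmap ((Algebra.TensorProduct.map (AlgHom.id k V) (c : V →ₐ[k] V)).comp
      (Bialgebra.comulAlgHom k V)) (toConv (i : A →ₐ[k] V) * secPoint σ V (s * t)) =
    pmap Algebra.TensorProduct.includeLeft (toConv (i : A →ₐ[k] V) * secPoint σ V s) *
      pmap Algebra.TensorProduct.includeRight (toConv (i : A →ₐ[k] V) * secPoint σ V t) := by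
  rw [pmap_mul, pmap_mul, pmap_mul, pmap_secPoint, pmap_secPoint, pmap_secPoint, secPoint_mul]
  have h1 := congrArg (pmap (Algebra.TensorProduct.map (AlgHom.id k V) (c : V →ₐ[k] V)))
    (pmap_comul i)
  rw [pmap_mul] at h1
  have h2 : pmap (Algebra.TensorProduct.map (AlgHom.id k V) (c : V →ₐ[k] V))
      (toConv (Algebra.TensorProduct.includeLeft.comp (i : A →ₐ[k] V))) =
      pmap Algebra.TensorProduct.includeLeft (toConv (i : A →ₐ[k] V)) :=
    WithConv.ext (AlgHom.ext fun a => by simp)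
  have h3 : pmap (Algebra.TensorProduct.map (AlgHom.id k V) (c : V →ₐ[k] V))
      (toConv (Algebra.TensorProduct.includeRight.comp (i : A →ₐ[k] V))) =
      toConv (((Algebra.TensorProduct.includeRight : V →ₐ[k] V ⊗[k] V).comp
        (c : V →ₐ[k] V)).comp (i : A →ₐ[k] V)) := WithConv.ext (AlgHom.ext fun a => by simp)
  rw [h2, h3, hc] at h1
  refine (congrArg (· * (secPoint σ (V ⊗[k] V) s * secPoint σ (V ⊗[k] V) t)) h1).trans ?_
  exact mul_conj_mul _ _ _ _

/-- An extension of a finite constant group which has a section is a semidirect product. -/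
theorem exists_equiv_semidirect (h : IsExtension i p) {σ : A →ₐc[k] ConstCoord k S}
    (hσ : σ.comp p = BialgHom.id k _) :
    ∃ (ρ : S →* (V →ₐc[k] V)) (e : A ≃ₐc[k] SemidirectCoord ρ),
      (∀ f : ConstCoord k S, e (p f) = SemidirectCoord.proj ρ f) ∧
      ∀ f : A, SemidirectCoord.inl ρ (e f) = i f := by
  have hK := IsKernel.of_isExtension h
  choose c hc using h.exists_conj σ
  -- Pullback reverses composition; the inverse makes `ρ` a left action on functions.
  let ρ : S →* (V →ₐc[k] V) :=
    { toFun := fun s => c s⁻¹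
      map_one' := by
        have h1 : ((c 1⁻¹ : V →ₐc[k] V) : V →ₐ[k] V) = AlgHom.id k V := by
          refine algHom_ext_comp h.surjective ((hc _ V (AlgHom.id k V)).trans ?_)
          rw [pinv_secPoint]
          simp only [inv_one, secPoint_one, one_mul, mul_one]
        exact BialgHom.ext fun f => DFunLike.congr_fun h1 f
      map_mul' := fun s t => by
        have h1 : ((c (s * t)⁻¹ : V →ₐc[k] V) : V →ₐ[k] V) =
            (c s⁻¹ : V →ₐ[k] V).comp (c t⁻¹ : V →ₐ[k] V) := by
          refine algHom_ext_comp h.surjective ((hc _ V (AlgHom.id k V)).trans ?_)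
          rw [hc t⁻¹ V (c s⁻¹ : V →ₐ[k] V)]
          have h2 := hc s⁻¹ V (AlgHom.id k V)
          rw [AlgHom.id_comp] at h2
          rw [h2, pinv_secPoint, pinv_secPoint, pinv_secPoint, inv_inv, inv_inv, inv_inv,
            mul_inv_rev, secPoint_mul, secPoint_mul]
          simp only [mul_assoc]
        exact BialgHom.ext fun f => DFunLike.congr_fun h1 f }
  have hact : ∀ s f, SemidirectCoord.act ρ s f = c s f := fun s f => by
    change c s⁻¹⁻¹ f = _
    rw [inv_inv]
  let I : WithConv (A →ₐ[k] V) := toConv (i : A →ₐ[k] V)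
  have hI : pcomp p I = 1 := hK.pcomp_comp (AlgHom.id k V)
  -- The generic point u·s of the coset over s; `e₀` is pullback along (u, s) ↦ u·s.
  let y : S → WithConv (A →ₐ[k] V) := fun s => I * secPoint σ V s
  let e₀ : A →ₐ[k] (S → V) := AlgHom.pi fun s => (y s).ofConv
  have he₀ : ∀ a s, e₀ a s = y s a := fun _ _ => rfl
  have hy : ∀ s f, y s (p f) = algebraMap k V (f s) := fun s f => by
    have h1 : pcomp p (y s) = point k V s := by
      rw [pcomp_mul, hI, one_mul, pcomp_secPoint hσ]
    exact congrArg (fun x => x.ofConv f) h1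
  let e₁ : A →ₐc[k] SemidirectCoord ρ := BialgHom.ofAlgHom e₀ (by
      have h1 : pmap (Bialgebra.counitAlgHom k V) (y 1) = 1 := by
        rw [pmap_mul, pmap_secPoint, secPoint_one, mul_one]
        exact WithConv.ext (AlgHom.ext fun a => CoalgHomClass.counit_comp_apply i a)
      exact congrArg WithConv.ofConv h1) (by
      refine AlgHom.ext fun a => FinFun.ext_two (k := k) (V := V) (W := V) fun s t => ?_
      have h1 : ∀ z : A ⊗[k] A, TensorProduct.map (FinFun.ev k V s) (FinFun.ev k V t)
          (Algebra.TensorProduct.map e₀ e₀ z) = Algebra.TensorProduct.productMap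
            (pmap Algebra.TensorProduct.includeLeft (y s)).ofConv
            (pmap (Algebra.TensorProduct.includeRight : V →ₐ[k] V ⊗[k] V) (y t)).ofConv z := by
        intro z
        induction z with
        | zero => simp
        | add a b ha hb => simp only [map_add, ha, hb]
        | tmul a b => simp [he₀]
      refine (h1 (comul a)).trans ((mul_apply _ _ a).symm.trans ?_)
      refine Eq.trans ?_ (SemidirectCoord.ev_Δ ρ s t (e₀ a)).symm
      rw [LinearMap.ext (hact s)]
      exact (congrArg (fun x => x.ofConv a)
        (pmap_comul_mul_secPoint σ (hc s (V ⊗[k] V) Algebra.TensorProduct.includeRight) t)).symm)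
  have hinj : Function.Injective e₁ := by
    refine (injective_iff_map_eq_zero e₁).2 fun a ha => ?_
    -- The generic point of the fibre over s, divided by the section, lies in the kernel. The fibre
    -- point thus factors through `y s`, and a vanishes on the fibre.
    have h1 : ∀ s, a * p (delta k s) = 0 := by
      intro s
      let Q : Ideal A := Ideal.span {p (1 - delta k s)}
      let q : WithConv (A →ₐ[k] A ⧸ Q) := toConv (Ideal.Quotient.mkₐ k Q)
      have hq : pcomp p q = point k (A ⧸ Q) s := by
        refine eq_point_of_delta ?_
        have h2 : q (p (1 - delta k s)) = 0 :=
          Ideal.Quotient.eq_zero_iff_mem.2 (Ideal.subset_span rfl)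
        rw [map_sub, map_sub, map_one, map_one, sub_eq_zero] at h2
        exact h2.symm
      obtain ⟨v, hv⟩ := hK.exists_eq_comp _ (q * pinv (secPoint σ (A ⧸ Q) s)) (by
        rw [pcomp_mul, pcomp_pinv, hq, pcomp_secPoint hσ, mul_pinv_cancel])
      have h2 : q = pmap v (y s) := by
        rw [pmap_mul, pmap_secPoint]
        refine Eq.trans ?_ (congrArg (· * secPoint σ (A ⧸ Q) s) hv)
        rw [pinv_mul_cancel_right]
      have h3 : q a = 0 := by
        have h4 : y s a = 0 := congrFun ha s
        rw [h2, pmap_apply, h4, map_zero]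
      obtain ⟨b, rfl⟩ := Ideal.mem_span_singleton'.1 (Ideal.Quotient.eq_zero_iff_mem.1 h3)
      rw [mul_assoc, ← map_mul, sub_mul, one_mul, delta_mul_delta, if_pos rfl, sub_self, map_zero,
        mul_zero]
    rw [← mul_one a, ← map_one p, ← sum_delta, map_sum, Finset.mul_sum]
    exact Finset.sum_eq_zero fun s _ => h1 s
  have hsurj : Function.Surjective e₁ := by
    have h1 : ∀ s (w : V), ∃ a, y s a = w := by
      intro s w
      obtain ⟨b, rfl⟩ := h.surjective w
      -- `T b` is the function h ↦ b(h s⁻¹); on the coset it takes the value b(u) at u·s.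
      let T : WithConv (A →ₐ[k] A) := toConv (AlgHom.id k A) * secPoint σ A s⁻¹
      have h2 : pmap (y s).ofConv T = I := by
        rw [pmap_mul, pmap_secPoint, ← pinv_secPoint]
        exact mul_pinv_cancel_right I (secPoint σ V s)
      exact ⟨T b, congrArg (fun x => x.ofConv b) h2⟩
    intro w
    choose a ha using fun s => h1 s (w s)
    refine ⟨∑ s, p (delta k s) * a s, ?_⟩
    funext t
    change e₀ (∑ s, p (delta k s) * a s) t = w t
    rw [he₀, map_sum, Finset.sum_eq_single t]
    · rw [map_mul, hy, delta_apply, if_pos rfl, map_one, one_mul, ha]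
    · intro s _ hs
      rw [map_mul, hy, delta_apply, if_neg hs.symm, map_zero, zero_mul]
    · simp
  refine ⟨ρ, BialgEquiv.ofBijective e₁ ⟨hinj, hsurj⟩, fun f => funext fun s => hy s f, fun f => ?_⟩
  change y 1 f = i f
  have h1 : y 1 = I := by
    change I * secPoint σ V 1 = I
    rw [secPoint_one, mul_one]
  rw [h1]
  rfl

end IsExtension

/-! ### Splitting, existence of completions, and the semidirect product -/

theorem mainTheorem12 (k : Type u) [Field k] [CharZero k]
    (S : Type u) [Group S] [Fintype S] [DecidableEq S] :
    -- every extension `1 ⟶ U ⟶ H ⟶ S ⟶ 1` with `U` prounipotent has a section `S ⟶ H`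
    (∀ (A B : Type u) [CommRing A] [HopfAlgebra k A] [CommRing B] [HopfAlgebra k B]
      (i : A →ₐc[k] B) (p : ConstCoord k S →ₐc[k] A), IsExtension i p → IsProunipotent k B →
        ∃ σ : A →ₐc[k] ConstCoord k S, σ.comp p = BialgHom.id k (ConstCoord k S)) ∧
    (∀ (G : Type u) [Group G] (φ : G →* S), Function.Surjective φ → φ.ker.FG →
      -- the prounipotent completion of the kernel of `φ` exists
      (∃ (V : Type u) (_ : CommRing V) (_ : HopfAlgebra k V) (ι : φ.ker →* Points k V),
        IsProunipotentCompletion ι) ∧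
      -- the relative completion of `φ` exists
      (∃ (A : Type u) (_ : CommRing A) (_ : HopfAlgebra k A) (p : ConstCoord k S →ₐc[k] A)
        (ψ : G →* Points k A), IsRelativeCompletion φ p ψ) ∧
      -- the latter is a semidirect product of the former with `S`, over `S` and under `φ.ker`
      (∀ (V A : Type u) [CommRing V] [HopfAlgebra k V] [CommRing A] [HopfAlgebra k A]
        (ι : φ.ker →* Points k V) (p : ConstCoord k S →ₐc[k] A) (ψ : G →* Points k A),
        IsProunipotentCompletion ι → IsRelativeCompletion φ p ψ →
          ∃ (ρ : S →* (V →ₐc[k] V)) (e : A ≃ₐc[k] SemidirectCoord ρ),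
            (∀ f : ConstCoord k S, e (p f) = SemidirectCoord.proj ρ f) ∧
            ∀ (x : φ.ker) (f : A), (ψ x) f = (ι x) (SemidirectCoord.inl ρ (e f)))) := by
  refine ⟨fun A B _ _ _ _ i p h hB => AffineGroup.exists_section h hB, fun G _ φ hφ hK => ?_⟩
  have hK' : Group.FG φ.ker := (Group.fg_iff_subgroup_fg _).2 hK
  refine ⟨?_, ?_, fun V A _ _ _ _ ι p ψ hV hA => ?_⟩
  · obtain ⟨V, _, _, ι, hι⟩ := exists_isUnipCoord k (⊤ : Subgroup φ.ker) hK'.out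
    exact ⟨V, inferInstance, inferInstance, ι, hι.isProunipotentCompletion⟩
  · obtain ⟨A, _, _, ψ, hψ⟩ := exists_isUnipCoord k φ.ker hK
    obtain ⟨p, hp⟩ := hψ.exists_proj
    exact ⟨A, inferInstance, inferInstance, p, ψ, hψ.isRelativeCompletion hφ hK hp⟩
  · obtain ⟨i, hi, hiψ⟩ := (hA.isUnipCoord hφ hK).exists_isExtension hφ hA.triangle.comm
      (hV.isUnipCoord hK')
    obtain ⟨σ, hσ⟩ := AffineGroup.exists_section hi hV.prounipotent
    obtain ⟨ρ, e, hp, he⟩ := hi.exists_equiv_semidirect hσ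
    exact ⟨ρ, e, hp, fun x f => by rw [he, hiψ]⟩
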